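/- **Setting.** Fix $T>0$ and observation times $0<t_1<\dots<t_n<T$, a Borel set $U\subset\mathbb R^{k_1}\times\mathbb R^{k_2}$ of control values $(\alpha,\beta)$, and Borel measurable data: a drift $b(x,\alpha)\in\mathbb R^d$ and a diffusion matrix $\sigma(x,\alpha)\in\mathbb R^{d\times m}$, with controlled generator $$\mathcal G(\alpha)\varphi=\sum_i b_i(\cdot,\alpha)\,\partial_i\varphi+\tfrac12\sum_{i,j}(\sigma\sigma^{\top})_{ij}(\cdot,\alpha)\,\partial_{ij}\varphi ;$$ costs $\ell(t,\mu,\alpha)$, $h(t_i,\mu,\beta)$, $g(\mu)$ with values in $[-\infty,\infty]$ for $\mu\in\mathcal P(\mathbb R^d)$ (the probability measures on $\mathbb R^d$ with the Borel sets of the weak topology); an observation function and independent random variables $\Gamma_1,\dots,\Gamma_n$, giving the observation $Y_i^{\beta,\mu}=Y(t_i,\mu,\beta,\Gamma_i)$; and an update kernel $K_\beta(x;\mu,y)\ge0$ such that, for all $i$, $\mu$ and $(\alpha,\beta)\in U$, almost surely $\int K_\beta(x;\mu,Y_i^{\beta,\mu})\,\mu(dx)=1$. **Controls.** For $0\le s\le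 t\le T$ and $\mu\in\mathcal P(\mathbb R^d)$, $\mathcal U[s,t]$ is the set of $u=(\alpha_r,\beta_r)_{s\le r\le t}$ with $(\alpha_r,\beta_r)\in U$ for all $r$, together with a state process $\mu^u_r=\mu^u_r(s,\mu)\in\mathcal P(\mathbb R^d)$, such that, with $\mathcal F_r=\sigma(Y_j: s<t_j\le r)$, $\mathcal F_{r^-}=\sigma(Y_j: s<t_j<r)$, $\beta_j:=\beta_{t_j}$ and $Y_j=Y_j^{\beta_j,\mu^u_{t_j^-}}$: * $\alpha$ and $\mu^u$ are progressively measurable with respect to $(\mathcal F_r)$; $\beta$ is $\mathcal F_{r^-}$-measurable at each $r$, left-continuous and piecewise constant with jumps only at observation times; $\mu^u_{t_j^-}$ is $\mathcal F_{t_j^-}$-measurable; * almost surely, $\mu^u_s=\mu$; between observation times $\mu^u$ solves $d\mu^u_r=\mathcal G^*(\alpha_r)\mu^u_r\,dr$ weakly, that is, $\int_s^t\!\int|\mathcal G(\alpha_r)\varphi|\,d\mu^u_r\,dr<\infty$ and $\int\varphi\,d\mu^u_{r_2}-\int\varphi\,d\mu^u_{r_1}=\int_{r_1}^{r_2}\!\int\mathcal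 G(\alpha_r)\varphi\,d\mu^u_r\,dr$ for all $\varphi\in C^2_c(\mathbb R^d)$ and all $s\le r_1\le r_2\le t$ with no observation time in $(r_1,r_2]$; and, at each $t_j\in(s,t]$, the weak left limit $\mu^u_{t_j^-}$ exists and $\mu^u_{t_j}(dx)=K_{\beta_j}(x;\mu^u_{t_j^-},Y_j)\,\mu^u_{t_j^-}(dx)$. (If the Fokker–Planck equation has several weak solutions, each of them is allowed as a state process of $u$.) **Value function.** $V(T,\mu)=g(\mu)$ and, for $s<T$, $$V(s,\mu)=\inf_{u\in\mathcal U[s,T]}\mathbb E\Big[\int_s^T\ell(r,\mu^u_r,\alpha_r)\,dr+\sum_{j:\,s<t_j\le T}h(t_j,\mu^u_{t_j^-},\beta_j)+g(\mu^u_T)\Big].$$ $V(t_i^-,\mu)$ denotes the value of the problem started at time $t_i$ just before the observation: the observation at $t_i$ is still to be made, $\mu^u_{t_i^-}=\mu$, $\beta_i$ is deterministic, and in the definitions above (controls on $[t_i,t]$, $\sigma$-algebras, cost) $s<t_j$ is replaced by $t_i\le t_j$. Infima over the empty set are $+\infty$, and integrals use the convention $\infty-\infty=+\infty$. Assume that the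 problem is well defined: for all $s\le t$ in $[0,T]$ and every admissible control on $[s,t]$ (started after or before an observation at $s$), the negative parts of the running cost, of the measurement costs and, if $t=T$, of the terminal cost have finite expectation; and $V(s,\mu)>-\infty$ for all $s\in[0,T]$ and all $\mu$. **Theorem (Dynamic Programming Principle).** Let $0\le s<T$, $\mu\in\mathcal P(\mathbb R^d)$ and $s\le t\le T$. If $t\notin\{t_1,\dots,t_n,T\}$, suppose in addition that $U=A\times B$ is a product. Then $$V(s,\mu)=\inf_{u\in\mathcal U[s,t]}\mathbb E\Big[\int_s^t\ell(r,\mu^u_r(s,\mu),\alpha_r)\,dr+\sum_{j:\,s<t_j\le t}h(t_j,\mu^u_{t_j^-}(s,\mu),\beta_j)+V\big(t,\mu^u_t(s,\mu)\big)\Big].$$ Moreover, for every $i$ and every $\mu\in\mathcal P(\mathbb R^d)$, $$V(t_i^-,\mu)=\inf_{(\alpha,\beta)\in U}\Big\{h(t_i,\mu,\beta)+\mathbb E\big[V\big(t_i,K_\beta(\cdot\,;\mu,Y_i^{\beta,\mu})\,\mu\big)\big]\Big\}.$$ -/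

import Mathlib

open MeasureTheory ProbabilityTheory Filter Topology
open scoped ENNReal

noncomputable section

namespace ObsControl

/-- The space `ℝᵏ`. -/
abbrev Vec (k : ℕ) := EuclideanSpace ℝ (Fin k)

/-- The space `𝒫(ℝᵈ)`, with the topology of weak convergence and its Borel sets. -/
abbrev Law (d : ℕ) := ProbabilityMeasure (Vec d)

/-- Integral of an extended real function: the integral of the positive part minus the integral of
the negative part, with the value `+∞` as soon as the positive part has integral `+∞`
(the usual convention `∞ - ∞ = +∞` of minimization problems). -/
def extIntegral {S : Type*} [MeasurableSpace S] (κ : Measure S) (f : S → EReal) : EReal :=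
  open Classical in
  if ∫⁻ x, (f x).toENNReal ∂κ = ∞ then ⊤
  else ((∫⁻ x, (f x).toENNReal ∂κ : ℝ≥0∞) : EReal) - ((∫⁻ x, (-f x).toENNReal ∂κ : ℝ≥0∞) : EReal)

/-- A function of two variables `(r, ω)` is progressively measurable on the time interval `[s, t]`
with respect to the family `F` of σ-algebras. -/
def ProgMeas {Ω E : Type*} [MeasurableSpace E] (F : ℝ → MeasurableSpace Ω) (s t : ℝ)
    (f : ℝ → Ω → E) : Prop :=
  ∀ r ∈ Set.Icc s t,
    Measurable[(inferInstance : MeasurableSpace (Set.Icc s r)).prod (F r)]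
      (fun p : Set.Icc s r × Ω => f p.1 p.2)

/-- The partial derivative `∂ᵢ f (y)`. -/
def pderiv {d : ℕ} (i : Fin d) (f : Vec d → ℝ) (y : Vec d) : ℝ :=
  fderiv ℝ f y (EuclideanSpace.single i 1)

/-- Whether the problem is started at time `s` just before the observation made at `s` (if there
is one), i.e. at `s⁻`, or just after it, i.e. at `s`. -/
inductive Phase
  | before
  | after

/-- The data of the control problem. The unobserved state lives in `ℝᵈ`, the driving noise in `ℝᵐ`,
observations in `𝒴`, and the observation noise in `G`. -/
structure Model (d m k₁ k₂ n : ℕ) (𝒴 G Ω : Type*)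
    [MeasurableSpace 𝒴] [MeasurableSpace G] [MeasurableSpace Ω] where
  /-- time horizon -/
  T : ℝ
  /-- observation times -/
  τ : Fin n → ℝ
  /-- set of admissible control values `(α, β)` -/
  U : Set (Vec k₁ × Vec k₂)
  /-- controlled drift -/
  b : Vec d → Vec k₁ → Vec d
  /-- controlled diffusion matrix -/
  σ : Vec d → Vec k₁ → Matrix (Fin d) (Fin m) ℝ
  /-- update kernel `K_β(x; μ, y)` -/
  K : Vec k₂ → Vec d → Law d → 𝒴 → ℝ≥0∞
  /-- the observation as a function of time, prior law, precision control, and noise variable -/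
  obs : ℝ → Law d → Vec k₂ → G → 𝒴
  /-- running cost -/
  ℓ : ℝ → Law d → Vec k₁ → EReal
  /-- cost of a measurement -/
  h : ℝ → Law d → Vec k₂ → EReal
  /-- terminal cost -/
  g : Law d → EReal
  /-- the underlying probability -/
  P : Measure Ω
  /-- the random variables driving the observations -/
  Γ : Fin n → Ω → G

/-- A control `u = (α, β)` together with a state process `X` (`= μᵘ`) and its values `Xm j`
(`= μᵘ` at `τⱼ⁻`) just before the observation times. -/
structure Controlled (d k₁ k₂ n : ℕ) (Ω : Type*) where
  α : ℝ → Ω → Vec k₁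
  β : ℝ → Ω → Vec k₂
  X : ℝ → Ω → Law d
  Xm : Fin n → Ω → Law d

namespace Model

variable {d m k₁ k₂ n : ℕ} {𝒴 G Ω : Type*}
  [MeasurableSpace 𝒴] [MeasurableSpace G] [MeasurableSpace Ω]

/-- Standing assumptions: ordered observation times inside `(0, T)`, Borel data, independent
noise variables, and update kernels that are probability densities with respect to the prior. -/
structure Standing (M : Model d m k₁ k₂ n 𝒴 G Ω) : Prop where
  T_pos : 0 < M.T
  τ_mono : StrictMono M.τ
  τ_mem : ∀ j, M.τ j ∈ Set.Ioo 0 M.T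
  meas_U : MeasurableSet M.U
  meas_b : Measurable fun p : Vec d × Vec k₁ => M.b p.1 p.2
  meas_σ : ∀ i j, Measurable fun p : Vec d × Vec k₁ => M.σ p.1 p.2 i j
  meas_K : Measurable fun p : Vec k₂ × Vec d × Law d × 𝒴 => M.K p.1 p.2.1 p.2.2.1 p.2.2.2
  meas_obs : ∀ j, Measurable fun p : Law d × Vec k₂ × G => M.obs (M.τ j) p.1 p.2.1 p.2.2
  meas_ℓ : Measurable fun p : ℝ × Law d × Vec k₁ => M.ℓ p.1 p.2.1 p.2.2
  meas_h : ∀ j, Measurable fun p : Law d × Vec k₂ => M.h (M.τ j) p.1 p.2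
  meas_g : Measurable M.g
  prob : IsProbabilityMeasure M.P
  meas_Γ : ∀ j, Measurable (M.Γ j)
  indep : iIndepFun M.Γ M.P
  normalized : ∀ j, ∀ ν : Law d, ∀ c ∈ M.U,
    ∀ᵐ ω ∂M.P, ∫⁻ x, M.K c.2 x ν (M.obs (M.τ j) ν c.2 (M.Γ j ω)) ∂(ν : Measure (Vec d)) = 1

variable (M : Model d m k₁ k₂ n 𝒴 G Ω)

/-- The controlled generator
`𝒢(a) φ = ∑ᵢ bᵢ(·, a) ∂ᵢφ + ½ ∑ᵢⱼ (σ σᵀ)ᵢⱼ(·, a) ∂ᵢⱼφ`. -/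
def gen (a : Vec k₁) (φ : Vec d → ℝ) (y : Vec d) : ℝ :=
  ∑ i, M.b y a i * pderiv i φ y
    + (1 / 2) * ∑ i, ∑ j, (M.σ y a * (M.σ y a).transpose) i j * pderiv i (pderiv j φ) y

/-- The updated law `K_β(·; ν, y) ν`. (It is a probability measure for almost every observation,
by normalization; on the exceptional null set the value is irrelevant.) -/
def update (β : Vec k₂) (ν : Law d) (y : 𝒴) : Law d :=
  open Classical in
  if hp : IsProbabilityMeasure ((ν : Measure (Vec d)).withDensity fun x => M.K β x ν y) then
    ⟨(ν : Measure (Vec d)).withDensity fun x => M.K β x ν y, hp⟩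
  else ν

theorem coe_update (β : Vec k₂) (ν : Law d) (y : 𝒴)
    (hp : IsProbabilityMeasure ((ν : Measure (Vec d)).withDensity fun x => M.K β x ν y)) :
    (M.update β ν y : Measure (Vec d)) = (ν : Measure (Vec d)).withDensity fun x => M.K β x ν y :=
  congrArg (fun ρ : Law d => (ρ : Measure (Vec d))) (dif_pos hp)

/-- The (indices of the) observations made during `[s, t]`; the one at time `s`, if any, is counted
exactly when the problem is started before it. -/
def window (ph : Phase) (s t : ℝ) : Finset (Fin n) :=
  open Classical in
  Finset.univ.filter fun j => (s < M.τ j ∨ (ph = Phase.before ∧ M.τ j = s)) ∧ M.τ j ≤ t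

/-- `IsTrajectory ph s t μ a x xm β y`: along one realization, with control path `a`, precision
controls `β j` and observations `y j`, the path `x` on `[s, t]` starts from `μ`, is a weak solution
of the Fokker-Planck equation `dx = 𝒢*(a) x dr` between observation times, and is updated at
observation times, `xm j` being its value just before the `j`-th observation. -/
structure IsTrajectory (ph : Phase) (s t : ℝ) (μ : Law d) (a : ℝ → Vec k₁) (x : ℝ → Law d)
    (xm : Fin n → Law d) (β : Fin n → Vec k₂) (y : Fin n → 𝒴) : Prop where
  start : (∀ j ∈ M.window ph s t, M.τ j ≠ s) → x s = μ
  start_before : ∀ j ∈ M.window ph s t, M.τ j = s → xm j = μ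
  integrable : ∀ φ : Vec d → ℝ, ContDiff ℝ 2 φ → HasCompactSupport φ →
    ∫⁻ r in Set.Icc s t, ∫⁻ z, ‖M.gen (a r) φ z‖ₑ ∂(x r : Measure (Vec d)) < ∞
  fokker_planck : ∀ r₁ r₂, s ≤ r₁ → r₁ ≤ r₂ → r₂ ≤ t →
    (∀ j ∈ M.window ph s t, ¬ (r₁ < M.τ j ∧ M.τ j ≤ r₂)) →
    ∀ φ : Vec d → ℝ, ContDiff ℝ 2 φ → HasCompactSupport φ →
      ∫ z, φ z ∂(x r₂ : Measure (Vec d)) = ∫ z, φ z ∂(x r₁ : Measure (Vec d))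
        + ∫ r in r₁..r₂, ∫ z, M.gen (a r) φ z ∂(x r : Measure (Vec d))
  left_limit : ∀ j ∈ M.window ph s t, s < M.τ j → Tendsto x (𝓝[<] (M.τ j)) (𝓝 (xm j))
  jump : ∀ j ∈ M.window ph s t, x (M.τ j) = M.update (β j) (xm j) (y j)

/-- The observation `Yⱼ`, a function of time, prior law, precision control and `Γⱼ`. -/
def Y (u : Controlled d k₁ k₂ n Ω) (j : Fin n) (ω : Ω) : 𝒴 :=
  M.obs (M.τ j) (u.Xm j ω) (u.β (M.τ j) ω) (M.Γ j ω)

/-- `𝓕ᵣ`, generated by the observations made up to (and including) time `r` since the start. -/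
@[reducible] def sigmaAt (ph : Phase) (s t : ℝ) (u : Controlled d k₁ k₂ n Ω) (r : ℝ) : MeasurableSpace Ω :=
  ⨆ j ∈ M.window ph s t, ⨆ _ : M.τ j ≤ r, MeasurableSpace.comap (M.Y u j) inferInstance

/-- `𝓕` at `r⁻`, generated by the observations made strictly before time `r` since the start. -/
@[reducible] def sigmaBefore (ph : Phase) (s t : ℝ) (u : Controlled d k₁ k₂ n Ω) (r : ℝ) : MeasurableSpace Ω :=
  ⨆ j ∈ M.window ph s t, ⨆ _ : M.τ j < r, MeasurableSpace.comap (M.Y u j) inferInstance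

/-- Admissible controls on `[s, t]` with initial law `μ`, together with their state process. -/
structure Admissible (ph : Phase) (s t : ℝ) (μ : Law d) (u : Controlled d k₁ k₂ n Ω) : Prop where
  α_adapted : ProgMeas (M.sigmaAt ph s t u) s t u.α
  /-- `β` is left-continuous and piecewise constant, jumping only at observation times -/
  β_piecewise : ∀ r₁ r₂, s ≤ r₁ → r₁ ≤ r₂ → r₂ ≤ t →
    (∀ j ∈ M.window ph s t, ¬ (r₁ ≤ M.τ j ∧ M.τ j < r₂)) → u.β r₁ = u.β r₂
  β_predictable : ∀ r ∈ Set.Icc s t, Measurable[M.sigmaBefore ph s t u r] (u.β r)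
  mem_U : ∀ r ∈ Set.Icc s t, ∀ ω, (u.α r ω, u.β r ω) ∈ M.U
  X_adapted : ProgMeas (M.sigmaAt ph s t u) s t u.X
  Xm_adapted : ∀ j ∈ M.window ph s t, Measurable[M.sigmaBefore ph s t u (M.τ j)] (u.Xm j)
  dynamics : ∀ᵐ ω ∂M.P, M.IsTrajectory ph s t μ (fun r => u.α r ω) (fun r => u.X r ω)
    (fun j => u.Xm j ω) (fun j => u.β (M.τ j) ω) (fun j => M.Y u j ω)

/-- The class `𝒰[s, t]` (for the initial law `μ`). -/
def controls (ph : Phase) (s t : ℝ) (μ : Law d) : Set (Controlled d k₁ k₂ n Ω) :=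
  {u | M.Admissible ph s t μ u}

/-- Pathwise cost accumulated on `[s, t]`: running cost plus cost of the measurements. -/
def runCost (ph : Phase) (s t : ℝ) (u : Controlled d k₁ k₂ n Ω) (ω : Ω) : EReal :=
  extIntegral (volume.restrict (Set.Icc s t)) (fun r => M.ℓ r (u.X r ω) (u.α r ω))
    + ∑ j ∈ M.window ph s t, M.h (M.τ j) (u.Xm j ω) (u.β (M.τ j) ω)

/-- The cost functional `J(s, ·; u)`. -/
def J (ph : Phase) (s : ℝ) (u : Controlled d k₁ k₂ n Ω) : EReal :=
  extIntegral M.P fun ω => M.runCost ph s M.T u ω + M.g (u.X M.T ω)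

/-- The value function of the problem started at `s` (after or before the observation at `s`). -/
def value (ph : Phase) (s : ℝ) (μ : Law d) : EReal :=
  open Classical in
  if s < M.T then ⨅ u ∈ M.controls ph s M.T μ, M.J ph s u else M.g μ

/-- The value function `V(s, μ)`. -/
def V (s : ℝ) (μ : Law d) : EReal := M.value Phase.after s μ

/-- The value `V(s⁻, μ)`, of the problem started just before the observation made at time `s`. -/
def Vleft (s : ℝ) (μ : Law d) : EReal := M.value Phase.before s μ

/-- Expected total negative part of the costs on `[s, t]` (with the terminal cost if `t = T`). -/
def negCost (ph : Phase) (s t : ℝ) (u : Controlled d k₁ k₂ n Ω) : ℝ≥0∞ :=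
  open Classical in
  ∫⁻ ω, ((∫⁻ r in Set.Icc s t, (-M.ℓ r (u.X r ω) (u.α r ω)).toENNReal)
    + ∑ j ∈ M.window ph s t, (-M.h (M.τ j) (u.Xm j ω) (u.β (M.τ j) ω)).toENNReal
    + if t = M.T then (-M.g (u.X t ω)).toENNReal else 0) ∂M.P

/-- The optimization problem is well defined: the negative parts of the costs have finite
expectation for every admissible control, and the value function never equals `-∞`. -/
structure WellDefined : Prop where
  negCost_lt : ∀ ph s t μ, 0 ≤ s → s ≤ t → t ≤ M.T →
    ∀ u ∈ M.controls ph s t μ, M.negCost ph s t u < ∞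
  V_ne_bot : ∀ s μ, 0 ≤ s → s ≤ M.T → M.V s μ ≠ ⊥

end Model

end ObsControl

end

/-! Between consecutive observation times no information arrives. For a fixed realization, a control
is there just a deterministic control path with a solution of the Fokker-Planck equation and one
precision. The noise of the next observation is independent of whatever determined the law and the
precision just before it (`Standing.indep_noise`, `Standing.map_post`), so the future depends on the
past only through the current law. Hence the value at t is the infimum, over deterministic paths up
to the next observation time t' (or T), of the cost of the path plus the mean of the value at t'
under the update kernel. This operator is `bellman`, and the principle follows by backward induction
over the observation times.

One inequality is pathwise: almost every realization of an admissible process competes in the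
one-step infimum (`Step.bellman_le`). Integration, with independence turning kernel means into
expectations (`Step.extIntegral_X`), gives the lower bound `Step.bellman_lower`.

The other inequality pastes near-optimal continuations, chosen measurably in the law at t. The value
function need not be Borel, and neither compactness nor uniqueness for the Fokker-Planck equation is
available, so the selection rests on descriptive set theory. Paths are coded by points of a Polish
space, through one measurable map that evaluates all measurable functions up to null sets
(`exists_universal_evaluation`). Codes of genuine solutions form a Borel set
(`measurableSet_validCode`), because the weak equation reduces to countably many conditions. The
value is propagated as an infimum over the Baire space of a Borel function (`InfProj`); such
functions are measurable for the completion of every finite measure, and ε-optimal points can be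
chosen by Borel maps off a null set (`exists_measurable_lt`). The induction carries the package
`Programmable` back across one step (`Step.programmable`).

Pasting (`extend`) keeps the old process up to t and then follows the selected code. The precision
must be constant since the last observation, so when t lies strictly between observations the new
precision also replaces the old one on the stretch before t. This anticipates nothing and costs
nothing, but it pairs old values of α with a new β; the product form of U is used exactly here.

Infinite values are handled by integrability of negative parts. For costs this is the well-posedness
assumption, applied also to pasted controls; for the value function it is deduced from near-optimal
pasted controls. -/

noncomputable section

namespace ObsControl

/-! ### Integrals of extended real functions. -/

section ExtIntegral

variable {S : Type*} [MeasurableSpace S] {κ : Measure S} {f g : S → EReal}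

theorem extIntegral_of_neg_ne_top (h : ∫⁻ x, (-f x).toENNReal ∂κ ≠ ∞) :
    extIntegral κ f = ((∫⁻ x, (f x).toENNReal ∂κ : ℝ≥0∞) : EReal)
      - ((∫⁻ x, (-f x).toENNReal ∂κ : ℝ≥0∞) : EReal) := by
  unfold extIntegral
  split_ifs with h1
  · rw [h1]
    lift (∫⁻ x, (-f x).toENNReal ∂κ) to NNReal using h with N
    rfl
  · rfl

theorem extIntegral_of_pos_eq_top (h : ∫⁻ x, (f x).toENNReal ∂κ = ∞) :
    extIntegral κ f = ⊤ := if_pos h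

theorem ennreal_sub_nnreal_ne_bot (A : ℝ≥0∞) (M : NNReal) :
    (A : EReal) - ((M : ℝ≥0∞) : EReal) ≠ ⊥ := by
  induction A with
  | top => exact top_ne_bot
  | coe a => exact EReal.coe_ne_bot ((a : ℝ) - M)

theorem extIntegral_ne_bot (h : ∫⁻ x, (-f x).toENNReal ∂κ ≠ ∞) : extIntegral κ f ≠ ⊥ := by
  rw [extIntegral_of_neg_ne_top h]
  lift (∫⁻ x, (-f x).toENNReal ∂κ) to NNReal using h with N
  exact ennreal_sub_nnreal_ne_bot _ _

theorem extIntegral_mono_ae (h : ∀ᵐ x ∂κ, f x ≤ g x) : extIntegral κ f ≤ extIntegral κ g := by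
  have h1 : ∫⁻ x, (f x).toENNReal ∂κ ≤ ∫⁻ x, (g x).toENNReal ∂κ :=
    lintegral_mono_ae (h.mono fun x hx => EReal.toENNReal_le_toENNReal hx)
  have h2 : ∫⁻ x, (-g x).toENNReal ∂κ ≤ ∫⁻ x, (-f x).toENNReal ∂κ :=
    lintegral_mono_ae (h.mono fun x hx =>
      EReal.toENNReal_le_toENNReal (EReal.neg_le_neg_iff.2 hx))
  by_cases hg : ∫⁻ x, (g x).toENNReal ∂κ = ∞
  · rw [extIntegral_of_pos_eq_top hg]; exact le_top
  · have hf : ∫⁻ x, (f x).toENNReal ∂κ ≠ ∞ := ne_top_of_le_ne_top hg h1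
    unfold extIntegral
    rw [if_neg hf, if_neg hg]
    exact EReal.sub_le_sub (by exact_mod_cast h1) (by exact_mod_cast h2)

theorem extIntegral_congr_ae (h : ∀ᵐ x ∂κ, f x = g x) : extIntegral κ f = extIntegral κ g :=
  le_antisymm (extIntegral_mono_ae (h.mono fun _ hx => hx.le))
    (extIntegral_mono_ae (h.mono fun _ hx => hx.ge))

theorem extIntegral_zero : extIntegral κ (fun _ => 0) = 0 := by
  rw [extIntegral_of_neg_ne_top] <;> simp

/-- A measurable extended real function whose negative part is integrable. -/
structure LowerIntegrable (κ : Measure S) (f : S → EReal) : Prop where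
  aemeasurable : AEMeasurable f κ
  neg_ne_top : ∫⁻ x, (-f x).toENNReal ∂κ ≠ ∞

theorem LowerIntegrable.ae_ne_bot (h : LowerIntegrable κ f) : ∀ᵐ x ∂κ, f x ≠ ⊥ := by
  have h1 := ae_lt_top' (h.aemeasurable.neg.ereal_toENNReal) h.neg_ne_top
  filter_upwards [h1] with x hx hb
  simp [hb] at hx

theorem LowerIntegrable.extIntegral_ne_bot (h : LowerIntegrable κ f) : extIntegral κ f ≠ ⊥ :=
  ObsControl.extIntegral_ne_bot h.neg_ne_top

theorem ae_lt_top_of_pos_ne_top (hf : AEMeasurable f κ) (h : ∫⁻ x, (f x).toENNReal ∂κ ≠ ∞) :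
    ∀ᵐ x ∂κ, f x < ⊤ := by
  filter_upwards [ae_lt_top' hf.ereal_toENNReal h] with x hx
  rw [lt_top_iff_ne_top]
  intro hb
  simp [hb] at hx

theorem extIntegral_eq_top_of_not_ae (hf : AEMeasurable f κ) (h : ¬ ∀ᵐ x ∂κ, f x < ⊤) :
    extIntegral κ f = ⊤ :=
  extIntegral_of_pos_eq_top (by
    by_contra hne
    exact h (ae_lt_top_of_pos_ne_top hf hne))

theorem LowerIntegrable.congr (h : LowerIntegrable κ f) (hfg : ∀ᵐ x ∂κ, f x = g x) :
    LowerIntegrable κ g :=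
  ⟨h.aemeasurable.congr hfg, by
    have := lintegral_congr_ae (μ := κ) (f := fun x => (-f x).toENNReal)
      (g := fun x => (-g x).toENNReal) (hfg.mono fun x hx => by simp only [hx])
    rw [← this]; exact h.neg_ne_top⟩

/-- Being free of subtractions, this identity integrates in `ℝ≥0∞` without any finiteness. The value
`⊥` is excluded because `⊤ + ⊥ = ⊥` in `EReal`, against the convention built into `extIntegral`. -/
theorem toENNReal_add_identity {x y : EReal} (hx : x ≠ ⊥) (hy : y ≠ ⊥) :
    (x + y).toENNReal + (-x).toENNReal + (-y).toENNReal
      = (-(x + y)).toENNReal + x.toENNReal + y.toENNReal := by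
  induction x with
  | bot => exact absurd rfl hx
  | top => rw [EReal.top_add_of_ne_bot hy]; simp
  | coe a =>
    induction y with
    | bot => exact absurd rfl hy
    | top => simp
    | coe b =>
      norm_cast
      simp only [EReal.real_coe_toENNReal]
      have key : ∀ r : ℝ, ENNReal.ofReal r = ((max r 0).toNNReal : ℝ≥0∞) := by
        intro r; rw [← ENNReal.ofReal]; rw [ENNReal.ofReal_max]; simp
      have e : ∀ p q r : ℝ, ENNReal.ofReal p + ENNReal.ofReal q + ENNReal.ofReal r
          = ENNReal.ofReal (max p 0 + max q 0 + max r 0) := by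
        intro p q r
        rw [ENNReal.ofReal_add (by positivity) (by positivity),
          ENNReal.ofReal_add (by positivity) (by positivity)]
        simp [ENNReal.ofReal_max]
      rw [e, e]
      congr 1
      rcases le_total a 0 with ha | ha <;> rcases le_total b 0 with hb | hb <;>
        rcases le_total (a + b) 0 with hc | hc <;>
        simp only [max_eq_left, max_eq_right, ha, hb, hc, Left.nonneg_neg_iff, Left.neg_nonpos_iff] <;>
        ring

theorem neg_toENNReal_add_le {x y : EReal} (hx : x ≠ ⊥) (hy : y ≠ ⊥) :
    (-(x + y)).toENNReal ≤ (-x).toENNReal + (-y).toENNReal := by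
  rw [EReal.neg_add (Or.inl hx) (Or.inr hy), sub_eq_add_neg]
  exact EReal.toENNReal_add_le

theorem coe_sub_eq_add_sub {P N P₁ N₁ P₂ N₂ : ℝ≥0∞} (h : P + N₁ + N₂ = N + P₁ + P₂)
    (hN : N ≠ ∞) (hN₁ : N₁ ≠ ∞) (hN₂ : N₂ ≠ ∞) :
    (P : EReal) - N = ((P₁ : EReal) - N₁) + ((P₂ : EReal) - N₂) := by
  lift N to NNReal using hN
  lift N₁ to NNReal using hN₁
  lift N₂ to NNReal using hN₂
  have hs : ∀ M : NNReal, ((⊤ : ℝ≥0∞) : EReal) - ((M : ℝ≥0∞) : EReal) = ⊤ := fun M => rfl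
  have hnb := ennreal_sub_nnreal_ne_bot
  induction P₁ with
  | top =>
    have : P = ⊤ := by
      simpa [ENNReal.add_eq_top] using h
    rw [this, hs, hs, EReal.top_add_of_ne_bot (hnb _ _)]
  | coe p₁ =>
    induction P₂ with
    | top =>
      have : P = ⊤ := by
        simpa [ENNReal.add_eq_top] using h
      rw [this, hs, hs, EReal.add_top_of_ne_bot (hnb _ _)]
    | coe p₂ =>
      have hP : P ≠ ⊤ := by
        rintro rfl
        simp at h
        exact absurd h (by exact_mod_cast ENNReal.coe_ne_top.symm)
      lift P to NNReal using hP
      have h' : P + N₁ + N₂ = N + p₁ + p₂ := by exact_mod_cast h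
      have h'' : (P : ℝ) + N₁ + N₂ = N + p₁ + p₂ := by exact_mod_cast h'
      have e : ∀ A B : NNReal, ((A : ℝ≥0∞) : EReal) - ((B : ℝ≥0∞) : EReal)
          = ((A - B : ℝ) : EReal) := fun A B => rfl
      rw [e, e, e, ← EReal.coe_add]
      congr 1
      linarith

theorem LowerIntegrable.add (hf : LowerIntegrable κ f) (hg : LowerIntegrable κ g) :
    LowerIntegrable κ (fun x => f x + g x) := by
  refine ⟨hf.aemeasurable.add hg.aemeasurable, ?_⟩
  have h : ∫⁻ x, (-(f x + g x)).toENNReal ∂κ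
      ≤ ∫⁻ x, (-f x).toENNReal + (-g x).toENNReal ∂κ := by
    apply lintegral_mono_ae
    filter_upwards [hf.ae_ne_bot, hg.ae_ne_bot] with x h1 h2
    exact neg_toENNReal_add_le h1 h2
  have mf' := hf.aemeasurable.neg.ereal_toENNReal
  simp only [Pi.neg_apply] at mf'
  rw [lintegral_add_left' mf'] at h
  exact ne_top_of_le_ne_top (ENNReal.add_ne_top.2 ⟨hf.neg_ne_top, hg.neg_ne_top⟩) h

/-- The subtraction-free identity is integrated first; only then are the three negative parts, whose
integrals are finite, moved across. -/
theorem extIntegral_add (hf : LowerIntegrable κ f) (hg : LowerIntegrable κ g) :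
    extIntegral κ (fun x => f x + g x) = extIntegral κ f + extIntegral κ g := by
  have hfg := hf.add hg
  rw [extIntegral_of_neg_ne_top hf.neg_ne_top, extIntegral_of_neg_ne_top hg.neg_ne_top,
    extIntegral_of_neg_ne_top hfg.neg_ne_top]
  refine coe_sub_eq_add_sub ?_ hfg.neg_ne_top hf.neg_ne_top hg.neg_ne_top
  have mf := hf.aemeasurable.ereal_toENNReal
  have mg := hg.aemeasurable.ereal_toENNReal
  have mf' := hf.aemeasurable.neg.ereal_toENNReal
  have mg' := hg.aemeasurable.neg.ereal_toENNReal
  have ms := hfg.aemeasurable.ereal_toENNReal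
  have ms' := hfg.aemeasurable.neg.ereal_toENNReal
  simp only [Pi.neg_apply] at mf' mg' ms'
  rw [← lintegral_add_left' ms, ← lintegral_add_right' _ mg', ← lintegral_add_left' ms',
    ← lintegral_add_right' _ mg]
  apply lintegral_congr_ae
  filter_upwards [hf.ae_ne_bot, hg.ae_ne_bot] with x h1 h2
  exact toENNReal_add_identity h1 h2

theorem lowerIntegrable_const [IsFiniteMeasure κ] {c : EReal} (hc : c ≠ ⊥) :
    LowerIntegrable κ (fun _ => c) := by
  refine ⟨aemeasurable_const, ?_⟩
  rw [lintegral_const]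
  refine ENNReal.mul_ne_top ?_ (measure_ne_top _ _)
  rw [EReal.toENNReal_ne_top_iff]
  simpa [EReal.neg_eq_top_iff] using hc

theorem extIntegral_const [IsProbabilityMeasure κ] (c : EReal) :
    extIntegral κ (fun _ => c) = c := by
  unfold extIntegral
  simp only [lintegral_const, measure_univ, mul_one]
  split_ifs with h
  · exact (EReal.toENNReal_eq_top_iff.1 h).symm
  · induction c with
    | bot => simp
    | top => simp at h
    | coe a =>
      rw [EReal.coe_toENNReal_eq_max, EReal.coe_toENNReal_eq_max]
      rcases le_total a 0 with ha | ha
      · have h1 : (a : EReal) ≤ 0 := by exact_mod_cast ha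
        have h2 : (0 : EReal) ≤ -(a : EReal) := by
          rw [← EReal.coe_neg]; exact_mod_cast (neg_nonneg.2 ha)
        rw [max_eq_left h1, max_eq_right h2]
        simp
      · have h1 : (0 : EReal) ≤ a := by exact_mod_cast ha
        have h2 : -(a : EReal) ≤ 0 := by
          rw [← EReal.coe_neg]; exact_mod_cast (neg_nonpos.2 ha)
        rw [max_eq_right h1, max_eq_left h2]
        simp

/-- Lower integrability is not needed: an infinite positive part makes the right side `⊤`, and an
infinite negative part beside a finite positive part survives the shift by a constant, making the
left side `⊥`. -/
theorem extIntegral_add_real_le [IsProbabilityMeasure κ] (hf : AEMeasurable f κ) (ε : ℝ) :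
    extIntegral κ (fun x => f x + ε) ≤ extIntegral κ f + ε := by
  by_cases hp : ∫⁻ x, (f x).toENNReal ∂κ = ∞
  · rw [extIntegral_of_pos_eq_top hp]; simp
  by_cases hn : ∫⁻ x, (-f x).toENNReal ∂κ = ∞
  · have hp' : ∫⁻ x, (f x + ε).toENNReal ∂κ ≠ ∞ := by
      have : ∫⁻ x, (f x + ε).toENNReal ∂κ ≤ ∫⁻ x, (f x).toENNReal + ENNReal.ofReal ε ∂κ :=
        lintegral_mono fun x => by
          simpa using EReal.toENNReal_add_le (x := f x) (y := (ε : EReal))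
      rw [lintegral_add_right _ measurable_const] at this
      refine ne_top_of_le_ne_top (ENNReal.add_ne_top.2 ⟨hp, ?_⟩) this
      simp
    have hn' : ∫⁻ x, (-(f x + ε)).toENNReal ∂κ = ∞ := by
      by_contra hne
      have : ∫⁻ x, (-f x).toENNReal ∂κ
          ≤ ∫⁻ x, (-(f x + ε)).toENNReal + ENNReal.ofReal ε ∂κ := by
        apply lintegral_mono fun x => ?_
        have h1 : -f x = -(f x + ε) + ε := by
          rw [EReal.neg_add (Or.inr (by simp)) (Or.inr (by simp)), EReal.sub_add_cancel]
        conv_lhs => rw [h1]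
        simpa using EReal.toENNReal_add_le (x := -(f x + ε)) (y := (ε : EReal))
      rw [lintegral_add_right _ measurable_const, hn] at this
      have h2 : ∫⁻ x, (-(f x + ε)).toENNReal ∂κ + ∫⁻ _, ENNReal.ofReal ε ∂κ ≠ ∞ :=
        ENNReal.add_ne_top.2 ⟨hne, by simp⟩
      exact h2 (top_le_iff.1 this)
    unfold extIntegral
    rw [if_neg hp', hn']
    simp
  · rw [extIntegral_add ⟨hf, hn⟩ (lowerIntegrable_const (EReal.coe_ne_bot ε)),
      extIntegral_const]

end ExtIntegral

end ObsControl

namespace ObsControl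

/-! ### Measurable sections of continuous maps from the Baire space. -/

section Selection

/-- A continuous injection of the Baire space into the real line. -/
def baireToReal (x : ℕ → ℕ) : ℝ :=
  Cardinal.cantorFunction (1 / 3) fun m => decide (x (Nat.unpair m).1 = (Nat.unpair m).2)

/-- A sequence is encoded by the indicator of its graph: the digit at `Nat.pair i (x i)` is `true`
for x, hence for y, which says `y i = x i`. The ratio 1/3 < 1/2 makes digit expansions unique. -/
theorem baireToReal_injective : Function.Injective baireToReal := by
  intro x y hxy
  have h := Cardinal.cantorFunction_injective (c := 1 / 3) (by norm_num) (by norm_num) hxy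
  funext i
  have h1 := congrFun h (Nat.pair i (x i))
  simp only [Nat.unpair_pair, decide_true] at h1
  exact (of_decide_eq_true h1.symm).symm

theorem continuous_baireToReal : Continuous baireToReal := by
  unfold baireToReal Cardinal.cantorFunction
  refine continuous_tsum (u := fun n : ℕ => ((1 : ℝ) / 3) ^ n) (fun n => ?_)
    (summable_geometric_of_lt_one (by norm_num) (by norm_num)) fun n x => ?_
  · have : Continuous fun k : ℕ => Cardinal.cantorFunctionAux (1 / 3)
        (fun _ => decide (k = (Nat.unpair n).2)) n := continuous_of_discreteTopology
    exact this.comp (continuous_apply (Nat.unpair n).1)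
  · unfold Cardinal.cantorFunctionAux
    rw [Real.norm_eq_abs, Bool.cond_eq_ite]
    split_ifs
    · rw [abs_of_nonneg (by positivity)]
    · rw [abs_zero]; positivity

theorem measurableEmbedding_baireToReal : MeasurableEmbedding baireToReal :=
  continuous_baireToReal.measurableEmbedding baireToReal_injective

variable {S : Type*} [TopologicalSpace S] [PolishSpace S] [MeasurableSpace S] [BorelSpace S]

/-- Capacitability of analytic sets. Coordinates are bounded one after the other, keeping the outer
measure of the image above c by continuity from below along arbitrary increasing sets. The resulting
box K is compact, and its image contains the intersection of the closures of the intermediate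
images, to which continuity from above applies. -/
theorem exists_compact_measure_image {h : (ℕ → ℕ) → S} (hh : Continuous h) (ρ : Measure S)
    [IsFiniteMeasure ρ] {c : ℝ≥0∞} (hc : c < ρ (Set.range h)) :
    ∃ K : Set (ℕ → ℕ), IsCompact K ∧ c ≤ ρ (h '' K) := by
  have step : ∀ (n : ℕ) (D : Set (ℕ → ℕ)), ∃ m : ℕ,
      c < ρ (h '' D) → c < ρ (h '' (D ∩ {x | x n ≤ m})) := by
    intro n D
    by_cases hD : c < ρ (h '' D)
    · have hU : h '' D = ⋃ m : ℕ, h '' (D ∩ {x | x n ≤ m}) := by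
        rw [← Set.image_iUnion, ← Set.inter_iUnion]
        congr 1
        ext x
        simp only [Set.mem_inter_iff, Set.mem_iUnion, Set.mem_ofPred_eq]
        exact ⟨fun hx => ⟨hx, x n, le_rfl⟩, fun hx => hx.1⟩
      have hmono : Monotone fun m : ℕ => h '' (D ∩ {x | x n ≤ m}) := by
        intro a b hab
        refine Set.image_mono (Set.inter_subset_inter_right _ ?_)
        intro x hx
        exact le_trans hx hab
      rw [hU, hmono.measure_iUnion] at hD
      obtain ⟨m, hm⟩ := lt_iSup_iff.1 hD
      exact ⟨m, fun _ => hm⟩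
    · exact ⟨0, fun hD' => absurd hD' hD⟩
  choose m hm using step
  let D : ℕ → Set (ℕ → ℕ) := fun n => Nat.rec Set.univ (fun n D => D ∩ {x | x n ≤ m n D}) n
  have hD0 : D 0 = Set.univ := rfl
  have hDs : ∀ n, D (n + 1) = D n ∩ {x | x n ≤ m n (D n)} := fun n => rfl
  have hcD : ∀ n, c < ρ (h '' D n) := by
    intro n
    induction n with
    | zero => rw [hD0, Set.image_univ]; exact hc
    | succ n ih => rw [hDs]; exact hm n _ ih
  set k : ℕ → ℕ := fun n => m n (D n) with hk
  have hDmem : ∀ n x, x ∈ D n ↔ ∀ i < n, x i ≤ k i := by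
    intro n x
    induction n with
    | zero => simp [hD0]
    | succ n ih =>
      rw [hDs, Set.mem_inter_iff, ih]
      simp only [Set.mem_ofPred_eq]
      constructor
      · rintro ⟨h1, h2⟩ i hi
        rcases Nat.lt_succ_iff_lt_or_eq.1 hi with hi | rfl
        · exact h1 i hi
        · exact h2
      · intro h1
        exact ⟨fun i hi => h1 i (by omega), h1 n (by omega)⟩
  let K : Set (ℕ → ℕ) := Set.univ.pi fun i => Set.Iic (k i)
  have hK : IsCompact K := isCompact_univ_pi fun i => (Set.finite_Iic (k i)).isCompact
  refine ⟨K, hK, ?_⟩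
  let := TopologicalSpace.upgradeIsCompletelyMetrizable S
  have hsub : ⋂ n, closure (h '' D n) ⊆ h '' K := by
    intro s hs
    rw [Set.mem_iInter] at hs
    have hex : ∀ n : ℕ, ∃ x ∈ D n, dist s (h x) < 1 / ((n : ℝ) + 1) := by
      intro n
      obtain ⟨y, ⟨x, hx, rfl⟩, hy⟩ := Metric.mem_closure_iff.1 (hs n) (1 / ((n : ℝ) + 1))
        (by positivity)
      exact ⟨x, hx, hy⟩
    choose x hxD hxs using hex
    -- The points `x n` need not lie in K, but truncating them changes coordinate i only for n ≤ i;
    -- a subsequential limit of the truncations is thus a limit of the points themselves.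
    let x' : ℕ → ℕ → ℕ := fun n i => min (x n i) (k i)
    have hx' : ∀ n, x' n ∈ K := fun n i _ =>
      Set.mem_Iic.2 (min_le_right (x n i) (k i))
    obtain ⟨z, hz, φ, hφ, hlim⟩ := hK.tendsto_subseq hx'
    have hlim2 : Tendsto (fun n => x (φ n)) atTop (𝓝 z) := by
      rw [tendsto_pi_nhds] at hlim ⊢
      intro i
      refine (hlim i).congr' ?_
      filter_upwards [eventually_gt_atTop i] with n hn
      have : i < φ n := lt_of_lt_of_le hn (hφ.id_le n)
      exact min_eq_left ((hDmem _ _).1 (hxD (φ n)) i this)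
    have h1 : Tendsto (fun n => h (x (φ n))) atTop (𝓝 (h z)) := (hh.tendsto z).comp hlim2
    have h2 : Tendsto (fun n => h (x (φ n))) atTop (𝓝 s) := by
      have h3 : Tendsto (fun n => h (x n)) atTop (𝓝 s) := by
        rw [tendsto_iff_dist_tendsto_zero]
        refine squeeze_zero (fun _ => dist_nonneg) (fun n => ?_)
          tendsto_one_div_add_atTop_nhds_zero_nat
        rw [dist_comm]
        exact (hxs n).le
      exact h3.comp hφ.tendsto_atTop
    exact ⟨z, hz, tendsto_nhds_unique h1 h2⟩
  have hanti : Antitone fun n => closure (h '' D n) := by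
    refine antitone_nat_of_succ_le fun n => closure_mono (Set.image_mono ?_)
    rw [hDs]
    exact Set.inter_subset_left
  calc c ≤ ⨅ n, ρ (closure (h '' D n)) :=
        le_iInf fun n => (hcD n).le.trans (measure_mono subset_closure)
    _ = ρ (⋂ n, closure (h '' D n)) :=
        (hanti.measure_iInter (fun n => isClosed_closure.measurableSet.nullMeasurableSet)
          ⟨0, measure_ne_top _ _⟩).symm
    _ ≤ ρ (h '' K) := measure_mono hsub

/-- Each fibre in K is compact, so its image in the line has a smallest point, and this point is
selected. It is a Borel function of s because its sublevel sets are, up to the default value 0 off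
the image, images of compact sets. -/
theorem exists_measurable_section_compact {h : (ℕ → ℕ) → S} (hh : Continuous h)
    {K : Set (ℕ → ℕ)} (hK : IsCompact K) :
    ∃ ψ : S → ℕ → ℕ, Measurable ψ ∧ ∀ s ∈ h '' K, h (ψ s) = s := by
  let := TopologicalSpace.upgradeIsCompletelyMetrizable S
  let A : S → Set ℝ := fun s => baireToReal '' (K ∩ h ⁻¹' {s})
  have hA : ∀ s, IsCompact (A s) := fun s =>
    (hK.inter_right (isClosed_singleton.preimage hh)).image continuous_baireToReal
  have hAne : ∀ s ∈ h '' K, (A s).Nonempty := by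
    rintro s ⟨x, hx, rfl⟩
    exact ⟨_, x, ⟨hx, rfl⟩, rfl⟩
  classical
  let q : S → ℝ := fun s => if s ∈ h '' K then sInf (A s) else 0
  have hcK : ∀ c : ℝ, MeasurableSet (h '' (K ∩ baireToReal ⁻¹' Set.Iic c)) := fun c =>
    ((hK.inter_right (isClosed_Iic.preimage continuous_baireToReal)).image hh).measurableSet
  have hKm : MeasurableSet (h '' K) := (hK.image hh).measurableSet
  have hq : Measurable q := by
    apply measurable_of_Iic
    intro c
    have : q ⁻¹' Set.Iic c = (h '' (K ∩ baireToReal ⁻¹' Set.Iic c))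
        ∪ (if (0 : ℝ) ≤ c then (h '' K)ᶜ else ∅) := by
      ext s
      simp only [Set.mem_preimage, Set.mem_Iic, Set.mem_union, q]
      by_cases hs : s ∈ h '' K
      · rw [if_pos hs]
        have h2 : s ∉ (if (0 : ℝ) ≤ c then (h '' K)ᶜ else ∅) := by
          split_ifs
          · simpa using hs
          · simp
        simp only [h2, or_false]
        constructor
        · intro hle
          obtain ⟨x, ⟨hxK, hxs⟩, hx⟩ := (hA s).sInf_mem (hAne s hs)
          refine ⟨x, ⟨hxK, ?_⟩, hxs⟩
          simpa [hx] using hle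
        · rintro ⟨x, ⟨hxK, hxc⟩, hxs⟩
          exact (csInf_le (hA s).bddBelow ⟨x, ⟨hxK, hxs⟩, rfl⟩).trans hxc
      · rw [if_neg hs]
        have h1 : s ∉ h '' (K ∩ baireToReal ⁻¹' Set.Iic c) := fun h' =>
          hs (Set.image_mono Set.inter_subset_left h')
        simp only [h1, false_or]
        split_ifs with hc
        · simpa [hc] using hs
        · simp [hc]
    rw [this]
    refine (hcK c).union ?_
    split_ifs
    · exact hKm.compl
    · exact MeasurableSet.empty
  obtain ⟨r, hr, hre⟩ := measurableEmbedding_baireToReal.exists_measurable_extend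
    (measurable_id (α := ℕ → ℕ)) fun _ => inferInstance
  refine ⟨fun s => r (q s), hr.comp hq, fun s hs => ?_⟩
  obtain ⟨x, ⟨hxK, hxs⟩, hx⟩ := (hA s).sInf_mem (hAne s hs)
  have : q s = baireToReal x := by simp only [q, if_pos hs, hx]
  simp only [this]
  have h2 : r (baireToReal x) = x := congrFun hre x
  rw [h2]
  exact hxs

/-- Countably many images of compact sets exhaust the range up to a null set; the section of the
first one containing s is used. -/
theorem exists_measurable_section {h : (ℕ → ℕ) → S} (hh : Continuous h) (ρ : Measure S)
    [IsFiniteMeasure ρ] :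
    ∃ (M : Set S) (ψ : S → ℕ → ℕ), MeasurableSet M ∧ M ⊆ Set.range h ∧
      ρ (Set.range h \ M) = 0 ∧ Measurable ψ ∧ ∀ s ∈ M, h (ψ s) = s := by
  have hex : ∀ j : ℕ, ∃ K : Set (ℕ → ℕ), IsCompact K ∧
      ρ (Set.range h) ≤ ρ (h '' K) + (1 / ((j : ℝ≥0∞) + 1)) := by
    intro j
    have hpos : (1 / ((j : ℝ≥0∞) + 1)) ≠ 0 := by
      simp
    rcases eq_or_ne (ρ (Set.range h)) 0 with h0 | h0
    · exact ⟨∅, isCompact_empty, by simp [h0]⟩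
    · obtain ⟨K, hK, hle⟩ := exists_compact_measure_image hh ρ
        (ENNReal.sub_lt_self (measure_ne_top ρ _) h0 hpos)
      exact ⟨K, hK, tsub_le_iff_right.1 hle⟩
  choose K hK hKρ using hex
  have hsec := fun j => exists_measurable_section_compact hh (hK j)
  choose ψ hψ hψs using hsec
  let := TopologicalSpace.upgradeIsCompletelyMetrizable S
  have hKm : ∀ j, MeasurableSet (h '' K j) := fun j => ((hK j).image hh).measurableSet
  let M : Set S := ⋃ j, h '' K j
  have hM : MeasurableSet M := MeasurableSet.iUnion hKm
  have hMsub : M ⊆ Set.range h := Set.iUnion_subset fun j => Set.image_subset_range _ _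
  classical
  -- The alternative `s ∉ M` only makes the search for the first index total.
  have hfind : ∀ s, ∃ j, s ∈ h '' K j ∨ s ∉ M := by
    intro s
    by_cases hs : s ∈ M
    · obtain ⟨j, hj⟩ := Set.mem_iUnion.1 hs
      exact ⟨j, Or.inl hj⟩
    · exact ⟨0, Or.inr hs⟩
  refine ⟨M, fun s => ψ (Nat.find (hfind s)) s, hM, hMsub, ?_, ?_, ?_⟩
  · rw [measure_sdiff hMsub hM.nullMeasurableSet (measure_ne_top _ _), tsub_eq_zero_iff_le]
    refine ENNReal.le_of_forall_pos_le_add fun ε hε _ => ?_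
    obtain ⟨j, hj⟩ := ENNReal.exists_inv_nat_lt (a := (ε : ℝ≥0∞)) (by exact_mod_cast hε.ne')
    have h1 : (1 / ((j : ℝ≥0∞) + 1)) ≤ ε := by
      refine le_trans ?_ hj.le
      rw [one_div]
      exact ENNReal.inv_le_inv.2 le_self_add
    exact (hKρ j).trans (add_le_add (measure_mono (Set.subset_iUnion (fun j => h '' K j) j)) h1)
  · exact Measurable.find (p := fun j s => s ∈ h '' K j ∨ s ∉ M) hψ
      (fun j => (hKm j).union hM.compl) hfind
  · intro s hs
    have := Nat.find_spec (hfind s)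
    exact hψs _ s (this.resolve_right fun hn => hn hs)

end Selection

/-! ### Measurable projection and infimal projections of Borel functions. -/

section Projective

variable {S : Type*} [MeasurableSpace S] [StandardBorelSpace S]

/-- Measurable projection and measurable selection. -/
theorem exists_measurable_selection {B : Set (S × (ℕ → ℕ))} (hB : MeasurableSet B) (ρ : Measure S)
    [IsFiniteMeasure ρ] :
    NullMeasurableSet (Prod.fst '' B) ρ ∧
      ∃ ψ : S → ℕ → ℕ, Measurable ψ ∧ ∀ᵐ s ∂ρ, s ∈ Prod.fst '' B → (s, ψ s) ∈ B := by
  let := upgradeStandardBorel S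
  rcases Set.eq_empty_or_nonempty B with rfl | hne
  · exact ⟨by simp, fun _ => 0, measurable_const, by simp⟩
  -- B is a continuous image of the Baire space under some g; a section of the first component of g,
  -- followed by its second component, selects a point of the fibre.
  have han := hB.analyticSet
  rw [AnalyticSet_def] at han
  obtain ⟨g, hg, hgB⟩ := han.resolve_left hne.ne_empty
  obtain ⟨M, ψ, hM, hMsub, hM0, hψ, hψs⟩ :=
    exists_measurable_section (h := fun x => (g x).1) (continuous_fst.comp hg) ρ
  have hr : Prod.fst '' B = Set.range fun x => (g x).1 := by
    rw [← hgB, ← Set.range_comp]; rfl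
  rw [hr]
  refine ⟨?_, fun s => (g (ψ s)).2, ?_, ?_⟩
  · have : M =ᵐ[ρ] Set.range fun x => (g x).1 := by
      refine Filter.EventuallyLE.antisymm (Filter.Eventually.of_forall hMsub) ?_
      rw [ae_le_set]
      exact hM0
    exact hM.nullMeasurableSet.congr this
  · exact (continuous_snd.comp hg).measurable.comp hψ
  · have : ∀ᵐ s ∂ρ, s ∉ (Set.range fun x => (g x).1) \ M := by
      exact measure_eq_zero_iff_ae_notMem.1 hM0
    filter_upwards [this] with s hs hsr
    have hsM : s ∈ M := by
      by_contra h; exact hs ⟨hsr, h⟩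
    have h1 : (s, (g (ψ s)).2) = g (ψ s) := Prod.ext (hψs s hsM).symm rfl
    rw [h1, ← hgB]
    exact ⟨_, rfl⟩

/-- Infimal projections of measurable functions of two variables. -/
def InfProj (f : S → EReal) : Prop :=
  ∃ F : S × (ℕ → ℕ) → EReal, Measurable F ∧ ∀ s, f s = ⨅ z, F (s, z)

omit [StandardBorelSpace S] in
theorem Measurable.infProj {f : S → EReal} (hf : Measurable f) : InfProj f :=
  ⟨fun p => f p.1, hf.comp measurable_fst, fun _ => (ciInf_const).symm⟩

/-- The set where f < c is the projection of the Borel set where F < c, hence measurable for the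
completion of ρ. -/
theorem InfProj.aemeasurable {f : S → EReal} (hf : InfProj f) (ρ : Measure S)
    [IsFiniteMeasure ρ] : AEMeasurable f ρ := by
  obtain ⟨F, hF, hfF⟩ := hf
  refine NullMeasurable.aemeasurable ?_
  have : @Measurable (NullMeasurableSpace S ρ) EReal _ _ f := by
    refine measurable_of_Iio fun c => ?_
    have h : f ⁻¹' Set.Iio c = Prod.fst '' {p : S × (ℕ → ℕ) | F p < c} := by
      ext s
      simp only [Set.mem_preimage, Set.mem_Iio, hfF, iInf_lt_iff, Set.mem_image, Set.mem_ofPred_eq]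
      constructor
      · rintro ⟨z, hz⟩; exact ⟨(s, z), hz, rfl⟩
      · rintro ⟨⟨s', z⟩, hz, rfl⟩; exact ⟨z, hz⟩
    have h2 := (exists_measurable_selection (hF (measurableSet_Iio (a := c))) ρ).1
    have h3 : Prod.fst '' {p : S × (ℕ → ℕ) | F p < c} = Prod.fst '' (F ⁻¹' Set.Iio c) := rfl
    rw [← h3, ← h] at h2
    exact h2
  exact this

/-- Selection is applied to the set of ε-optimal pairs, with f replaced by a Borel version so that
this set is Borel. Finiteness of `f s` is what makes `f s < f s + ε`, so that the fibre is nonempty.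
-/
theorem exists_measurable_lt {f : S → EReal} {F : S × (ℕ → ℕ) → EReal} (hF : Measurable F)
    (hfF : ∀ s, f s = ⨅ z, F (s, z)) (hbot : ∀ s, f s ≠ ⊥) (ρ : Measure S) [IsFiniteMeasure ρ]
    {ε : ℝ} (hε : 0 < ε) :
    ∃ ψ : S → ℕ → ℕ, Measurable ψ ∧ ∀ᵐ s ∂ρ, f s < ⊤ → F (s, ψ s) < f s + ε := by
  have hf : AEMeasurable f ρ := InfProj.aemeasurable ⟨F, hF, hfF⟩ ρ
  obtain ⟨ψ, hψ, hψs⟩ := (exists_measurable_selection (B := {p | F p < hf.mk f p.1 + ε})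
    (measurableSet_lt hF ((hf.measurable_mk.comp measurable_fst).add measurable_const)) ρ).2
  refine ⟨ψ, hψ, ?_⟩
  filter_upwards [hψs, hf.ae_eq_mk] with s hs hse hlt
  rw [hse]
  refine hs ?_
  have h1 : ⨅ z, F (s, z) < f s + ε := by
    rw [← hfF]
    have h0 := hbot s
    revert hlt h0
    induction f s with
    | bot => simp
    | top => simp
    | coe a =>
      intro _ _
      rw [← EReal.coe_add, EReal.coe_lt_coe_iff]
      linarith
  obtain ⟨z, hz⟩ := iInf_lt_iff.1 h1
  exact ⟨(s, z), by simpa [← hse] using hz, rfl⟩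

end Projective

end ObsControl

namespace ObsControl

/-! ### One Borel map evaluating all measurable functions up to null sets. -/

section UniversalEvaluation

variable {S E : Type*} [MeasurableSpace S] [StandardBorelSpace S]
  [MeasurableSpace E] [StandardBorelSpace E] [Nonempty E]

/-- Continuous functions are dense in L¹ and the sequence g is uniformly dense among them; L¹
convergence then gives almost sure convergence of a subsequence. The indices used form a point of
the Baire space, which serves as code of f. -/
theorem exists_seq_tendsto_ae_of_denseRange {g : ℕ → C(unitInterval, ℝ)} (hg : DenseRange g)
    (κ : Measure unitInterval) [IsFiniteMeasure κ] {f : unitInterval → ℝ} (hf : Measurable f)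
    (hf1 : ∀ x, |f x| ≤ 1) :
    ∃ z : ℕ → ℕ, ∀ᵐ x ∂κ, Tendsto (fun m => g (z m) x) atTop (𝓝 (f x)) := by
  have hfL : MemLp f 1 κ := MemLp.of_bound hf.aestronglyMeasurable 1 (ae_of_all _ hf1)
  have h1 : ∀ m : ℕ, ∃ i, eLpNorm (⇑(g i) - f) 1 κ
      ≤ (1 / ((m : ℝ≥0∞) + 1)) + ENNReal.ofReal (1 / ((m : ℝ) + 1)) * κ Set.univ := by
    intro m
    obtain ⟨c, hc, -⟩ := hfL.exists_boundedContinuous_eLpNorm_sub_le ENNReal.one_ne_top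
      (ε := 1 / ((m : ℝ≥0∞) + 1)) (by simp)
    obtain ⟨i, hi⟩ := hg.exists_dist_lt c.toContinuousMap
      (show (0 : ℝ) < 1 / ((m : ℝ) + 1) by positivity)
    refine ⟨i, ?_⟩
    have e : (⇑(g i) - f) = (⇑(g i) - ⇑c) + (⇑c - f) := by
      funext x; simp
    rw [e]
    refine (eLpNorm_add_le ?_ ?_ le_rfl).trans ?_
    · exact ((g i).continuous.sub c.continuous).aestronglyMeasurable
    · exact c.continuous.aestronglyMeasurable.sub hf.aestronglyMeasurable
    · rw [add_comm]
      refine add_le_add ?_ ?_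
      · rw [eLpNorm_sub_comm]; exact hc
      · have := eLpNorm_le_of_ae_bound (p := 1) (μ := κ) (f := ⇑(g i) - ⇑c)
          (C := 1 / ((m : ℝ) + 1)) (ae_of_all _ fun x => by
            have := ContinuousMap.dist_apply_le_dist (f := c.toContinuousMap) (g := g i) x
            rw [dist_comm, Real.dist_eq] at this
            exact this.trans hi.le)
        refine this.trans (le_of_eq ?_)
        simp [mul_comm]
  choose i hi using h1
  have hlim : Tendsto (fun m => eLpNorm (⇑(g (i m)) - f) 1 κ) atTop (𝓝 0) := by
    have a1 : Tendsto (fun m : ℕ => 1 / ((m : ℝ≥0∞) + 1)) atTop (𝓝 0) := by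
      have := (tendsto_add_atTop_iff_nat 1).2 ENNReal.tendsto_inv_nat_nhds_zero
      simpa using this
    have a2 : Tendsto (fun m : ℕ => ENNReal.ofReal (1 / ((m : ℝ) + 1)) * κ Set.univ) atTop (𝓝 0) := by
      have h2 := ENNReal.tendsto_ofReal (tendsto_one_div_add_atTop_nhds_zero_nat (𝕜 := ℝ))
      have := ENNReal.Tendsto.mul_const h2 (Or.inr (measure_ne_top κ Set.univ))
      simpa using this
    have a3 := a1.add a2
    rw [add_zero] at a3
    exact tendsto_of_tendsto_of_tendsto_of_le_of_le tendsto_const_nhds a3 (fun _ => zero_le)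
      hi
  obtain ⟨ns, -, hns⟩ := (tendstoInMeasure_of_tendsto_eLpNorm one_ne_zero
    (fun m => (g (i m)).continuous.aestronglyMeasurable) hf.aestronglyMeasurable
    hlim).exists_seq_tendsto_ae
  exact ⟨fun m => i (ns m), hns⟩

variable (S E) in
/-- All measurable functions are obtained, up to null sets and simultaneously for all finite
measures, as sections of one measurable function. -/
theorem exists_universal_evaluation :
    ∃ ev : (ℕ → ℕ) × S → E, Measurable ev ∧ ∀ (κ : Measure S) [IsFiniteMeasure κ] (f : S → E),
      Measurable f → ∃ z, ∀ᵐ s ∂κ, ev (z, s) = f s := by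
  let ι : S → unitInterval := unitInterval.sigmoid ∘ embeddingReal S
  have hι : MeasurableEmbedding ι := measurableEmbedding_sigmoid_comp_embeddingReal S
  let j : E → ℝ := Subtype.val ∘ (unitInterval.sigmoid ∘ embeddingReal E)
  have hj : MeasurableEmbedding j :=
    (MeasurableEmbedding.subtype_coe measurableSet_Icc).comp
      (measurableEmbedding_sigmoid_comp_embeddingReal E)
  have hj1 : ∀ x, |j x| ≤ 1 := fun x =>
    abs_le.2 ⟨le_trans (by norm_num) (unitInterval.sigmoid (embeddingReal E x)).2.1,
      (unitInterval.sigmoid (embeddingReal E x)).2.2⟩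
  obtain ⟨r, hr, hrj⟩ := hj.exists_measurable_extend (measurable_id (α := E)) fun _ => inferInstance
  let g : ℕ → C(unitInterval, ℝ) := TopologicalSpace.denseSeq _
  have hg : DenseRange g := TopologicalSpace.denseRange_denseSeq _
  -- A code lists indices of continuous functions and is decoded by their limit. The upper limit
  -- makes the map defined and Borel for every code, and r returns from the line to E.
  refine ⟨fun p => r ((limsup (fun m => ((g (p.1 m) (ι p.2) : ℝ) : EReal)) atTop).toReal),
    ?_, ?_⟩
  · refine hr.comp (Measurable.ereal_toReal ?_)
    refine Measurable.limsup fun m => measurable_coe_real_ereal.comp ?_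
    have h2 : Measurable fun q : ℕ × S => g q.1 (ι q.2) :=
      measurable_from_prod_countable_right fun n => (g n).continuous.measurable.comp hι.measurable
    have h3 : Measurable fun p : (ℕ → ℕ) × S => (p.1 m, p.2) :=
      ((measurable_pi_apply m).comp measurable_fst).prodMk measurable_snd
    exact h2.comp h3
  · intro κ _ f hf
    obtain ⟨F, hF, hFf⟩ := hι.exists_measurable_extend (hj.measurable.comp hf) fun _ => ⟨0⟩
    -- The extension F is uncontrolled off the range of ι; clamping restores the bound 1 without
    -- changing it on the range.
    let F' : unitInterval → ℝ := fun x => max (min (F x) 1) (-1)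
    have hF' : Measurable F' := (hF.min measurable_const).max measurable_const
    obtain ⟨z, hz⟩ := exists_seq_tendsto_ae_of_denseRange hg (κ.map ι) hF' fun x =>
      abs_le.2 ⟨le_max_right _ _, max_le (min_le_right _ _) (by norm_num)⟩
    refine ⟨z, ?_⟩
    filter_upwards [ae_of_ae_map hι.measurable.aemeasurable hz] with s hs
    have h1 : F' (ι s) = j (f s) := by
      have h2 : F (ι s) = j (f s) := congrFun hFf s
      have h3 := abs_le.1 (hj1 (f s))
      simp only [F', h2]
      rw [min_eq_left h3.2, max_eq_left h3.1]
    rw [h1] at hs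
    have h4 : Tendsto (fun m => ((g (z m) (ι s) : ℝ) : EReal)) atTop (𝓝 (j (f s) : EReal)) :=
      (continuous_coe_real_ereal.tendsto _).comp hs
    simp only [h4.limsup_eq, EReal.toReal_coe]
    exact congrFun hrj (f s)

end UniversalEvaluation

/-! ### Probability measures on a standard Borel space. -/

section StandardBorel

/-- The range of i is the set of fixed points of `i ∘ r`, which is Borel; the structure of this
subset is transported back to X. -/
theorem standardBorelSpace_of_retract {X Θ : Type*} [MeasurableSpace X] [MeasurableSpace Θ]
    [StandardBorelSpace Θ] {i : X → Θ} {r : Θ → X} (hi : Measurable i) (hr : Measurable r)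
    (hri : ∀ x, r (i x) = x) : StandardBorelSpace X := by
  have hm : MeasurableEmbedding i := by
    refine ⟨Function.LeftInverse.injective hri, hi, fun s hs => ?_⟩
    have : i '' s = {θ | i (r θ) = θ} ∩ r ⁻¹' s := by
      ext θ
      constructor
      · rintro ⟨x, hx, rfl⟩
        exact ⟨by simp [hri], by simpa [hri] using hx⟩
      · rintro ⟨h1, h2⟩
        exact ⟨r θ, h2, h1⟩
    rw [this]
    exact (measurableSet_eq_fun (hi.comp hr) measurable_id).inter (hr hs)
  have := (hm.measurableSet_range).standardBorel
  obtain ⟨τ, hb, hp⟩ := StandardBorelSpace.polish (α := Set.range i)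
  let τ' : TopologicalSpace X := τ.induced hm.equivRange
  refine ⟨τ', ⟨?_⟩, hm.equivRange.toEquiv.polishSpace_induced⟩
  refine Eq.trans ?_ (borel_comap (f := hm.equivRange) (t := τ)).symm
  rw [← hb.measurable_eq]
  exact hm.equivRange.measurableEmbedding.comap_eq.symm

theorem measurable_probabilityMeasure {α S : Type*} [MeasurableSpace α] [MeasurableSpace S]
    {f : α → ProbabilityMeasure S} (hf : Measurable fun a => (f a : Measure S)) : Measurable f :=
  hf.subtype_mk (h := fun a => (f a).2)

/-- With S embedded in the line, a law is coded by its distribution function at the rationals.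
Conversely, any family of reals indexed by ℚ is turned measurably into a Stieltjes measure and
pulled back to S, with a default law if the result is not a probability. This makes the space of
laws a measurable retract of `ℚ → ℝ`. -/
instance {S : Type*} [MeasurableSpace S] [StandardBorelSpace S] :
    StandardBorelSpace (ProbabilityMeasure S) := by
  rcases isEmpty_or_nonempty (ProbabilityMeasure S) with he | ⟨⟨ν₀⟩⟩
  · infer_instance
  have hemb := measurableEmbedding_embeddingReal S
  let i : ProbabilityMeasure S → ℚ → ℝ := fun ν q =>
    (((ν : Measure S).map (embeddingReal S)) (Set.Iic (q : ℝ))).toReal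
  let st := stieltjesOfMeasurableRat (fun (θ : ℚ → ℝ) => θ) measurable_id
  let c : (ℚ → ℝ) → Measure S := fun θ => (st θ).measure.comap (embeddingReal S)
  have hcapp : ∀ θ A, c θ A = (st θ).measure (embeddingReal S '' A) := fun θ A =>
    hemb.comap_apply _ _
  have hst : Measurable fun θ => (st θ).measure :=
    measurable_measure_stieltjesOfMeasurableRat measurable_id
  have hc : Measurable c := by
    refine Measure.measurable_of_measurable_coe _ fun A hA => ?_
    simp only [hcapp]
    exact (Measure.measurable_coe (hemb.measurableSet_image.2 hA)).comp hst
  classical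
  let r : (ℚ → ℝ) → ProbabilityMeasure S := fun θ =>
    if h : IsProbabilityMeasure (c θ) then ⟨c θ, h⟩ else ν₀
  have hset : MeasurableSet {θ | IsProbabilityMeasure (c θ)} := by
    have : {θ | IsProbabilityMeasure (c θ)} = {θ | c θ Set.univ = 1} := by
      ext θ; exact isProbabilityMeasure_iff
    rw [this]
    exact (Measure.measurable_coe MeasurableSet.univ).comp hc (measurableSet_singleton _)
  have hr : Measurable r := by
    refine measurable_probabilityMeasure ?_
    have : (fun θ => (r θ : Measure S))
        = fun θ => if IsProbabilityMeasure (c θ) then c θ else (ν₀ : Measure S) := by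
      funext θ
      by_cases h : IsProbabilityMeasure (c θ)
      · rw [if_pos h]; exact congrArg Subtype.val (dif_pos h)
      · rw [if_neg h]; exact congrArg Subtype.val (dif_neg h)
    rw [this]
    exact Measurable.ite hset hc measurable_const
  refine standardBorelSpace_of_retract (i := i) (r := r) ?_ hr ?_
  · refine measurable_pi_lambda _ fun q => ENNReal.measurable_toReal.comp ?_
    have : ∀ ν : ProbabilityMeasure S, ((ν : Measure S).map (embeddingReal S)) (Set.Iic (q : ℝ))
        = (ν : Measure S) (embeddingReal S ⁻¹' Set.Iic (q : ℝ)) := fun ν =>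
      hemb.map_apply _ _
    simp only [this]
    exact (Measure.measurable_coe (hemb.measurable measurableSet_Iic)).comp measurable_subtype_coe
  · intro ν
    have : IsProbabilityMeasure ((ν : Measure S).map (embeddingReal S)) :=
      Measure.isProbabilityMeasure_map hemb.measurable.aemeasurable
    set ρ := (ν : Measure S).map (embeddingReal S) with hρ
    have hpt : IsRatStieltjesPoint (fun (θ : ℚ → ℝ) => θ) (i ν) := by
      have hcdf : ∀ q : ℚ, i ν q = cdf ρ q := fun q => (cdf_eq_real ρ q).symm
      refine ⟨?_, ?_, ?_, ?_⟩
      · intro a b hab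
        simp only [hcdf]
        exact monotone_cdf ρ (by exact_mod_cast hab)
      · simp only [funext hcdf]
        exact (tendsto_cdf_atTop ρ).comp (tendsto_ratCast_atTop_iff.2 tendsto_id)
      · simp only [funext hcdf]
        exact (tendsto_cdf_atBot ρ).comp (tendsto_ratCast_atBot_iff.2 tendsto_id)
      · intro t
        simp only [hcdf]
        rw [← (cdf ρ).iInf_rat_gt_eq (t : ℝ)]
        exact (Equiv.subtypeEquivRight fun q => by simp).iInf_congr fun q => rfl
    have hmeas : (st (i ν)).measure = ρ := by
      have h1 : st (i ν) = cdf ρ := by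
        ext x
        rw [← (st (i ν)).iInf_rat_gt_eq, ← (cdf ρ).iInf_rat_gt_eq]
        refine iInf_congr fun q => ?_
        have h2 := stieltjesOfMeasurableRat_eq (measurable_id (α := ℚ → ℝ)) (i ν) (q : ℚ)
        have h3 := toRatCDF_of_isRatStieltjesPoint hpt (q : ℚ)
        exact (h2.trans h3).trans (cdf_eq_real ρ q).symm
      rw [h1, measure_cdf]
    have hcν : c (i ν) = ν := by
      simp only [c, hmeas, hρ]
      exact hemb.comap_map _
    have hp : IsProbabilityMeasure (c (i ν)) := by rw [hcν]; exact ν.2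
    exact (dif_pos hp).trans (Subtype.ext hcν)

end StandardBorel

end ObsControl

namespace ObsControl

/-! ### A countable determining family of test functions. -/

section TestFunctions

variable {d : ℕ}

/-- Test functions: `C²` functions with compact support. -/
structure IsTest (φ : Vec d → ℝ) : Prop where
  contDiff : ContDiff ℝ 2 φ
  compact : HasCompactSupport φ

theorem IsTest.integrable {φ : Vec d → ℝ} (h : IsTest φ) (ν : Law d) :
    Integrable φ (ν : Measure (Vec d)) :=
  h.contDiff.continuous.integrable_of_hasCompactSupport h.compact

/-- The cutoff equals 1 on a neighbourhood of K, not merely on K, so that multiplying by it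
preserves derivatives there. -/
theorem exists_cutoff {K G : Set (Vec d)} (hK : IsCompact K) (hG : IsOpen G) (hKG : K ⊆ G) :
    ∃ χ : Vec d → ℝ, IsTest χ ∧ (∀ᶠ y in 𝓝ˢ K, χ y = 1) ∧
      (∀ y, 0 ≤ χ y ∧ χ y ≤ 1) ∧ Function.support χ ⊆ G := by
  obtain ⟨V, hVo, hKV, hVG, hVc⟩ := exists_open_between_and_isCompact_closure hK hG hKG
  obtain ⟨f, hf0, hf1, hf⟩ := exists_contMDiffMap_zero_one_nhds_of_isClosed
    (modelWithCornersSelf ℝ (Vec d)) (n := 2) hVo.isClosed_compl hK.isClosed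
    (Set.disjoint_left.2 fun x hx hxK => hx (hKV hxK))
  have hsupp : Function.support f ⊆ V := by
    intro y hy
    by_contra hyV
    exact hy (hf0.self_of_nhdsSet y hyV)
  refine ⟨f, ⟨f.contMDiff.contDiff, ?_⟩, hf1, hf, ?_⟩
  · exact hVc.of_isClosed_subset (isClosed_tsupport _) (closure_mono hsupp)
  · exact hsupp.trans (subset_closure.trans hVG)

/-- No mass can escape when the limit has mass one. For open G, inner regularity and a cutoff
between a compact subset and G give the lower bound of the portmanteau theorem. -/
theorem tendsto_law_of_test {ι : Type*} {L : Filter ι} [L.IsCountablyGenerated]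
    {x : ι → Law d} {ν : Law d}
    (h : ∀ φ, IsTest φ → Tendsto (fun i => ∫ z, φ z ∂(x i : Measure (Vec d))) L
      (𝓝 (∫ z, φ z ∂(ν : Measure (Vec d))))) : Tendsto x L (𝓝 ν) := by
  refine tendsto_of_forall_isOpen_le_liminf' fun G hG => ?_
  rw [hG.measure_eq_iSup_isCompact]
  refine iSup₂_le fun K hKG => iSup_le fun hK => ?_
  obtain ⟨χ, hχ, hχ1, hχb, hχG⟩ := exists_cutoff hK hG hKG
  have hle : ∀ (ρ : Law d), ENNReal.ofReal (∫ z, χ z ∂(ρ : Measure (Vec d)))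
      ≤ (ρ : Measure (Vec d)) G := by
    intro ρ
    rw [ofReal_integral_eq_lintegral_ofReal (hχ.integrable ρ) (ae_of_all _ fun z => (hχb z).1)]
    rw [← lintegral_indicator_one hG.measurableSet]
    refine lintegral_mono fun z => ?_
    by_cases hz : z ∈ G
    · rw [Set.indicator_of_mem hz]
      simpa using ENNReal.ofReal_le_ofReal (hχb z).2
    · rw [Function.notMem_support.1 fun h' => hz (hχG h')]
      simp
  have hge : (ν : Measure (Vec d)) K ≤ ENNReal.ofReal (∫ z, χ z ∂(ν : Measure (Vec d))) := by
    rw [ofReal_integral_eq_lintegral_ofReal (hχ.integrable ν) (ae_of_all _ fun z => (hχb z).1)]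
    rw [← lintegral_indicator_one hK.measurableSet]
    refine lintegral_mono fun z => ?_
    by_cases hz : z ∈ K
    · rw [Set.indicator_of_mem hz, hχ1.self_of_nhdsSet z hz]; simp
    · rw [Set.indicator_of_notMem hz]; exact zero_le
  rcases L.eq_or_neBot with rfl | hne
  · simp [liminf_eq]
  have hlim : Tendsto (fun i => ENNReal.ofReal (∫ z, χ z ∂(x i : Measure (Vec d)))) L
      (𝓝 (ENNReal.ofReal (∫ z, χ z ∂(ν : Measure (Vec d))))) := ENNReal.tendsto_ofReal (h χ hχ)
  calc (ν : Measure (Vec d)) K ≤ _ := hge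
    _ = liminf (fun i => ENNReal.ofReal (∫ z, χ z ∂(x i : Measure (Vec d)))) L := hlim.liminf_eq.symm
    _ ≤ _ := liminf_le_liminf (Eventually.of_forall fun i => hle (x i))

theorem law_ext_of_test {ν ρ : Law d}
    (h : ∀ φ, IsTest φ → ∫ z, φ z ∂(ν : Measure (Vec d)) = ∫ z, φ z ∂(ρ : Measure (Vec d))) :
    ν = ρ :=
  tendsto_nhds_unique (f := fun _ : ℕ => ν) (l := atTop) tendsto_const_nhds
    (tendsto_law_of_test fun φ hφ => by rw [h φ hφ]; exact tendsto_const_nhds)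

theorem pderiv_congr {i : Fin d} {f g : Vec d → ℝ} {y : Vec d} (h : f =ᶠ[𝓝 y] g) :
    pderiv i f y = pderiv i g y := by
  unfold pderiv; rw [h.fderiv_eq]

theorem pderiv_eventuallyEq {i : Fin d} {f g : Vec d → ℝ} {y : Vec d} (h : f =ᶠ[𝓝 y] g) :
    pderiv i f =ᶠ[𝓝 y] pderiv i g :=
  h.eventuallyEq_nhds.mono fun _ hz => pderiv_congr hz

theorem contDiff_pderiv {i : Fin d} {f : Vec d → ℝ} {n m : ℕ∞} (hf : ContDiff ℝ n f)
    (hnm : m + 1 ≤ n) : ContDiff ℝ m (pderiv i f) := by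
  unfold pderiv
  exact (hf.fderiv_right (by exact_mod_cast hnm)).clm_apply contDiff_const

/-- The values of a function and of its first and second partial derivatives. -/
def jet (f : Vec d → ℝ) (y : Vec d) : ℝ × (Fin d → ℝ) × (Fin d → Fin d → ℝ) :=
  (f y, fun i => pderiv i f y, fun i j => pderiv i (pderiv j f) y)

theorem jet_congr {f g : Vec d → ℝ} {y : Vec d} (h : f =ᶠ[𝓝 y] g) : jet f y = jet g y := by
  unfold jet
  rw [h.eq_of_nhds]
  simp only [pderiv_congr h]
  congr 2
  funext i j
  exact pderiv_congr (pderiv_eventuallyEq h)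

theorem jet_eq_zero {f : Vec d → ℝ} {y : Vec d} (h : y ∉ tsupport f) : jet f y = 0 := by
  have h1 : f =ᶠ[𝓝 y] fun _ => 0 := notMem_tsupport_iff_eventuallyEq.1 h
  rw [jet_congr h1]
  unfold jet
  have : ∀ i, pderiv i (fun _ : Vec d => (0 : ℝ)) = fun _ => 0 := by
    intro i; funext z; simp [pderiv]
  simp only [this]
  rfl

theorem continuous_pderiv {i : Fin d} {f : Vec d → ℝ} (hf : ContDiff ℝ 1 f) :
    Continuous (pderiv i f) :=
  (contDiff_pderiv (n := 1) (m := 0) (by exact_mod_cast hf) (by simp)).continuous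

theorem IsTest.continuous_jet {f : Vec d → ℝ} (hf : IsTest f) : Continuous (jet f) := by
  refine hf.contDiff.continuous.prodMk (Continuous.prodMk ?_ ?_)
  · exact continuous_pi fun i => continuous_pderiv (hf.contDiff.of_le one_le_two)
  · refine continuous_pi fun i => continuous_pi fun j => continuous_pderiv ?_
    exact contDiff_pderiv (n := 2) (m := 1) (by exact_mod_cast hf.contDiff) (by norm_num)

variable (d) in
-- For supports in a fixed ball, second order jets form a subset of a separable space of continuous
-- functions on the ball, and a dense sequence of jets is lifted back. Keeping the supports in the
-- same ball is essential: the generator has only locally integrable coefficients.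
theorem exists_dense_test : ∃ φ : ℕ → Vec d → ℝ, (∀ k, IsTest (φ k)) ∧
    ∀ ψ, IsTest ψ → ∃ N : ℕ, tsupport ψ ⊆ Metric.closedBall 0 N ∧ ∀ ε > 0, ∃ k,
      tsupport (φ k) ⊆ Metric.closedBall 0 N ∧ ∀ y, dist (jet (φ k) y) (jet ψ y) < ε := by
  classical
  let A : ℕ → Set (Vec d → ℝ) := fun N =>
    {ψ | IsTest ψ ∧ tsupport ψ ⊆ Metric.closedBall 0 N}
  have hc : ∀ N : ℕ, ∃ C : Set (Vec d → ℝ), C.Countable ∧ C ⊆ A N ∧ ∀ ψ ∈ A N, ∀ ε > 0,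
      ∃ φ ∈ C, ∀ y, dist (jet φ y) (jet ψ y) < ε := by
    intro N
    let B := Metric.closedBall (0 : Vec d) N
    have : CompactSpace B := isCompact_iff_compactSpace.1 (isCompact_closedBall _ _)
    let J : A N → C(B, ℝ × (Fin d → ℝ) × (Fin d → Fin d → ℝ)) := fun ψ =>
      ⟨fun y => jet ψ.1 y, ψ.2.1.continuous_jet.comp continuous_subtype_val⟩
    obtain ⟨t, htc, hcl⟩ := (TopologicalSpace.IsSeparable.of_separableSpace
      (Set.range J)).exists_countable_dense_subset.imp fun t ht => And.intro ht.1 ht.2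
    have : Countable t := hcl.1.to_subtype
    choose g hg using fun F : t => htc F.2
    refine ⟨Set.range fun F : t => (g F).1, Set.countable_range _, ?_, ?_⟩
    · rintro _ ⟨F, rfl⟩
      exact (g F).2
    · intro ψ hψ ε hε
      have h1 : J ⟨ψ, hψ⟩ ∈ closure t := hcl.2 ⟨_, rfl⟩
      obtain ⟨F, hF, hd⟩ := Metric.mem_closure_iff.1 h1 ε hε
      refine ⟨_, ⟨⟨F, hF⟩, rfl⟩, fun y => ?_⟩
      by_cases hy : y ∈ B
      · have hgF : J (g ⟨F, hF⟩) = F := hg ⟨F, hF⟩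
        rw [← hgF] at hd
        have h2 := ContinuousMap.dist_apply_le_dist (f := J ⟨ψ, hψ⟩) (g := J (g ⟨F, hF⟩)) ⟨y, hy⟩
        rw [dist_comm]
        exact h2.trans_lt hd
      · rw [jet_eq_zero fun h' => hy ((g ⟨F, hF⟩).2.2 h'), jet_eq_zero fun h' => hy (hψ.2 h'), dist_self]
        exact hε
  choose C hCc hCA hCd using hc
  have hUc : (⋃ N, C N).Countable := Set.countable_iUnion hCc
  have hex : ∀ ψ : Vec d → ℝ, IsTest ψ → ∃ N : ℕ, tsupport ψ ⊆ Metric.closedBall 0 N := by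
    intro ψ hψ
    obtain ⟨R, hR⟩ := hψ.compact.isCompact.isBounded.subset_closedBall (0 : Vec d)
    obtain ⟨N, hN⟩ := exists_nat_ge R
    exact ⟨N, hR.trans (Metric.closedBall_subset_closedBall hN)⟩
  have hne : (⋃ N, C N).Nonempty := by
    have h0 : (fun _ => 0 : Vec d → ℝ) ∈ A 0 := by
      refine ⟨⟨contDiff_const, HasCompactSupport.zero⟩, ?_⟩
      have : tsupport (fun _ => 0 : Vec d → ℝ) = ∅ := tsupport_eq_empty_iff.2 rfl
      rw [this]; exact Set.empty_subset _
    obtain ⟨φ, hφ, -⟩ := hCd 0 _ h0 1 one_pos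
    exact ⟨φ, Set.mem_iUnion.2 ⟨0, hφ⟩⟩
  obtain ⟨φ, hφ⟩ := hUc.exists_eq_range hne
  have hmem : ∀ k, φ k ∈ ⋃ N, C N := fun k => hφ ▸ ⟨k, rfl⟩
  refine ⟨φ, fun k => ?_, fun ψ hψ => ?_⟩
  · obtain ⟨N, hN⟩ := Set.mem_iUnion.1 (hmem k)
    exact (hCA N hN).1
  · obtain ⟨N, hN⟩ := hex ψ hψ
    refine ⟨N, hN, fun ε hε => ?_⟩
    obtain ⟨f, hf, hd⟩ := hCd N ψ ⟨hψ, hN⟩ ε hε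
    obtain ⟨k, hk⟩ : f ∈ Set.range φ := hφ ▸ Set.mem_iUnion.2 ⟨N, hf⟩
    exact ⟨k, hk ▸ (hCA N hf).2, hk ▸ hd⟩

variable (d) in
/-- A countable family of test functions, dense for uniform convergence of second order jets. -/
def testSeq : ℕ → Vec d → ℝ := (exists_dense_test d).choose

theorem isTest_testSeq (k : ℕ) : IsTest (testSeq d k) := (exists_dense_test d).choose_spec.1 k

theorem exists_testSeq_approx {ψ : Vec d → ℝ} (hψ : IsTest ψ) :
    ∃ (N : ℕ) (k : ℕ → ℕ), tsupport ψ ⊆ Metric.closedBall 0 N ∧ ∀ j,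
      tsupport (testSeq d (k j)) ⊆ Metric.closedBall 0 N ∧
      ∀ y, dist (jet (testSeq d (k j)) y) (jet ψ y) < 1 / ((j : ℝ) + 1) := by
  obtain ⟨N, hN, h⟩ := (exists_dense_test d).choose_spec.2 ψ hψ
  choose! k hk using h
  exact ⟨N, fun j => k (1 / ((j : ℝ) + 1)), hN, fun j => hk _ (by positivity)⟩

theorem tendsto_integral_testSeq {ψ : Vec d → ℝ} {k : ℕ → ℕ}
    (hk : ∀ j y, dist (jet (testSeq d (k j)) y) (jet ψ y) < 1 / ((j : ℝ) + 1)) (hψ : IsTest ψ)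
    (ν : Law d) :
    Tendsto (fun j => ∫ z, testSeq d (k j) z ∂(ν : Measure (Vec d))) atTop
      (𝓝 (∫ z, ψ z ∂(ν : Measure (Vec d)))) := by
  rw [tendsto_iff_dist_tendsto_zero]
  refine squeeze_zero (fun _ => dist_nonneg) (fun j => ?_)
    (tendsto_one_div_add_atTop_nhds_zero_nat (𝕜 := ℝ))
  rw [Real.dist_eq, ← integral_sub ((isTest_testSeq _).integrable ν) (hψ.integrable ν)]
  have := norm_integral_le_of_norm_le_const (μ := (ν : Measure (Vec d)))
    (f := fun z => testSeq d (k j) z - ψ z) (C := 1 / ((j : ℝ) + 1)) (ae_of_all _ fun z => by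
      have h1 : dist (testSeq d (k j) z) (ψ z) ≤ dist (jet (testSeq d (k j)) z) (jet ψ z) :=
        le_max_left _ _
      exact (Real.dist_eq _ _ ▸ h1).trans (hk j z).le)
  simpa using this

theorem law_ext_of_testSeq {ν ρ : Law d}
    (h : ∀ k, ∫ z, testSeq d k z ∂(ν : Measure (Vec d))
      = ∫ z, testSeq d k z ∂(ρ : Measure (Vec d))) : ν = ρ := by
  refine law_ext_of_test fun φ hφ => ?_
  obtain ⟨N, k, -, hk⟩ := exists_testSeq_approx hφ
  refine tendsto_nhds_unique (tendsto_integral_testSeq (fun j => (hk j).2) hφ ν) ?_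
  simp only [h]
  exact tendsto_integral_testSeq (fun j => (hk j).2) hφ ρ

/-- The sequence of integrals of the functions `testSeq`. -/
def testVec (ν : Law d) (k : ℕ) : ℝ := ∫ z, testSeq d k z ∂(ν : Measure (Vec d))

theorem measurable_coe_law : Measurable fun ν : Law d => (ν : Measure (Vec d)) :=
  measurable_subtype_coe

/-- The tautological Markov kernel. -/
def lawKernel (d : ℕ) : Kernel (Law d) (Vec d) := ⟨fun ν => ν, measurable_coe_law⟩

instance : IsMarkovKernel (lawKernel d) := ⟨fun ν => ν.2⟩

theorem measurable_testVec : Measurable (testVec (d := d)) := by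
  refine measurable_pi_lambda _ fun k => ?_
  have : StronglyMeasurable fun ν : Law d => ∫ z, testSeq d k z ∂(lawKernel d ν) :=
    StronglyMeasurable.integral_kernel
      (isTest_testSeq k).contDiff.continuous.stronglyMeasurable
  exact this.measurable

theorem testVec_injective : Function.Injective (testVec (d := d)) := fun _ _ h =>
  law_ext_of_testSeq fun k => congrFun h k

instance : Nonempty (Law d) := ⟨⟨Measure.dirac 0, inferInstance⟩⟩

variable (d) in
-- An injective Borel map between standard Borel spaces is an embedding. A law can thus be recovered
-- measurably from its integrals, which the Fokker-Planck equation gives explicitly.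
theorem exists_testVec_inverse : ∃ r : (ℕ → ℝ) → Law d, Measurable r ∧ ∀ ν, r (testVec ν) = ν := by
  obtain ⟨r, hr, h⟩ := (measurable_testVec (d := d)).measurableEmbedding testVec_injective
    |>.exists_measurable_extend (measurable_id (α := Law d)) fun _ => inferInstance
  exact ⟨r, hr, congrFun h⟩

/-- A measurable left inverse of `testVec`. -/
def lawOfVec : (ℕ → ℝ) → Law d := (exists_testVec_inverse d).choose

theorem measurable_lawOfVec : Measurable (lawOfVec (d := d)) :=
  (exists_testVec_inverse d).choose_spec.1

theorem lawOfVec_testVec (ν : Law d) : lawOfVec (testVec ν) = ν :=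
  (exists_testVec_inverse d).choose_spec.2 ν

end TestFunctions

end ObsControl

namespace ObsControl

/-! ### Derivatives of coordinates and of their products. -/

section Coordinates

variable {d : ℕ}

theorem pderiv_coord (k i : Fin d) :
    pderiv k (fun y : Vec d => y i) = fun _ => if k = i then 1 else 0 := by
  funext y
  unfold pderiv
  have h : HasFDerivAt (fun y : Vec d => y i) (EuclideanSpace.proj i : Vec d →L[ℝ] ℝ) y :=
    (EuclideanSpace.proj i : Vec d →L[ℝ] ℝ).hasFDerivAt
  rw [h.fderiv]
  simp [eq_comm]

theorem pderiv_coord_mul (k i j : Fin d) :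
    pderiv k (fun y : Vec d => y i * y j)
      = fun y => (if k = i then y j else 0) + (if k = j then y i else 0) := by
  funext y
  unfold pderiv
  have h1 : HasFDerivAt (fun y : Vec d => y i) (EuclideanSpace.proj i : Vec d →L[ℝ] ℝ) y :=
    (EuclideanSpace.proj i : Vec d →L[ℝ] ℝ).hasFDerivAt
  have h2 : HasFDerivAt (fun y : Vec d => y j) (EuclideanSpace.proj j : Vec d →L[ℝ] ℝ) y :=
    (EuclideanSpace.proj j : Vec d →L[ℝ] ℝ).hasFDerivAt
  have h3 : HasFDerivAt (fun y : Vec d => y i * y j) _ y := h1.mul h2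
  rw [h3.fderiv]
  simp [eq_comm]
  ring

theorem pderiv_pderiv_coord_mul (l k i j : Fin d) :
    pderiv l (pderiv k (fun y : Vec d => y i * y j))
      = fun _ => (if k = i then (if l = j then 1 else 0) else 0)
        + (if k = j then (if l = i then 1 else 0) else 0) := by
  rw [pderiv_coord_mul]
  have h0 : ∀ (c : Prop) [Decidable c] (j : Fin d),
      pderiv l (fun y : Vec d => if c then y j else 0)
        = fun _ => if c then (if l = j then 1 else 0) else 0 := by
    intro c _ j
    by_cases hc : c
    · simp only [if_pos hc, pderiv_coord]
    · simp only [if_neg hc]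
      funext y
      simp [pderiv]
  have hd : ∀ (c : Prop) [Decidable c] (j : Fin d) (y : Vec d),
      DifferentiableAt ℝ (fun y : Vec d => if c then y j else 0) y := by
    intro c _ j y
    by_cases hc : c
    · simp only [if_pos hc]
      exact (EuclideanSpace.proj (𝕜 := ℝ) j).differentiableAt
    · simp only [if_neg hc]
      exact differentiableAt_const _
  funext y
  have h1 := congrFun (h0 (k = i) j) y
  have h2 := congrFun (h0 (k = j) i) y
  unfold pderiv at h1 h2 ⊢
  have h3 := fderiv_add (hd (k = i) j y) (hd (k = j) i y)
  have h4 : ((fun y : Vec d => if k = i then y j else 0) + fun y => if k = j then y i else 0)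
    = fun y : Vec d => (if k = i then y j else 0) + if k = j then y i else 0 := rfl
  rw [h4] at h3
  rw [h3, add_apply, h1, h2]

variable (d) in
/-- Test functions which agree with the coordinates, and with their products, on a ball. -/
theorem exists_coordinate_test (N : ℕ) : ∃ (f : Fin d → Vec d → ℝ) (f₂ : Fin d → Fin d → Vec d → ℝ),
    (∀ i, IsTest (f i)) ∧ (∀ i j, IsTest (f₂ i j)) ∧
    (∀ i, ∀ y ∈ Metric.closedBall (0 : Vec d) N, f i =ᶠ[𝓝 y] fun y => y i) ∧
    ∀ i j, ∀ y ∈ Metric.closedBall (0 : Vec d) N, f₂ i j =ᶠ[𝓝 y] fun y => y i * y j := by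
  obtain ⟨χ, hχ, hχ1, -, -⟩ := exists_cutoff (isCompact_closedBall (0 : Vec d) N) isOpen_univ
    (Set.subset_univ _)
  have hcoord : ∀ i, ContDiff ℝ 2 fun y : Vec d => y i := fun i =>
    (EuclideanSpace.proj i : Vec d →L[ℝ] ℝ).contDiff
  refine ⟨fun i y => χ y * y i, fun i j y => χ y * (y i * y j), fun i => ?_, fun i j => ?_, ?_, ?_⟩
  · exact ⟨hχ.contDiff.mul (hcoord i), hχ.compact.mul_right⟩
  · exact ⟨hχ.contDiff.mul ((hcoord i).mul (hcoord j)), hχ.compact.mul_right⟩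
  · intro i y hy
    filter_upwards [eventually_nhdsSet_iff_forall.1 hχ1 y hy] with z hz
    rw [hz, one_mul]
  · intro i j y hy
    filter_upwards [eventually_nhdsSet_iff_forall.1 hχ1 y hy] with z hz
    rw [hz, one_mul]

end Coordinates

namespace Model

variable {d m k₁ k₂ n : ℕ} {𝒴 G Ω : Type*}
  [MeasurableSpace 𝒴] [MeasurableSpace G] [MeasurableSpace Ω]
  (M : Model d m k₁ k₂ n 𝒴 G Ω)

/-! ### The generator as a linear function of second order jets. -/

section Generator

/-- The diffusion coefficient `(σ σᵀ)ᵢⱼ`. -/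
def diffusion (a : Vec k₁) (y : Vec d) (i j : Fin d) : ℝ :=
  (M.σ y a * (M.σ y a).transpose) i j

theorem diffusion_symm (a : Vec k₁) (y : Vec d) (i j : Fin d) :
    M.diffusion a y i j = M.diffusion a y j i := by
  unfold diffusion
  simp only [Matrix.mul_apply, Matrix.transpose_apply]
  exact Finset.sum_congr rfl fun k _ => mul_comm _ _

/-- The size of the coefficients of the generator. -/
def genBound (a : Vec k₁) (y : Vec d) : ℝ :=
  ∑ i, |M.b y a i| + (1 / 2) * ∑ i, ∑ j, |M.diffusion a y i j|

theorem genBound_nonneg (a : Vec k₁) (y : Vec d) : 0 ≤ M.genBound a y := by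
  unfold genBound; positivity

theorem gen_eq_jet (a : Vec k₁) (φ : Vec d → ℝ) (y : Vec d) :
    M.gen a φ y = ∑ i, M.b y a i * (jet φ y).2.1 i
      + (1 / 2) * ∑ i, ∑ j, M.diffusion a y i j * (jet φ y).2.2 i j := rfl

theorem abs_gen_sub_le (a : Vec k₁) (φ ψ : Vec d → ℝ) (y : Vec d) :
    |M.gen a φ y - M.gen a ψ y| ≤ M.genBound a y * dist (jet φ y) (jet ψ y) := by
  set D := dist (jet φ y) (jet ψ y) with hD
  have h1 : ∀ i, |(jet φ y).2.1 i - (jet ψ y).2.1 i| ≤ D := fun i => by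
    have : dist ((jet φ y).2.1 i) ((jet ψ y).2.1 i) ≤ D :=
      (dist_le_pi_dist _ _ i).trans ((le_max_left _ _).trans (le_max_right _ _))
    rwa [Real.dist_eq] at this
  have h2 : ∀ i j, |(jet φ y).2.2 i j - (jet ψ y).2.2 i j| ≤ D := fun i j => by
    have : dist ((jet φ y).2.2 i j) ((jet ψ y).2.2 i j) ≤ D :=
      (dist_le_pi_dist _ _ j).trans ((dist_le_pi_dist _ _ i).trans
        ((le_max_right _ _).trans (le_max_right _ _)))
    rwa [Real.dist_eq] at this
  rw [gen_eq_jet, gen_eq_jet]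
  have e : (∑ i, M.b y a i * (jet φ y).2.1 i
      + (1 / 2) * ∑ i, ∑ j, M.diffusion a y i j * (jet φ y).2.2 i j)
      - (∑ i, M.b y a i * (jet ψ y).2.1 i
      + (1 / 2) * ∑ i, ∑ j, M.diffusion a y i j * (jet ψ y).2.2 i j)
      = ∑ i, M.b y a i * ((jet φ y).2.1 i - (jet ψ y).2.1 i)
      + (1 / 2) * ∑ i, ∑ j, M.diffusion a y i j * ((jet φ y).2.2 i j - (jet ψ y).2.2 i j) := by
    simp only [mul_sub, Finset.sum_sub_distrib]
    ring
  rw [e]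
  unfold genBound
  rw [add_mul, mul_assoc, Finset.sum_mul]
  refine (abs_add_le _ _).trans (add_le_add ?_ ?_)
  · refine (Finset.abs_sum_le_sum_abs _ _).trans (Finset.sum_le_sum fun i _ => ?_)
    rw [abs_mul]
    exact mul_le_mul_of_nonneg_left (h1 i) (abs_nonneg _)
  · rw [abs_mul, abs_of_nonneg (by norm_num : (0 : ℝ) ≤ 1 / 2)]
    refine mul_le_mul_of_nonneg_left ?_ (by norm_num)
    rw [Finset.sum_mul]
    refine (Finset.abs_sum_le_sum_abs _ _).trans (Finset.sum_le_sum fun i _ => ?_)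
    rw [Finset.sum_mul]
    refine (Finset.abs_sum_le_sum_abs _ _).trans (Finset.sum_le_sum fun j _ => ?_)
    rw [abs_mul]
    exact mul_le_mul_of_nonneg_left (h2 i j) (abs_nonneg _)

theorem gen_congr {a : Vec k₁} {φ ψ : Vec d → ℝ} {y : Vec d} (h : φ =ᶠ[𝓝 y] ψ) :
    M.gen a φ y = M.gen a ψ y := by
  rw [gen_eq_jet, gen_eq_jet, jet_congr h]

theorem gen_eq_zero {a : Vec k₁} {φ : Vec d → ℝ} {y : Vec d} (h : y ∉ tsupport φ) :
    M.gen a φ y = 0 := by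
  rw [gen_eq_jet, jet_eq_zero h]
  simp

/-- Coordinates, and then their products, make the generator reveal its drift and its diffusion
matrix. -/
theorem gen_coord (a : Vec k₁) (y : Vec d) (i : Fin d) :
    M.gen a (fun y => y i) y = M.b y a i := by
  have h2 : ∀ k l, pderiv l (pderiv k fun y : Vec d => y i) y = 0 := by
    intro k l
    rw [pderiv_coord]
    simp [pderiv]
  have h1 : ∀ k, pderiv k (fun y : Vec d => y i) y = if k = i then 1 else 0 := fun k =>
    congrFun (pderiv_coord k i) y
  unfold gen
  simp only [h2, h1]
  simp

theorem gen_coord_mul (a : Vec k₁) (y : Vec d) (i j : Fin d) :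
    M.gen a (fun y => y i * y j) y
      = M.b y a i * y j + M.b y a j * y i + M.diffusion a y i j := by
  have h1 : ∀ k, (jet (fun y : Vec d => y i * y j) y).2.1 k
      = (if k = i then y j else 0) + (if k = j then y i else 0) := fun k =>
    congrFun (pderiv_coord_mul k i j) y
  have h2 : ∀ l k, (jet (fun y : Vec d => y i * y j) y).2.2 l k
      = (if k = i then (if l = j then 1 else 0) else 0)
        + (if k = j then (if l = i then 1 else 0) else 0) := fun l k =>
    congrFun (pderiv_pderiv_coord_mul l k i j) y
  rw [gen_eq_jet]
  simp only [h1, h2, mul_add, Finset.sum_add_distrib]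
  have e1 : ∑ x, ∑ z, M.diffusion a y x z *
      (if z = i then (if x = j then (1 : ℝ) else 0) else 0) = M.diffusion a y j i := by
    simp
  have e2 : ∑ x, ∑ z, M.diffusion a y x z *
      (if z = j then (if x = i then (1 : ℝ) else 0) else 0) = M.diffusion a y i j := by
    simp
  rw [e1, e2, M.diffusion_symm a y j i]
  simp
  ring

variable {M} in
theorem Standing.measurable_diffusion (hM : M.Standing) (i j : Fin d) :
    Measurable fun p : Vec k₁ × Vec d => M.diffusion p.1 p.2 i j := by
  unfold diffusion
  simp only [Matrix.mul_apply, Matrix.transpose_apply]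
  exact Finset.measurable_sum _ fun k _ =>
    ((hM.meas_σ i k).comp measurable_swap).mul ((hM.meas_σ j k).comp measurable_swap)

variable {M} in
theorem Standing.measurable_drift (hM : M.Standing) (i : Fin d) :
    Measurable fun p : Vec k₁ × Vec d => M.b p.2 p.1 i :=
  (EuclideanSpace.proj (𝕜 := ℝ) i).continuous.measurable.comp (hM.meas_b.comp measurable_swap)

variable {M} in
theorem Standing.measurable_genBound (hM : M.Standing) :
    Measurable fun p : Vec k₁ × Vec d => M.genBound p.1 p.2 := by
  unfold genBound
  refine (Finset.measurable_sum _ fun i _ => (hM.measurable_drift i).abs).add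
    (measurable_const.mul ?_)
  exact Finset.measurable_sum _ fun i _ => Finset.measurable_sum _ fun j _ =>
    (hM.measurable_diffusion i j).abs

variable {M} in
theorem Standing.measurable_gen (hM : M.Standing) {φ : Vec d → ℝ} (hφ : IsTest φ) :
    Measurable fun p : Vec k₁ × Vec d => M.gen p.1 φ p.2 := by
  simp only [gen_eq_jet]
  have hj : Measurable (jet φ) := hφ.continuous_jet.measurable
  have h1 : ∀ i, Measurable fun p : Vec k₁ × Vec d => (jet φ p.2).2.1 i := fun i =>
    (measurable_pi_apply i).comp (measurable_fst.comp (measurable_snd.comp (hj.comp measurable_snd)))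
  have h2 : ∀ i j, Measurable fun p : Vec k₁ × Vec d => (jet φ p.2).2.2 i j := fun i j =>
    (measurable_pi_apply j).comp ((measurable_pi_apply i).comp
      (measurable_snd.comp (measurable_snd.comp (hj.comp measurable_snd))))
  refine (Finset.measurable_sum _ fun i _ => (hM.measurable_drift i).mul (h1 i)).add
    (measurable_const.mul ?_)
  exact Finset.measurable_sum _ fun i _ => Finset.measurable_sum _ fun j _ =>
    (hM.measurable_diffusion i j).mul (h2 i j)

end Generator

/-! ### Integrability of the generator along a path of laws. -/

section PathMeasure

/-- The measure `x r (dz) dr` on `[s, t] × ℝᵈ`. -/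
def pathMeasure (s t : ℝ) {x : ℝ → Law d} (hx : Measurable x) : Measure (ℝ × Vec d) :=
  (volume.restrict (Set.Icc s t)) ⊗ₘ ((lawKernel d).comap x hx)

theorem lintegral_pathMeasure {s t : ℝ} {x : ℝ → Law d} (hx : Measurable x)
    {f : ℝ × Vec d → ℝ≥0∞} (hf : Measurable f) :
    ∫⁻ p, f p ∂(pathMeasure s t hx)
      = ∫⁻ r in Set.Icc s t, ∫⁻ z, f (r, z) ∂(x r : Measure (Vec d)) :=
  Measure.lintegral_compProd hf

variable {M}

theorem Standing.measurable_gen_path (hM : M.Standing) {a : ℝ → Vec k₁} (ha : Measurable a)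
    {φ : Vec d → ℝ} (hφ : IsTest φ) : Measurable fun p : ℝ × Vec d => M.gen (a p.1) φ p.2 :=
  (hM.measurable_gen hφ).comp ((ha.comp measurable_fst).prodMk measurable_snd)

theorem integrable_gen_iff (hM : M.Standing) {s t : ℝ} {a : ℝ → Vec k₁} (ha : Measurable a)
    {x : ℝ → Law d} (hx : Measurable x) {φ : Vec d → ℝ} (hφ : IsTest φ) :
    Integrable (fun p : ℝ × Vec d => M.gen (a p.1) φ p.2) (pathMeasure s t hx)
      ↔ ∫⁻ r in Set.Icc s t, ∫⁻ z, ‖M.gen (a r) φ z‖ₑ ∂(x r : Measure (Vec d)) < ∞ := by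
  have hm := hM.measurable_gen_path ha hφ
  rw [Integrable, and_iff_right hm.aestronglyMeasurable, HasFiniteIntegral,
    lintegral_pathMeasure hx hm.enorm]

/-- Test functions equal to coordinates and to their products on a ball recover each coefficient
there, so testing all φ amounts to local integrability of the coefficients. Uncountably many
conditions become one for each N. -/
theorem integrable_gen_iff_genBound (hM : M.Standing) {s t : ℝ} {a : ℝ → Vec k₁}
    (ha : Measurable a) {x : ℝ → Law d} (hx : Measurable x) :
    (∀ φ, IsTest φ → Integrable (fun p : ℝ × Vec d => M.gen (a p.1) φ p.2) (pathMeasure s t hx))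
      ↔ ∀ N : ℕ, IntegrableOn (fun p : ℝ × Vec d => M.genBound (a p.1) p.2)
        (Set.univ ×ˢ Metric.closedBall 0 N) (pathMeasure s t hx) := by
  have hB : ∀ N : ℕ, MeasurableSet (Set.univ ×ˢ Metric.closedBall (0 : Vec d) N : Set (ℝ × Vec d)) :=
    fun N => MeasurableSet.univ.prod Metric.isClosed_closedBall.measurableSet
  constructor
  · intro h N
    obtain ⟨f, f₂, hf, hf₂, hfe, hf₂e⟩ := exists_coordinate_test d N
    have hb : ∀ i, IntegrableOn (fun p : ℝ × Vec d => M.b p.2 (a p.1) i)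
        (Set.univ ×ˢ Metric.closedBall 0 N) (pathMeasure s t hx) := fun i => by
      refine (h _ (hf i)).integrableOn.congr_fun (fun p hp => ?_) (hB N)
      simp only
      rw [M.gen_congr (hfe i p.2 hp.2), gen_coord]
    have hbc : ∀ i j, IntegrableOn (fun p : ℝ × Vec d => M.b p.2 (a p.1) i * p.2 j)
        (Set.univ ×ˢ Metric.closedBall 0 N) (pathMeasure s t hx) := fun i j => by
      refine Integrable.mul_bdd (c := (N : ℝ)) (hb i) ?_ ?_
      · exact ((EuclideanSpace.proj (𝕜 := ℝ) j).continuous.measurable.comp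
          measurable_snd).aestronglyMeasurable
      · refine (ae_restrict_iff' (hB N)).2 (ae_of_all _ fun p hp => ?_)
        have h1 : ‖p.2‖ ≤ N := by simpa using hp.2
        exact (PiLp.norm_apply_le p.2 j).trans h1
    have hd : ∀ i j, IntegrableOn (fun p : ℝ × Vec d => M.diffusion (a p.1) p.2 i j)
        (Set.univ ×ˢ Metric.closedBall 0 N) (pathMeasure s t hx) := fun i j => by
      have h1 := ((h _ (hf₂ i j)).integrableOn (s := Set.univ ×ˢ Metric.closedBall 0 N)).sub
        ((hbc i j).add (hbc j i))
      refine IntegrableOn.congr_fun h1 (fun p hp => ?_) (hB N)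
      simp only [Pi.sub_apply, Pi.add_apply]
      rw [M.gen_congr (hf₂e i j p.2 hp.2), gen_coord_mul]
      ring
    unfold genBound
    refine Integrable.add (integrable_finsetSum _ fun i _ => (hb i).abs) ?_
    exact (integrable_finsetSum _ fun i _ => integrable_finsetSum _ fun j _ =>
      (hd i j).abs).const_mul _
  · intro h φ hφ
    obtain ⟨R, hR⟩ := hφ.compact.isCompact.isBounded.subset_closedBall (0 : Vec d)
    obtain ⟨N, hN⟩ := exists_nat_ge R
    have hsub : tsupport φ ⊆ Metric.closedBall 0 N :=
      hR.trans (Metric.closedBall_subset_closedBall hN)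
    obtain ⟨C, hC⟩ : ∃ C, ∀ y, dist (jet φ y) 0 ≤ C := by
      have hcs : HasCompactSupport (jet φ) := by
        refine HasCompactSupport.intro hφ.compact.isCompact fun y hy => jet_eq_zero hy
      obtain ⟨C, hC⟩ := hφ.continuous_jet.bounded_above_of_compact_support hcs
      exact ⟨C, fun y => by rw [dist_zero_right]; exact hC y⟩
    have hsupp : (Set.univ ×ˢ Metric.closedBall (0 : Vec d) N : Set (ℝ × Vec d)).indicator
        (fun p => M.gen (a p.1) φ p.2) = fun p => M.gen (a p.1) φ p.2 := by
      funext p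
      by_cases hp : p ∈ (Set.univ ×ˢ Metric.closedBall (0 : Vec d) N : Set (ℝ × Vec d))
      · rw [Set.indicator_of_mem hp]
      · rw [Set.indicator_of_notMem hp, M.gen_eq_zero fun h' => hp ⟨trivial, hsub h'⟩]
    rw [← hsupp, integrable_indicator_iff (hB N)]
    refine ((h N).mul_const C).mono' (hM.measurable_gen_path ha hφ).aestronglyMeasurable
      (ae_of_all _ fun p => ?_)
    have h0 : jet (fun _ : Vec d => (0 : ℝ)) p.2 = 0 := jet_eq_zero (by simp)
    have h1 := M.abs_gen_sub_le (a p.1) φ (fun _ => 0) p.2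
    have h2 : M.gen (a p.1) (fun _ => 0) p.2 = 0 := by rw [gen_eq_jet, h0]; simp
    rw [h0, h2, sub_zero] at h1
    rw [Real.norm_eq_abs]
    exact h1.trans (mul_le_mul_of_nonneg_left (hC _) (M.genBound_nonneg _ _))

end PathMeasure

end Model

end ObsControl

/-! ### Solutions of the Fokker-Planck equation and their codes. -/

namespace ObsControl

theorem continuous_integral_test {d : ℕ} {φ : Vec d → ℝ} (hφ : IsTest φ) :
    Continuous fun ν : Law d => ∫ z, φ z ∂(ν : Measure (Vec d)) := by
  obtain ⟨C, hC⟩ := hφ.contDiff.continuous.bounded_above_of_compact_support hφ.compact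
  exact ProbabilityMeasure.continuous_integral_boundedContinuousFunction
    (BoundedContinuousFunction.ofNormedAddCommGroup φ hφ.contDiff.continuous C hC)

namespace Model

variable {d m k₁ k₂ n : ℕ} {𝒴 G Ω : Type*}
  [MeasurableSpace 𝒴] [MeasurableSpace G] [MeasurableSpace Ω]
  (M : Model d m k₁ k₂ n 𝒴 G Ω)

/-- The path `x` is, on `[s, t]`, a weak solution of the Fokker-Planck equation with control `a`
and initial law `ν`. -/
structure Segment (s t : ℝ) (ν : Law d) (a : ℝ → Vec k₁) (x : ℝ → Law d) : Prop where
  start : x s = ν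
  integrable : ∀ φ : Vec d → ℝ, IsTest φ →
    ∫⁻ r in Set.Icc s t, ∫⁻ z, ‖M.gen (a r) φ z‖ₑ ∂(x r : Measure (Vec d)) < ∞
  fokker_planck : ∀ r ∈ Set.Icc s t, ∀ φ : Vec d → ℝ, IsTest φ →
    ∫ z, φ z ∂(x r : Measure (Vec d)) = ∫ z, φ z ∂(ν : Measure (Vec d))
      + ∫ ρ in s..r, ∫ z, M.gen (a ρ) φ z ∂(x ρ : Measure (Vec d))

variable {M}

theorem integrableOn_gen_path (hM : M.Standing) {s t : ℝ} {a : ℝ → Vec k₁} (ha : Measurable a)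
    {x : ℝ → Law d} (hx : Measurable x) {φ : Vec d → ℝ} (hφ : IsTest φ)
    (h : ∫⁻ r in Set.Icc s t, ∫⁻ z, ‖M.gen (a r) φ z‖ₑ ∂(x r : Measure (Vec d)) < ∞) :
    IntegrableOn (fun r => ∫ z, M.gen (a r) φ z ∂(x r : Measure (Vec d))) (Set.Icc s t) := by
  have h1 := (integrable_gen_iff hM ha hx hφ).2 h
  have h2 : Integrable (fun r => ∫ z, M.gen (a r) φ z ∂((lawKernel d).comap x hx r))
      (volume.restrict (Set.Icc s t)) := by
    unfold pathMeasure at h1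
    rw [Measure.compProd] at h1
    exact h1.integral_compProd
  exact h2

theorem intervalIntegrable_gen_path (hM : M.Standing) {s t : ℝ} {a : ℝ → Vec k₁}
    (ha : Measurable a) {x : ℝ → Law d} (hx : Measurable x) {φ : Vec d → ℝ} (hφ : IsTest φ)
    (h : ∫⁻ r in Set.Icc s t, ∫⁻ z, ‖M.gen (a r) φ z‖ₑ ∂(x r : Measure (Vec d)) < ∞)
    {r₁ r₂ : ℝ} (h₁ : r₁ ∈ Set.Icc s t) (h₂ : r₂ ∈ Set.Icc s t) :
    IntervalIntegrable (fun r => ∫ z, M.gen (a r) φ z ∂(x r : Measure (Vec d))) volume r₁ r₂ := by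
  have h3 : IntegrableOn (fun r => ∫ z, M.gen (a r) φ z ∂(x r : Measure (Vec d)))
      (Set.uIcc r₁ r₂) :=
    (integrableOn_gen_path hM ha hx hφ h).mono_set (Set.uIcc_subset_Icc h₁ h₂)
  exact h3.intervalIntegrable

/-- Integrals of test functions are primitives of integrable functions, hence continuous in time,
and they determine weak convergence. -/
theorem Segment.continuousOn (hM : M.Standing) {s t : ℝ} {ν : Law d} {a : ℝ → Vec k₁}
    (ha : Measurable a) {x : ℝ → Law d} (hx : Measurable x) (h : M.Segment s t ν a x) :
    ContinuousOn x (Set.Icc s t) := by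
  intro r hr
  refine tendsto_law_of_test fun φ hφ => ?_
  have hst : s ≤ t := hr.1.trans hr.2
  have h1 := intervalIntegral.continuousOn_primitive_interval (a := s) (b := t) (μ := volume)
    (f := fun r => ∫ z, M.gen (a r) φ z ∂(x r : Measure (Vec d)))
    (by rw [Set.uIcc_of_le hst]; exact integrableOn_gen_path hM ha hx hφ (h.integrable φ hφ))
  rw [Set.uIcc_of_le hst] at h1
  have h2 := (h1 r hr).const_add (∫ z, φ z ∂(ν : Measure (Vec d)))
  rw [h.fokker_planck r hr φ hφ]
  refine Tendsto.congr' ?_ h2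
  filter_upwards [self_mem_nhdsWithin] with r' hr'
  rw [h.fokker_planck r' hr' φ hφ]

theorem Segment.two_times (hM : M.Standing) {s t : ℝ} {ν : Law d} {a : ℝ → Vec k₁}
    (ha : Measurable a) {x : ℝ → Law d} (hx : Measurable x) (h : M.Segment s t ν a x)
    {r₁ r₂ : ℝ} (h₁ : r₁ ∈ Set.Icc s t) (h₂ : r₂ ∈ Set.Icc s t) {φ : Vec d → ℝ} (hφ : IsTest φ) :
    ∫ z, φ z ∂(x r₂ : Measure (Vec d)) = ∫ z, φ z ∂(x r₁ : Measure (Vec d))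
      + ∫ ρ in r₁..r₂, ∫ z, M.gen (a ρ) φ z ∂(x ρ : Measure (Vec d)) := by
  rw [h.fokker_planck r₂ h₂ φ hφ, h.fokker_planck r₁ h₁ φ hφ, add_assoc,
    intervalIntegral.integral_add_adjacent_intervals]
  · exact intervalIntegrable_gen_path hM ha hx hφ (h.integrable φ hφ)
      (Set.left_mem_Icc.2 (h₁.1.trans h₁.2)) h₁
  · exact intervalIntegrable_gen_path hM ha hx hφ (h.integrable φ hφ) h₁ h₂

theorem Segment.congr {s t : ℝ} {ν : Law d} {a a' : ℝ → Vec k₁} {x x' : ℝ → Law d}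
    (h : M.Segment s t ν a x) (hst : s ≤ t) (hx : ∀ r ∈ Set.Icc s t, x' r = x r)
    (ha : ∀ᵐ r ∂(volume.restrict (Set.Icc s t)), a' r = a r) : M.Segment s t ν a' x' := by
  refine ⟨(hx s (Set.left_mem_Icc.2 hst)).trans h.start, fun φ hφ => ?_, fun r hr φ hφ => ?_⟩
  · rw [lintegral_congr_ae (g := fun r => ∫⁻ z, ‖M.gen (a r) φ z‖ₑ ∂(x r : Measure (Vec d)))]
    · exact h.integrable φ hφ
    · filter_upwards [ha, ae_restrict_mem measurableSet_Icc] with r h1 h2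
      rw [h1, hx r h2]
  · rw [hx r hr, h.fokker_planck r hr φ hφ]
    congr 1
    apply intervalIntegral.integral_congr_ae_restrict
    rw [Set.uIoc_of_le hr.1]
    have hsub : Set.Ioc s r ⊆ Set.Icc s t := fun ρ hρ => ⟨hρ.1.le, hρ.2.trans hr.2⟩
    filter_upwards [ae_restrict_of_ae_restrict_of_subset hsub ha,
      ae_restrict_mem measurableSet_Ioc] with ρ h1 h2
    rw [h1, hx ρ (hsub h2)]

variable (M)

variable (k₁) in
/-- A universal evaluation map for control paths. -/
def evalControl : (ℕ → ℕ) × ℝ → Vec k₁ := (exists_universal_evaluation ℝ (Vec k₁)).choose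

variable (d) in
/-- A universal evaluation map for paths of laws. -/
def evalLaw : (ℕ → ℕ) × ℝ → Law d := (exists_universal_evaluation ℝ (Law d)).choose

omit M in
theorem measurable_evalControl : Measurable (evalControl k₁) :=
  (exists_universal_evaluation ℝ (Vec k₁)).choose_spec.1

omit M in
theorem measurable_evalLaw : Measurable (evalLaw d) :=
  (exists_universal_evaluation ℝ (Law d)).choose_spec.1

variable (k₁ k₂) in
/-- Codes for a control path, a path of laws, a default control value, and a precision. -/
abbrev Code := (ℕ → ℕ) × (ℕ → ℕ) × Vec k₁ × Vec k₂

/-- The pair of default control values of a code. -/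
def codePair (z : Code k₁ k₂) : Vec k₁ × Vec k₂ := z.2.2

open Classical in
/-- The control path with a given code. -/
def codeControl (z : Code k₁ k₂) (r : ℝ) : Vec k₁ :=
  if (evalControl k₁ (z.1, r), z.2.2.2) ∈ M.U then evalControl k₁ (z.1, r) else z.2.2.1

/-- The integrals of test functions along the Fokker-Planck flow described by a code. -/
def codeVec (s : ℝ) (p : Law d × Code k₁ k₂) (r : ℝ) (k : ℕ) : ℝ :=
  testVec p.1 k + ∫ ρ in Set.Ioc s r,
    ∫ z, M.gen (M.codeControl p.2 ρ) (testSeq d k) z ∂(evalLaw d (p.2.2.1, ρ) : Measure (Vec d))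

/-- The path of laws with a given code and initial value. -/
def codeLaw (s : ℝ) (p : Law d × Code k₁ k₂) (r : ℝ) : Law d := lawOfVec (M.codeVec s p r)

variable {M}

/-- Decoding is faithful only for almost every time, whereas admissibility constrains every time;
the default value of the code takes care of the exceptional times. -/
theorem codeControl_mem {z : Code k₁ k₂} (hz : codePair z ∈ M.U) (r : ℝ) :
    (M.codeControl z r, z.2.2.2) ∈ M.U := by
  unfold codeControl
  split_ifs with h
  · exact h
  · exact hz

theorem Standing.measurable_codeControl (hM : M.Standing) :
    Measurable fun q : Code k₁ k₂ × ℝ => M.codeControl q.1 q.2 := by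
  have h1 : Measurable fun q : Code k₁ k₂ × ℝ => evalControl k₁ (q.1.1, q.2) :=
    measurable_evalControl.comp ((measurable_fst.comp measurable_fst).prodMk measurable_snd)
  have h2 : Measurable fun q : Code k₁ k₂ × ℝ => q.1.2.2.2 := by fun_prop
  have h3 : Measurable fun q : Code k₁ k₂ × ℝ => q.1.2.2.1 := by fun_prop
  unfold codeControl
  exact Measurable.ite (h1.prodMk h2 hM.meas_U) h1 h3

/-- The kernel associated with the paths of laws coded by `evalLaw`. -/
def codeKernel : Kernel (Code k₁ k₂ × ℝ) (Vec d) :=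
  (lawKernel d).comap (fun q : Code k₁ k₂ × ℝ => evalLaw d (q.1.2.1, q.2))
    (measurable_evalLaw.comp (by fun_prop))

instance : IsMarkovKernel (codeKernel (d := d) (k₁ := k₁) (k₂ := k₂)) := by
  unfold codeKernel; infer_instance

theorem Standing.measurable_codeVec (hM : M.Standing) (s : ℝ) :
    Measurable fun q : (Law d × Code k₁ k₂) × ℝ => M.codeVec s q.1 q.2 := by
  refine measurable_pi_lambda _ fun k => ?_
  refine Measurable.add ?_ ?_
  · exact (measurable_pi_apply k).comp (measurable_testVec.comp (by fun_prop))
  · have h0 : Measurable fun w : (Code k₁ k₂ × ℝ) × Vec d =>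
        M.gen (M.codeControl w.1.1 w.1.2) (testSeq d k) w.2 :=
      (hM.measurable_gen (isTest_testSeq k)).comp
        ((hM.measurable_codeControl.comp measurable_fst).prodMk measurable_snd)
    have h1 : StronglyMeasurable fun w : Code k₁ k₂ × ℝ =>
        ∫ z, M.gen (M.codeControl w.1 w.2) (testSeq d k) z ∂(codeKernel (d := d) w) :=
      h0.stronglyMeasurable.integral_kernel_prod_right'
    have h2 : Measurable fun w : ((Law d × Code k₁ k₂) × ℝ) × ℝ =>
        {w : ((Law d × Code k₁ k₂) × ℝ) × ℝ | s < w.2 ∧ w.2 ≤ w.1.2}.indicator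
          (fun w => ∫ z, M.gen (M.codeControl w.1.1.2 w.2) (testSeq d k) z
            ∂(codeKernel (d := d) (w.1.1.2, w.2))) w := by
      refine Measurable.indicator ?_ ?_
      · have h3 : Measurable fun w : ((Law d × Code k₁ k₂) × ℝ) × ℝ => (w.1.1.2, w.2) := by fun_prop
        exact h1.measurable.comp h3
      · have h5 : Measurable fun w : ((Law d × Code k₁ k₂) × ℝ) × ℝ => w.2 := measurable_snd
        have h6 : Measurable fun w : ((Law d × Code k₁ k₂) × ℝ) × ℝ => w.1.2 := by fun_prop
        exact (measurableSet_lt measurable_const h5).inter (measurableSet_le h5 h6)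
    have h4 := (h2.stronglyMeasurable.integral_prod_right' (ν := volume)).measurable
    have h7 : (fun q : (Law d × Code k₁ k₂) × ℝ => ∫ ρ in Set.Ioc s q.2,
        ∫ z, M.gen (M.codeControl q.1.2 ρ) (testSeq d k) z
          ∂(evalLaw d (q.1.2.2.1, ρ) : Measure (Vec d)))
        = fun q => ∫ ρ, {w : ((Law d × Code k₁ k₂) × ℝ) × ℝ | s < w.2 ∧ w.2 ≤ w.1.2}.indicator
          (fun w => ∫ z, M.gen (M.codeControl w.1.1.2 w.2) (testSeq d k) z
            ∂(codeKernel (d := d) (w.1.1.2, w.2))) (q, ρ) := by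
      funext q
      rw [← integral_indicator measurableSet_Ioc]
      rfl
    rw [h7]
    exact h4

theorem Standing.measurable_codeLaw (hM : M.Standing) (s : ℝ) :
    Measurable fun q : (Law d × Code k₁ k₂) × ℝ => M.codeLaw s q.1 q.2 :=
  measurable_lawOfVec.comp (hM.measurable_codeVec s)

/-- A code is valid for an initial law if it describes a solution of the Fokker-Planck equation. -/
def ValidCode (M : Model d m k₁ k₂ n 𝒴 G Ω) (s t : ℝ) (p : Law d × Code k₁ k₂) : Prop :=
  codePair p.2 ∈ M.U ∧
    (∀ᵐ r ∂(volume.restrict (Set.Icc s t)), M.codeLaw s p r = evalLaw d (p.2.2.1, r)) ∧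
    M.Segment s t p.1 (M.codeControl p.2) (M.codeLaw s p)

/-- The universal evaluation gives the laws only almost everywhere. Inserted in the right side of
the Fokker-Planck equation, which does not see null sets, they yield the integrals of test functions
at every time, and decoding these recovers the path everywhere on the interval. -/
theorem exists_validCode {s t : ℝ} (hst : s ≤ t) {ν : Law d} {a : ℝ → Vec k₁}
    {x : ℝ → Law d} (ha : Measurable a) (hx : Measurable x) {β : Vec k₂}
    (hU : ∀ r, (a r, β) ∈ M.U) (h : M.Segment s t ν a x) :
    ∃ z : Code k₁ k₂, M.ValidCode s t (ν, z) ∧ z.2.2.2 = β ∧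
      (∀ᵐ r ∂(volume.restrict (Set.Icc s t)), M.codeControl z r = a r) ∧
      ∀ r ∈ Set.Icc s t, M.codeLaw s (ν, z) r = x r := by
  obtain ⟨za, hza⟩ := (exists_universal_evaluation ℝ (Vec k₁)).choose_spec.2
    (volume.restrict (Set.Icc s t)) a ha
  obtain ⟨zx, hzx⟩ := (exists_universal_evaluation ℝ (Law d)).choose_spec.2
    (volume.restrict (Set.Icc s t)) x hx
  let z : Code k₁ k₂ := (za, zx, a 0, β)
  have h1 : ∀ᵐ r ∂(volume.restrict (Set.Icc s t)), M.codeControl z r = a r := by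
    filter_upwards [hza] with r hr
    have hr' : evalControl k₁ (za, r) = a r := hr
    have h0 : (evalControl k₁ (z.1, r), z.2.2.2) ∈ M.U := by
      change (evalControl k₁ (za, r), β) ∈ M.U
      rw [hr']; exact hU r
    rw [codeControl, if_pos h0]
    exact hr'
  have h2 : ∀ r ∈ Set.Icc s t, M.codeLaw s (ν, z) r = x r := by
    intro r hr
    have h3 : M.codeVec s (ν, z) r = testVec (x r) := by
      funext k
      have h4 := h.fokker_planck r hr (testSeq d k) (isTest_testSeq k)
      unfold codeVec
      rw [testVec, testVec, h4, intervalIntegral.integral_of_le hr.1]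
      congr 1
      have hsub : Set.Ioc s r ⊆ Set.Icc s t := fun ρ hρ => ⟨hρ.1.le, hρ.2.trans hr.2⟩
      apply integral_congr_ae
      filter_upwards [ae_restrict_of_ae_restrict_of_subset hsub h1,
        ae_restrict_of_ae_restrict_of_subset hsub hzx] with ρ h5 h6
      have h6' : evalLaw d (zx, ρ) = x ρ := h6
      rw [h5, h6']
    rw [codeLaw, h3, lawOfVec_testVec]
  refine ⟨z, ⟨hU 0, ?_, h.congr hst h2 h1⟩, rfl, h1, h2⟩
  filter_upwards [hzx, ae_restrict_mem measurableSet_Icc] with r hr hr2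
  rw [h2 r hr2]
  exact hr.symm

end Model

end ObsControl

/-! ### Valid codes form a Borel set. -/

namespace ObsControl

theorem exists_rat_seq_tendsto {s t r : ℝ} (hst : s < t) (hr : r ∈ Set.Icc s t) :
    ∃ q : ℕ → ℚ, (∀ j, (q j : ℝ) ∈ Set.Icc s t) ∧ Tendsto (fun j => (q j : ℝ)) atTop (𝓝 r) := by
  have h1 : r ∈ closure (Set.Ioo s t ∩ Set.range ((↑) : ℚ → ℝ)) := by
    have h2 := closure_mono
      (Rat.isDenseEmbedding_coe_real.dense.open_subset_closure_inter (isOpen_Ioo (a := s) (b := t)))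
    rw [closure_closure, closure_Ioo hst.ne] at h2
    exact h2 hr
  obtain ⟨f, hf, hfr⟩ := mem_closure_iff_seq_limit.1 h1
  choose q hq using fun j => (hf j).2
  refine ⟨q, fun j => ?_, ?_⟩
  · rw [hq j]; exact Set.Ioo_subset_Icc_self (hf j).1
  · simpa only [hq] using hfr

/-- Uniform tightness along rational times. -/
def RatTight {d : ℕ} (s t : ℝ) (x : ℝ → Law d) : Prop :=
  ∀ k : ℕ, ∃ N : ℕ, ∀ q : ℚ, (q : ℝ) ∈ Set.Icc s t →
    (x q : Measure (Vec d)) (Metric.closedBall 0 N)ᶜ ≤ 1 / ((k : ℝ≥0∞) + 1)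

theorem RatTight.isCompact_closure {d : ℕ} {s t : ℝ} {x : ℝ → Law d} (h : RatTight s t x) :
    IsCompact (closure (x '' {r | r ∈ Set.Icc s t ∧ ∃ q : ℚ, (q : ℝ) = r})) := by
  refine isCompact_closure_of_isTightMeasureSet ?_
  rw [isTightMeasureSet_iff_exists_isCompact_measure_compl_le]
  intro ε hε
  obtain ⟨k, hk⟩ := ENNReal.exists_inv_nat_lt hε.ne'
  obtain ⟨N, hN⟩ := h k
  refine ⟨Metric.closedBall 0 N, isCompact_closedBall _ _, ?_⟩
  rintro μ ⟨ν, ⟨r, ⟨hr, q, rfl⟩, rfl⟩, rfl⟩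
  refine (hN q hr).trans (le_trans ?_ hk.le)
  rw [one_div]
  exact ENNReal.inv_le_inv.2 le_self_add

/-- The image of the compact interval is compact, hence tight by the converse half of Prokhorov's
theorem. -/
theorem ratTight_of_continuousOn {d : ℕ} {s t : ℝ} {x : ℝ → Law d}
    (h : ContinuousOn x (Set.Icc s t)) : RatTight s t x := by
  have h1 : IsCompact (closure (x '' Set.Icc s t)) := by
    have := isCompact_Icc.image_of_continuousOn h
    rwa [this.isClosed.closure_eq]
  have h2 := isTightMeasureSet_of_isCompact_closure h1
  rw [isTightMeasureSet_iff_exists_isCompact_measure_compl_le] at h2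
  intro k
  obtain ⟨K, hK, hK'⟩ := h2 (1 / ((k : ℝ≥0∞) + 1)) (by simp)
  obtain ⟨R, hR⟩ := hK.isBounded.subset_closedBall (0 : Vec d)
  obtain ⟨N, hN⟩ := exists_nat_ge R
  refine ⟨N, fun q hq => le_trans (measure_mono ?_) (hK' _ ⟨x q, ⟨q, hq, rfl⟩, rfl⟩)⟩
  exact Set.compl_subset_compl.2 (hR.trans (Metric.closedBall_subset_closedBall hN))

namespace Model

variable {d m k₁ k₂ n : ℕ} {𝒴 G Ω : Type*}
  [MeasurableSpace 𝒴] [MeasurableSpace G] [MeasurableSpace Ω]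
  {M : Model d m k₁ k₂ n 𝒴 G Ω}

theorem integrable_genBound_iff (hM : M.Standing) {s t : ℝ} {a : ℝ → Vec k₁} (ha : Measurable a)
    {x : ℝ → Law d} (hx : Measurable x) (N : ℕ) :
    IntegrableOn (fun p : ℝ × Vec d => M.genBound (a p.1) p.2)
        (Set.univ ×ˢ Metric.closedBall 0 N) (pathMeasure s t hx) ↔
      ∫⁻ r in Set.Icc s t, ∫⁻ z in Metric.closedBall 0 N, ENNReal.ofReal (M.genBound (a r) z)
        ∂(x r : Measure (Vec d)) < ∞ := by
  have hB : MeasurableSet (Set.univ ×ˢ Metric.closedBall (0 : Vec d) N : Set (ℝ × Vec d)) :=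
    MeasurableSet.univ.prod Metric.isClosed_closedBall.measurableSet
  have hm : Measurable fun p : ℝ × Vec d => M.genBound (a p.1) p.2 :=
    hM.measurable_genBound.comp ((ha.comp measurable_fst).prodMk measurable_snd)
  rw [IntegrableOn, Integrable, and_iff_right hm.aestronglyMeasurable, HasFiniteIntegral,
    ← lintegral_indicator hB, lintegral_pathMeasure hx (hm.enorm.indicator hB)]
  refine iff_of_eq (congrArg (· < ∞) (lintegral_congr fun r => ?_))
  rw [← lintegral_indicator Metric.isClosed_closedBall.measurableSet]
  refine lintegral_congr fun z => ?_
  by_cases hz : z ∈ Metric.closedBall (0 : Vec d) N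
  · rw [Set.indicator_of_mem hz, Set.indicator_of_mem (Set.mem_prod.2 ⟨Set.mem_univ r, hz⟩),
      Real.enorm_of_nonneg (M.genBound_nonneg _ _)]
  · rw [Set.indicator_of_notMem hz, Set.indicator_of_notMem fun h => hz h.2]

/-- The weak Fokker-Planck equation follows from its countably many instances. -/
theorem fokker_planck_of_testSeq (hM : M.Standing) {s t : ℝ} {ν : Law d} {a : ℝ → Vec k₁}
    (ha : Measurable a) {x : ℝ → Law d} (hx : Measurable x)
    (hint : ∀ φ : Vec d → ℝ, IsTest φ →
      Integrable (fun p : ℝ × Vec d => M.gen (a p.1) φ p.2) (pathMeasure s t hx))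
    {r : ℝ} (hr : r ∈ Set.Icc s t)
    (h : ∀ k, ∫ z, testSeq d k z ∂(x r : Measure (Vec d))
      = ∫ z, testSeq d k z ∂(ν : Measure (Vec d)) + ∫ ρ in Set.Ioc s r,
        ∫ z, M.gen (a ρ) (testSeq d k) z ∂(x ρ : Measure (Vec d)))
    {φ : Vec d → ℝ} (hφ : IsTest φ) :
    ∫ z, φ z ∂(x r : Measure (Vec d)) = ∫ z, φ z ∂(ν : Measure (Vec d)) + ∫ ρ in Set.Ioc s r,
        ∫ z, M.gen (a ρ) φ z ∂(x ρ : Measure (Vec d)) := by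
  obtain ⟨N, k, hN, hk⟩ := exists_testSeq_approx hφ
  have hB : MeasurableSet (Set.univ ×ˢ Metric.closedBall (0 : Vec d) N : Set (ℝ × Vec d)) :=
    MeasurableSet.univ.prod Metric.isClosed_closedBall.measurableSet
  have hg := (integrable_gen_iff_genBound hM ha hx).1 hint N
  have hsub : Set.Ioc s r ⊆ Set.Icc s t := fun ρ hρ => ⟨hρ.1.le, hρ.2.trans hr.2⟩
  have hpm : ∀ φ, IsTest φ → ∫ ρ in Set.Ioc s r, ∫ z, M.gen (a ρ) φ z ∂(x ρ : Measure (Vec d))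
      = ∫ p in Set.Ioc s r ×ˢ Set.univ, M.gen (a p.1) φ p.2 ∂(pathMeasure s t hx) := by
    intro φ hφ
    have h1 := (hint φ hφ).integrableOn (s := Set.Ioc s r ×ˢ Set.univ)
    unfold pathMeasure at h1 ⊢
    rw [Measure.setIntegral_compProd measurableSet_Ioc MeasurableSet.univ h1,
      Measure.restrict_restrict measurableSet_Ioc, Set.inter_eq_left.2 hsub]
    simp only [Measure.restrict_univ]
    rfl
  have hlim : Tendsto (fun j => ∫ ρ in Set.Ioc s r, ∫ z, M.gen (a ρ) (testSeq d (k j)) z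
      ∂(x ρ : Measure (Vec d))) atTop (𝓝 (∫ ρ in Set.Ioc s r, ∫ z, M.gen (a ρ) φ z
      ∂(x ρ : Measure (Vec d)))) := by
    simp only [hpm _ (isTest_testSeq _), hpm _ hφ]
    -- Off the ball of radius N both generators vanish; on it they differ by at most `genBound`
    -- times 1/(j+1). The error is therefore at most C/(j+1).
    set C := ∫ p in Set.univ ×ˢ Metric.closedBall 0 N, M.genBound (a p.1) p.2
      ∂(pathMeasure s t hx)
    rw [tendsto_iff_dist_tendsto_zero]
    refine squeeze_zero (g := fun j : ℕ => 1 / ((j : ℝ) + 1) * C) (fun _ => dist_nonneg)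
      (fun j => ?_) ?_
    · rw [Real.dist_eq, ← integral_sub (hint _ (isTest_testSeq _)).integrableOn
        (hint _ hφ).integrableOn, ← Real.norm_eq_abs]
      refine (norm_integral_le_integral_norm _).trans ?_
      have hI : Integrable ((Set.univ ×ˢ Metric.closedBall (0 : Vec d) N : Set (ℝ × Vec d)).indicator
          fun p => 1 / ((j : ℝ) + 1) * M.genBound (a p.1) p.2) (pathMeasure s t hx) :=
        (integrable_indicator_iff hB).2 (hg.const_mul _)
      have hle : ∀ p : ℝ × Vec d, ‖M.gen (a p.1) (testSeq d (k j)) p.2 - M.gen (a p.1) φ p.2‖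
          ≤ (Set.univ ×ˢ Metric.closedBall (0 : Vec d) N : Set (ℝ × Vec d)).indicator
            (fun p => 1 / ((j : ℝ) + 1) * M.genBound (a p.1) p.2) p := by
        intro p
        by_cases hp : p.2 ∈ Metric.closedBall (0 : Vec d) N
        · rw [Set.indicator_of_mem (Set.mem_prod.2 ⟨Set.mem_univ p.1, hp⟩), mul_comm]
          exact (M.abs_gen_sub_le _ _ _ _).trans
            (mul_le_mul_of_nonneg_left ((hk j).2 _).le (M.genBound_nonneg _ _))
        · rw [Set.indicator_of_notMem fun h => hp h.2, M.gen_eq_zero fun h => hp ((hk j).1 h),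
            M.gen_eq_zero fun h => hp (hN h)]
          simp
      have hd := (hint _ (isTest_testSeq (k j))).sub (hint _ hφ)
      calc _ ≤ ∫ p, ‖M.gen (a p.1) (testSeq d (k j)) p.2 - M.gen (a p.1) φ p.2‖
              ∂(pathMeasure s t hx) :=
            setIntegral_le_integral hd.norm (ae_of_all _ fun _ => norm_nonneg _)
        _ ≤ _ := integral_mono hd.norm hI hle
        _ = _ := by rw [integral_indicator hB, integral_const_mul]
    · simpa using (tendsto_one_div_add_atTop_nhds_zero_nat (𝕜 := ℝ)).mul_const C
  have hk' := fun j => (hk j).2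
  refine tendsto_nhds_unique (tendsto_integral_testSeq hk' hφ (x r)) ?_
  simp only [h]
  exact (tendsto_integral_testSeq hk' hφ ν).add hlim

/-- A countable criterion for the Fokker-Planck equation. -/
theorem segment_of_rational (hM : M.Standing) {s t : ℝ} (hst : s < t) {ν : Law d}
    {a : ℝ → Vec k₁} (ha : Measurable a) {x : ℝ → Law d} (hx : Measurable x)
    {v : ℝ → ℕ → ℝ} (hv : ∀ r ∈ Set.Icc s t, ∀ k, v r k = testVec ν k + ∫ ρ in Set.Ioc s r,
        ∫ z, M.gen (a ρ) (testSeq d k) z ∂(x ρ : Measure (Vec d)))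
    (hxv : ∀ r, x r = lawOfVec (v r))
    (hB : ∀ N : ℕ, ∫⁻ r in Set.Icc s t, ∫⁻ z in Metric.closedBall 0 N,
      ENNReal.ofReal (M.genBound (a r) z) ∂(x r : Measure (Vec d)) < ∞)
    (hq : ∀ q : ℚ, (q : ℝ) ∈ Set.Icc s t → testVec (x q) = v q)
    (ht : RatTight s t x) : M.Segment s t ν a x := by
  have hint := (integrable_gen_iff_genBound hM ha hx).2
    fun N => (integrable_genBound_iff hM ha hx N).2 (hB N)
  have hint' : ∀ φ, IsTest φ → _ := fun φ hφ => (integrable_gen_iff hM ha hx hφ).1 (hint φ hφ)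
  have hcont : ∀ k, ContinuousOn (fun r => v r k) (Set.Icc s t) := by
    intro k
    have h1 := intervalIntegral.continuousOn_primitive_interval (a := s) (b := t) (μ := volume)
      (f := fun r => ∫ z, M.gen (a r) (testSeq d k) z ∂(x r : Measure (Vec d)))
      (by rw [Set.uIcc_of_le hst.le]; exact integrableOn_gen_path hM ha hx (isTest_testSeq k)
            (hint' _ (isTest_testSeq k)))
    rw [Set.uIcc_of_le hst.le] at h1
    refine (h1.const_add (testVec ν k)).congr fun r hr => ?_
    simp only
    rw [hv r hr k, intervalIntegral.integral_of_le hr.1]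
  -- It is not automatic that `v r` consists of the integrals of some law. Along rational times
  -- converging to r, tightness produces a limit law whose integrals are `v r` by continuity of v;
  -- hence decoding is exact at every r.
  have key : ∀ r ∈ Set.Icc s t, testVec (x r) = v r := by
    intro r hr
    obtain ⟨q, hqm, hqr⟩ := exists_rat_seq_tendsto hst hr
    obtain ⟨ρ, -, f, hf, hρ⟩ := ht.isCompact_closure.tendsto_subseq (x := fun j => x (q j))
      fun j => subset_closure ⟨_, ⟨hqm j, q j, rfl⟩, rfl⟩
    have hρv : testVec ρ = v r := by
      funext k
      have h1 := ((continuous_integral_test (isTest_testSeq (d := d) k)).tendsto ρ).comp hρ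
      have h2 : Tendsto (fun j => v (q (f j)) k) atTop (𝓝 (v r k)) :=
        (hcont k r hr).tendsto.comp (tendsto_nhdsWithin_iff.2
          ⟨hqr.comp hf.tendsto_atTop, Eventually.of_forall fun j => hqm _⟩)
      refine tendsto_nhds_unique h1 (h2.congr fun j => ?_)
      rw [← hq _ (hqm _)]
      rfl
    rw [hxv r, ← hρv, lawOfVec_testVec]
  refine ⟨?_, hint', fun r hr φ hφ => ?_⟩
  · have hs : s ∈ Set.Icc s t := Set.left_mem_Icc.2 hst.le
    refine testVec_injective ?_
    rw [key s hs]
    funext k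
    rw [hv s hs k]
    simp
  · rw [intervalIntegral.integral_of_le hr.1]
    refine fokker_planck_of_testSeq hM ha hx hint hr (fun k => ?_) hφ
    have := hv r hr k
    rw [← key r hr] at this
    exact this

/-- Every condition on the right is an almost everywhere statement or is indexed by countably many
integers and rationals, and so is Borel in p. Tightness at rational times replaces continuity of the
path. -/
theorem validCode_iff (hM : M.Standing) {s t : ℝ} (hst : s < t) (p : Law d × Code k₁ k₂) :
    M.ValidCode s t p ↔ codePair p.2 ∈ M.U ∧
      (∀ᵐ r ∂(volume.restrict (Set.Icc s t)), M.codeLaw s p r = evalLaw d (p.2.2.1, r)) ∧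
      (∀ N : ℕ, ∫⁻ r in Set.Icc s t, ∫⁻ z in Metric.closedBall 0 N,
        ENNReal.ofReal (M.genBound (M.codeControl p.2 r) z) ∂(M.codeLaw s p r : Measure (Vec d))
          < ∞) ∧
      (∀ q : ℚ, (q : ℝ) ∈ Set.Icc s t → testVec (M.codeLaw s p q) = M.codeVec s p q) ∧
      RatTight s t (M.codeLaw s p) := by
  have ha : Measurable (M.codeControl p.2) :=
    hM.measurable_codeControl.comp (measurable_const.prodMk measurable_id)
  have hx : Measurable (M.codeLaw s p) :=
    (hM.measurable_codeLaw s).comp (measurable_const.prodMk measurable_id)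
  unfold ValidCode
  refine and_congr_right fun _ => and_congr_right fun hae => ?_
  have hv : ∀ r ∈ Set.Icc s t, ∀ k, M.codeVec s p r k = testVec p.1 k + ∫ ρ in Set.Ioc s r,
      ∫ z, M.gen (M.codeControl p.2 ρ) (testSeq d k) z
        ∂(M.codeLaw s p ρ : Measure (Vec d)) := by
    intro r hr k
    unfold codeVec
    congr 1
    have hsub : Set.Ioc s r ⊆ Set.Icc s t := fun ρ hρ => ⟨hρ.1.le, hρ.2.trans hr.2⟩
    refine integral_congr_ae ?_
    filter_upwards [ae_restrict_of_ae_restrict_of_subset hsub hae] with ρ hρ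
    rw [hρ]
  constructor
  · intro h
    refine ⟨fun N => ?_, fun q hq => ?_, ratTight_of_continuousOn (h.continuousOn hM ha hx)⟩
    · rw [← integrable_genBound_iff hM ha hx]
      exact (integrable_gen_iff_genBound hM ha hx).1
        (fun φ hφ => (integrable_gen_iff hM ha hx hφ).2 (h.integrable φ hφ)) N
    · funext k
      rw [hv q hq k]
      have := h.fokker_planck q hq _ (isTest_testSeq k)
      rwa [intervalIntegral.integral_of_le hq.1] at this
  · rintro ⟨h1, h2, h3⟩
    exact segment_of_rational hM hst ha hx hv (fun _ => rfl) h1 h2 h3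

theorem measurableSet_validCode (hM : M.Standing) {s t : ℝ} (hst : s < t) :
    MeasurableSet {p : Law d × Code k₁ k₂ | M.ValidCode s t p} := by
  have hL := hM.measurable_codeLaw s
  have hE : Measurable fun q : (Law d × Code k₁ k₂) × ℝ => evalLaw d (q.1.2.2.1, q.2) :=
    measurable_evalLaw.comp (by fun_prop)
  have hC : Measurable fun q : (Law d × Code k₁ k₂) × ℝ => M.codeControl q.1.2 q.2 :=
    hM.measurable_codeControl.comp (f := fun q : (Law d × Code k₁ k₂) × ℝ => (q.1.2, q.2))
      (by fun_prop)
  simp only [validCode_iff hM hst, Set.ofPred_and]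
  refine MeasurableSet.inter ?_ (MeasurableSet.inter ?_ (MeasurableSet.inter ?_
    (MeasurableSet.inter ?_ ?_)))
  · have : Measurable fun p : Law d × Code k₁ k₂ => codePair p.2 := by unfold codePair; fun_prop
    exact this hM.meas_U
  · have h1 : MeasurableSet {q : (Law d × Code k₁ k₂) × ℝ |
        M.codeLaw s q.1 q.2 = evalLaw d (q.1.2.2.1, q.2)} := measurableSet_eq_fun hL hE
    have h2 := measurable_measure_prodMk_left (ν := volume.restrict (Set.Icc s t)) h1.compl
    exact h2 (measurableSet_singleton 0)
  · simp only [Set.ofPred_forall]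
    refine MeasurableSet.iInter fun N => ?_
    let κ : Kernel ((Law d × Code k₁ k₂) × ℝ) (Vec d) := (lawKernel d).comap _ hL
    have : IsMarkovKernel κ := by unfold κ; infer_instance
    have h1 : Measurable fun w : ((Law d × Code k₁ k₂) × ℝ) × Vec d =>
        (Metric.closedBall (0 : Vec d) N).indicator
          (fun z => ENNReal.ofReal (M.genBound (M.codeControl w.1.1.2 w.1.2) z)) w.2 := by
      have h3 : Measurable fun w : ((Law d × Code k₁ k₂) × ℝ) × Vec d =>
          ENNReal.ofReal (M.genBound (M.codeControl w.1.1.2 w.1.2) w.2) :=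
        (hM.measurable_genBound.comp
          ((hC.comp measurable_fst).prodMk measurable_snd)).ennreal_ofReal
      exact h3.indicator (s := Prod.snd ⁻¹' (Metric.closedBall (0 : Vec d) N))
        (measurable_snd Metric.isClosed_closedBall.measurableSet)
    have h2 := (h1.lintegral_kernel_prod_right' (κ := κ)).lintegral_prod_right'
      (ν := volume.restrict (Set.Icc s t))
    have h4 : Measurable fun p : Law d × Code k₁ k₂ => ∫⁻ r in Set.Icc s t,
        ∫⁻ z in Metric.closedBall 0 N, ENNReal.ofReal (M.genBound (M.codeControl p.2 r) z)
          ∂(M.codeLaw s p r : Measure (Vec d)) := by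
      simp only [← lintegral_indicator Metric.isClosed_closedBall.measurableSet]
      exact h2
    exact h4 measurableSet_Iio
  · simp only [Set.ofPred_forall]
    refine MeasurableSet.iInter fun q => MeasurableSet.iInter fun hq => ?_
    have h1 : Measurable fun p : Law d × Code k₁ k₂ => (p, (q : ℝ)) :=
      measurable_id.prodMk measurable_const
    exact measurableSet_eq_fun (measurable_testVec.comp (hL.comp h1))
      ((hM.measurable_codeVec s).comp h1)
  · unfold RatTight
    simp only [Set.ofPred_forall, Set.ofPred_exists]
    refine MeasurableSet.iInter fun k => MeasurableSet.iUnion fun N => MeasurableSet.iInter fun q =>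
      MeasurableSet.iInter fun hq => ?_
    have h1 : Measurable fun p : Law d × Code k₁ k₂ => (p, (q : ℝ)) :=
      measurable_id.prodMk measurable_const
    exact measurableSet_le ((Measure.measurable_coe Metric.isClosed_closedBall.measurableSet.compl
      ).comp (measurable_coe_law.comp (hL.comp h1))) measurable_const

end Model

end ObsControl

/-! ### The update kernel and the independence of the next noise. -/

namespace ObsControl

namespace Model

variable {d m k₁ k₂ n : ℕ} {𝒴 G Ω : Type*}
  [MeasurableSpace 𝒴] [MeasurableSpace G] [MeasurableSpace Ω]
  {M : Model d m k₁ k₂ n 𝒴 G Ω}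

theorem Standing.measurable_update (hM : M.Standing) :
    Measurable fun p : Vec k₂ × Law d × 𝒴 => M.update p.1 p.2.1 p.2.2 := by
  let κ : Kernel (Vec k₂ × Law d × 𝒴) (Vec d) :=
    (lawKernel d).comap (fun p => p.2.1) (by fun_prop)
  have : IsMarkovKernel κ := by unfold κ; infer_instance
  let f : Vec k₂ × Law d × 𝒴 → Vec d → ℝ≥0∞ := fun p x => M.K p.1 x p.2.1 p.2.2
  have hf : Measurable (Function.uncurry f) :=
    hM.meas_K.comp (f := fun q : (Vec k₂ × Law d × 𝒴) × Vec d => (q.1.1, q.2, q.1.2.1, q.1.2.2))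
      (by fun_prop)
  have hD : Measurable fun p => (Kernel.withDensity κ f p : Measure (Vec d)) :=
    (Kernel.withDensity κ f).measurable
  simp only [Kernel.withDensity_apply κ hf] at hD
  have hD' : Measurable fun p : Vec k₂ × Law d × 𝒴 =>
      (p.2.1 : Measure (Vec d)).withDensity fun x => M.K p.1 x p.2.1 p.2.2 := hD
  have hs : MeasurableSet {p : Vec k₂ × Law d × 𝒴 | IsProbabilityMeasure
      ((p.2.1 : Measure (Vec d)).withDensity fun x => M.K p.1 x p.2.1 p.2.2)} := by
    simp only [isProbabilityMeasure_iff]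
    exact ((Measure.measurable_coe MeasurableSet.univ).comp hD') (measurableSet_singleton 1)
  refine measurable_probabilityMeasure ?_
  classical
  have h1 : (fun p : Vec k₂ × Law d × 𝒴 => (M.update p.1 p.2.1 p.2.2 : Measure (Vec d)))
      = fun p => if p ∈ {p : Vec k₂ × Law d × 𝒴 | IsProbabilityMeasure
      ((p.2.1 : Measure (Vec d)).withDensity fun x => M.K p.1 x p.2.1 p.2.2)} then
        (p.2.1 : Measure (Vec d)).withDensity fun x => M.K p.1 x p.2.1 p.2.2
      else (p.2.1 : Measure (Vec d)) := by
    funext p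
    split_ifs with h
    · exact M.coe_update _ _ _ h
    · exact congrArg (fun ρ : Law d => (ρ : Measure (Vec d))) (dif_neg h)
  rw [h1]
  exact Measurable.ite hs hD' (measurable_coe_law.comp (by fun_prop))

variable (M)

/-- The law after the observation `o`, if there is one, for a control value and a law before it. -/
def post (o : Option (Fin n)) (q : Vec k₂ × Law d) (ω : Ω) : Law d :=
  match o with
  | none => q.2
  | some j => M.update q.1 q.2 (M.obs (M.τ j) q.2 q.1 (M.Γ j ω))

/-- The cost of the observation `o`, if there is one. -/
def obsCost (o : Option (Fin n)) (q : Vec k₂ × Law d) : EReal :=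
  match o with
  | none => 0
  | some j => M.h (M.τ j) q.2 q.1

variable {M}

theorem Standing.measurable_post (hM : M.Standing) (o : Option (Fin n)) :
    Measurable fun p : (Vec k₂ × Law d) × Ω => M.post o p.1 p.2 := by
  cases o with
  | none => exact measurable_snd.comp measurable_fst
  | some j =>
    have h1 : Measurable fun p : (Vec k₂ × Law d) × Ω =>
        M.obs (M.τ j) p.1.2 p.1.1 (M.Γ j p.2) :=
      (hM.meas_obs j).comp (f := fun p : (Vec k₂ × Law d) × Ω => (p.1.2, p.1.1, M.Γ j p.2))
        ((measurable_snd.comp measurable_fst).prodMk ((measurable_fst.comp measurable_fst).prodMk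
          ((hM.meas_Γ j).comp measurable_snd)))
    exact hM.measurable_update.comp (f := fun p : (Vec k₂ × Law d) × Ω => (p.1.1, p.1.2, _))
      ((measurable_fst.comp measurable_fst).prodMk ((measurable_snd.comp measurable_fst).prodMk h1))

theorem Standing.measurable_post_right (hM : M.Standing) (o : Option (Fin n)) (q : Vec k₂ × Law d) :
    Measurable (M.post o q) := (hM.measurable_post o).comp measurable_prodMk_left

theorem Standing.measurable_obsCost (hM : M.Standing) (o : Option (Fin n)) :
    Measurable (M.obsCost o) := by
  cases o with
  | none => exact measurable_const
  | some j => exact (hM.meas_h j).comp measurable_swap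

/-- The law of the state after the observation `o`, if there is one. -/
def postKernel (hM : M.Standing) (o : Option (Fin n)) : Kernel (Vec k₂ × Law d) (Law d) where
  toFun q := M.P.map (M.post o q)
  measurable' := by
    have := hM.prob
    refine Measure.measurable_of_measurable_coe _ fun A hA => ?_
    have h1 : ∀ q, M.P.map (M.post o q) A
        = M.P (Prod.mk q ⁻¹' {p : (Vec k₂ × Law d) × Ω | M.post o p.1 p.2 ∈ A}) := fun q => by
      rw [Measure.map_apply (hM.measurable_post_right o q) hA]
      rfl
    simp only [h1]
    exact measurable_measure_prodMk_left (hM.measurable_post o hA)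

theorem postKernel_apply (hM : M.Standing) (o : Option (Fin n)) (q : Vec k₂ × Law d) :
    postKernel hM o q = M.P.map (M.post o q) := rfl

instance (hM : M.Standing) (o : Option (Fin n)) : IsMarkovKernel (postKernel hM o) := by
  have := hM.prob
  exact ⟨fun q => Measure.isProbabilityMeasure_map
    ((hM.measurable_post o).comp measurable_prodMk_left).aemeasurable⟩

/-- The σ-algebra of the noise variables up to the observation `j`. -/
@[reducible] def noiseBefore (M : Model d m k₁ k₂ n 𝒴 G Ω) (j : Fin n) : MeasurableSpace Ω :=
  ⨆ i ∈ {i : Fin n | i < j}, MeasurableSpace.comap (M.Γ i) inferInstance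

/-- The σ-algebra of the noise variables up to and including the observation `j`. -/
@[reducible] def noiseUpTo (M : Model d m k₁ k₂ n 𝒴 G Ω) (j : Fin n) : MeasurableSpace Ω :=
  ⨆ i ∈ {i : Fin n | i ≤ j}, MeasurableSpace.comap (M.Γ i) inferInstance

theorem Standing.noiseBefore_le (hM : M.Standing) (j : Fin n) :
    M.noiseBefore j ≤ (inferInstance : MeasurableSpace Ω) :=
  iSup₂_le fun i _ => (hM.meas_Γ i).comap_le

theorem Standing.indep_noise (hM : M.Standing) (j : Fin n) {E : Type*} [MeasurableSpace E]
    {ξ : Ω → E} (hξ : Measurable[M.noiseBefore j] ξ) : IndepFun ξ (M.Γ j) M.P := by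
  have h1 : Indep (⨆ i ∈ {i : Fin n | i < j}, MeasurableSpace.comap (M.Γ i) inferInstance)
      (⨆ i ∈ ({j} : Set (Fin n)), MeasurableSpace.comap (M.Γ i) inferInstance) M.P := by
    refine indep_iSup_of_disjoint (fun i => (hM.meas_Γ i).comap_le) ?_ ?_
    · exact hM.indep
    · rw [Set.disjoint_singleton_right]
      exact lt_irrefl j
  rw [IndepFun_iff_Indep]
  refine indep_of_indep_of_le_left (indep_of_indep_of_le_right h1 ?_) hξ.comap_le
  exact le_iSup₂_of_le j (Set.mem_singleton j) le_rfl

/-- The precision and the law before the observation are functions of earlier noises, so their joint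
law with `Γ j` is a product; Fubini then exhibits `postKernel` as the conditional law after the
observation. -/
theorem Standing.map_post (hM : M.Standing) (o : Option (Fin n)) {ξ : Ω → Vec k₂ × Law d}
    (hξ : Measurable ξ) (h : ∀ j, o = some j → Measurable[M.noiseBefore j] ξ) :
    M.P.map (fun ω => M.post o (ξ ω) ω) = (M.P.map ξ).bind (postKernel hM o) := by
  have := hM.prob
  ext A hA
  have hp : Measurable fun ω => M.post o (ξ ω) ω :=
    (hM.measurable_post o).comp (hξ.prodMk measurable_id)
  rw [Measure.map_apply hp hA, Measure.bind_apply hA (postKernel hM o).aemeasurable,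
    lintegral_map (f := fun q => postKernel hM o q A)
      ((Measure.measurable_coe hA).comp (postKernel hM o).measurable) hξ]
  cases o with
  | none =>
    have h1 : ∀ ω, postKernel hM none (ξ ω) A
        = ((fun ω => (ξ ω).2) ⁻¹' A).indicator (fun _ => 1) ω := fun ω => by
      rw [postKernel_apply]
      have : M.post none (ξ ω) = fun _ => (ξ ω).2 := rfl
      rw [this, Measure.map_const, measure_univ, one_smul, Measure.dirac_apply' _ hA]
      rfl
    simp only [h1]
    have h2 : MeasurableSet ((fun ω => (ξ ω).2) ⁻¹' A) := (measurable_snd.comp hξ) hA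
    rw [lintegral_indicator_const h2, one_mul]
    rfl
  | some j =>
    have hi := hM.indep_noise j (h j rfl)
    rw [indepFun_iff_map_prod_eq_prod_map_map hξ.aemeasurable (hM.meas_Γ j).aemeasurable] at hi
    let p : (Vec k₂ × Law d) × G → Law d :=
      fun w => M.update w.1.1 w.1.2 (M.obs (M.τ j) w.1.2 w.1.1 w.2)
    have hpm : Measurable p := by
      have h1 : Measurable fun w : (Vec k₂ × Law d) × G => M.obs (M.τ j) w.1.2 w.1.1 w.2 :=
        (hM.meas_obs j).comp (f := fun w : (Vec k₂ × Law d) × G => (w.1.2, w.1.1, w.2))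
          (by fun_prop)
      exact hM.measurable_update.comp (f := fun w : (Vec k₂ × Law d) × G => (w.1.1, w.1.2, _))
        ((measurable_fst.comp measurable_fst).prodMk
          ((measurable_snd.comp measurable_fst).prodMk h1))
    have h2 : M.P ((fun ω => M.post (some j) (ξ ω) ω) ⁻¹' A)
        = M.P.map (fun ω => (ξ ω, M.Γ j ω)) (p ⁻¹' A) := by
      rw [Measure.map_apply (hξ.prodMk (hM.meas_Γ j)) (hpm hA)]
      rfl
    rw [h2, hi, Measure.prod_apply (hpm hA), lintegral_map (measurable_measure_prodMk_left (hpm hA)) hξ]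
    refine lintegral_congr fun ω => ?_
    rw [Measure.map_apply (hM.meas_Γ j) (measurable_prodMk_left (hpm hA)), postKernel_apply,
      Measure.map_apply (hM.measurable_post_right _ _) hA]
    rfl

section Sigma

variable {ph : Phase} {s t : ℝ} {μ : Law d} {u : Controlled d k₁ k₂ n Ω}

theorem mem_window {j : Fin n} : j ∈ M.window ph s t ↔
    (s < M.τ j ∨ (ph = Phase.before ∧ M.τ j = s)) ∧ M.τ j ≤ t := by
  simp [window]

theorem window_le {j : Fin n} (hj : j ∈ M.window ph s t) : s ≤ M.τ j ∧ M.τ j ≤ t := by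
  rw [mem_window] at hj
  exact ⟨hj.1.elim le_of_lt fun h => h.2.ge, hj.2⟩

/-- Strong induction untangles the circular definition of the filtration: each observation is a
function of its own noise and of quantities measurable with respect to strictly earlier
observations. -/
theorem Admissible.comap_Y_le (hM : M.Standing) (hu : M.Admissible ph s t μ u) (j : Fin n)
    (hj : j ∈ M.window ph s t) :
    MeasurableSpace.comap (M.Y u j) inferInstance
      ≤ M.noiseUpTo j := by
  induction j using WellFoundedLT.induction with
  | _ j ih =>
    have h1 : M.sigmaBefore ph s t u (M.τ j) ≤ M.noiseUpTo j := by
      refine iSup₂_le fun i hi => iSup_le fun hij => ?_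
      have hij' : i < j := hM.τ_mono.lt_iff_lt.1 hij
      refine (ih i hij' hi).trans (iSup₂_le fun l hl => ?_)
      exact le_iSup₂_of_le (f := fun i (_ : i ∈ {i : Fin n | i ≤ j}) =>
        MeasurableSpace.comap (M.Γ i) inferInstance) l (le_trans hl hij'.le) le_rfl
    have h2 : Measurable[M.noiseUpTo j] (u.Xm j) := (hu.Xm_adapted j hj).mono h1 le_rfl
    have h3 : Measurable[M.noiseUpTo j] (u.β (M.τ j)) :=
      (hu.β_predictable _ (window_le hj)).mono h1 le_rfl
    have h4 : Measurable[M.noiseUpTo j] (M.Γ j) := measurable_iff_comap_le.2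
      (le_iSup₂_of_le (f := fun i (_ : i ∈ {i : Fin n | i ≤ j}) =>
        MeasurableSpace.comap (M.Γ i) inferInstance) j (le_refl j) le_rfl)
    exact measurable_iff_comap_le.1 ((hM.meas_obs j).comp (h2.prodMk (h3.prodMk h4)))

theorem Admissible.sigmaBefore_le_noise (hM : M.Standing) (hu : M.Admissible ph s t μ u)
    (j : Fin n) : M.sigmaBefore ph s t u (M.τ j) ≤ M.noiseBefore j := by
  refine iSup₂_le fun i hi => iSup_le fun hij => ?_
  refine (hu.comap_Y_le hM i hi).trans (iSup₂_le fun l hl => ?_)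
  exact le_iSup₂_of_le (f := fun i (_ : i ∈ {i : Fin n | i < j}) =>
    MeasurableSpace.comap (M.Γ i) inferInstance) l
    (lt_of_le_of_lt hl (hM.τ_mono.lt_iff_lt.1 hij)) le_rfl

theorem Admissible.sigmaAt_le (hM : M.Standing) (hu : M.Admissible ph s t μ u) (r : ℝ) :
    M.sigmaAt ph s t u r ≤ (inferInstance : MeasurableSpace Ω) :=
  iSup₂_le fun i hi => iSup_le fun _ =>
    (hu.comap_Y_le hM i hi).trans (iSup₂_le fun l _ => (hM.meas_Γ l).comap_le)

theorem sigmaBefore_le_sigmaAt (r : ℝ) : M.sigmaBefore ph s t u r ≤ M.sigmaAt ph s t u r :=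
  iSup₂_mono fun _ _ => iSup_mono' fun h => ⟨h.le, le_rfl⟩

theorem measurable_Y_sigmaAt {j : Fin n} (hj : j ∈ M.window ph s t) {r : ℝ} (hr : M.τ j ≤ r) :
    Measurable[M.sigmaAt ph s t u r] (M.Y u j) :=
  measurable_iff_comap_le.2 (le_iSup₂_of_le (f := fun j (_ : j ∈ M.window ph s t) =>
    ⨆ _ : M.τ j ≤ r, MeasurableSpace.comap (M.Y u j) inferInstance) j hj (le_iSup_of_le hr le_rfl))

end Sigma

end Model

end ObsControl

/-! ### Progressive processes and the continuation of a control. -/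

namespace ObsControl

section Progressive

variable {Ω E : Type*} [MeasurableSpace E]

theorem ProgMeas.measurable_min {F : ℝ → MeasurableSpace Ω} {s t r : ℝ} {f : ℝ → Ω → E}
    (h : ProgMeas F s t f) (hst : s ≤ t) (hsr : s ≤ r) {F' : MeasurableSpace Ω}
    (hF : F (min r t) ≤ F') :
    Measurable[(inferInstance : MeasurableSpace (Set.Icc s r)).prod F']
      (fun p : Set.Icc s r × Ω => f (min p.1 t) p.2) := by
  have h1 := h (min r t) ⟨le_min hsr hst, min_le_right _ _⟩
  let e : Set.Icc s r → Set.Icc s (min r t) := fun p =>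
    ⟨min p t, le_min p.2.1 hst, min_le_min_right _ p.2.2⟩
  have he : Measurable e :=
    ((measurable_subtype_coe.min measurable_const).subtype_mk)
  have h2 : @Measurable _ _ ((inferInstance : MeasurableSpace (Set.Icc s r)).prod F')
      ((inferInstance : MeasurableSpace (Set.Icc s (min r t))).prod (F (min r t)))
      (fun p : Set.Icc s r × Ω => (e p.1, p.2)) := by
    have h3 := he.comp (@measurable_fst (Set.Icc s r) Ω _ F')
    have h4 : @Measurable _ _ ((inferInstance : MeasurableSpace (Set.Icc s r)).prod F')
        (F (min r t)) (fun p : Set.Icc s r × Ω => p.2) :=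
      (@measurable_snd (Set.Icc s r) Ω _ F').mono le_rfl hF
    exact h3.prodMk h4
  exact h1.comp h2

theorem ProgMeas.at_time {F : ℝ → MeasurableSpace Ω} {s t r : ℝ} {f : ℝ → Ω → E}
    (h : ProgMeas F s t f) (hr : r ∈ Set.Icc s t) : Measurable[F r] (f r) := by
  have h1 := h r hr
  have h2 : @Measurable _ _ (F r) ((inferInstance : MeasurableSpace (Set.Icc s r)).prod (F r))
      (fun ω : Ω => ((⟨r, hr.1, le_rfl⟩ : Set.Icc s r), ω)) := by
    have h3 : @Measurable _ _ (F r) _ (fun _ : Ω => (⟨r, hr.1, le_rfl⟩ : Set.Icc s r)) :=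
      @measurable_const _ _ _ (F r) _
    have h4 : @Measurable _ _ (F r) (F r) (fun ω : Ω => ω) := @measurable_id _ (F r)
    exact h3.prodMk h4
  exact h1.comp h2

/-- A progressive process, stopped at the end of the time interval and extended, is jointly
measurable. -/
theorem ProgMeas.measurable_projIcc [mΩ : MeasurableSpace Ω] {F : ℝ → MeasurableSpace Ω} {s t : ℝ}
    {f : ℝ → Ω → E} (h : ProgMeas F s t f) (hst : s ≤ t) (hF : F t ≤ mΩ) :
    Measurable fun p : ℝ × Ω => f (Set.projIcc s t hst p.1) p.2 := by
  have h1 := (h t ⟨hst, le_rfl⟩).mono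
    (sup_le_sup le_rfl (MeasurableSpace.comap_mono hF)) le_rfl
  have h2 : Measurable fun p : ℝ × Ω => (Set.projIcc s t hst p.1, p.2) :=
    (continuous_projIcc.measurable.comp measurable_fst).prodMk measurable_snd
  exact Measurable.comp h1 h2

/-- The set S lies between the open and the closed half line ending at t, leaving free which process
provides the value at t: states keep the old one, whereas α does so only if an observation of the
window occurs at t. -/
theorem ProgMeas.glue {F F' : ℝ → MeasurableSpace Ω} {s t t' : ℝ} (hst : s ≤ t)
    {f g : ℝ → Ω → E} {S : Set ℝ} [∀ r, Decidable (r ∈ S)] (hS : MeasurableSet S) (hS₁ : ∀ r < t, r ∈ S)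
    (hS₂ : ∀ r ∈ S, r ≤ t) (hf : ProgMeas F s t f) (hF : ∀ r r', r ≤ r' → F r ≤ F' r')
    (hg : ∀ r ∈ Set.Icc t t', Measurable[(inferInstance : MeasurableSpace (Set.Icc s r)).prod (F' r)]
      (fun p : Set.Icc s r × Ω => g p.1 p.2)) :
    ProgMeas F' s t' (fun r ω => if r ∈ S then f r ω else g r ω) := by
  intro r hr
  rcases lt_or_ge r t with hrt | hrt
  · have h1 : (fun p : Set.Icc s r × Ω => if (p.1 : ℝ) ∈ S then f p.1 p.2 else g p.1 p.2)
        = fun p => f p.1 p.2 := by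
      funext p
      rw [if_pos (hS₁ _ (p.1.2.2.trans_lt hrt))]
    rw [h1]
    exact (hf r ⟨hr.1, hrt.le⟩).mono
      (sup_le_sup le_rfl (MeasurableSpace.comap_mono (hF r r le_rfl))) le_rfl
  · have h1 : (fun p : Set.Icc s r × Ω => if (p.1 : ℝ) ∈ S then f p.1 p.2 else g p.1 p.2)
        = fun p => if (p.1 : ℝ) ∈ S then f (min p.1 t) p.2 else g p.1 p.2 := by
      funext p
      split_ifs with hp
      · rw [min_eq_left (hS₂ _ hp)]
      · rfl
    rw [h1]
    have hm : MeasurableSet[(inferInstance : MeasurableSpace (Set.Icc s r)).prod (F' r)]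
        {p : Set.Icc s r × Ω | (p.1 : ℝ) ∈ S} :=
      (measurable_subtype_coe.comp (@measurable_fst _ _ _ (F' r))) hS
    refine Measurable.ite hm ?_ (hg r ⟨hrt, hr.2⟩)
    exact hf.measurable_min hst hr.1 (by rw [min_eq_right hrt]; exact hF t r hrt)

end Progressive

namespace Model

variable {d m k₁ k₂ n : ℕ} {𝒴 G Ω : Type*}
  [MeasurableSpace 𝒴] [MeasurableSpace G] [MeasurableSpace Ω]
  (M : Model d m k₁ k₂ n 𝒴 G Ω)

/-- Consecutive decision times: there is no observation time in `(t, t')`, and `o` is the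
observation at time `t'`, if any. -/
structure Step (t t' : ℝ) (o : Option (Fin n)) : Prop where
  nonneg : 0 ≤ t
  lt : t < t'
  le_T : t' ≤ M.T
  gap : ∀ j, t < M.τ j → t' ≤ M.τ j
  obs : ∀ j, M.τ j = t' ↔ o = some j

/-- Controls on `[s, t]` may be continued after `t` independently of their precisions at `t`. -/
def Splittable (ph : Phase) (s t : ℝ) : Prop :=
  (∃ A B, M.U = A ×ˢ B) ∨ (∃ j ∈ M.window ph s t, M.τ j = t) ∨ s = t

/-- The times `r` before the last observation in `[s, t]`. -/
def beforeObs (ph : Phase) (s t : ℝ) : Set ℝ := {r | ∃ j ∈ M.window ph s t, r ≤ M.τ j}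

open Classical in
/-- The continuation on `[t, t']` of a control on `[s, t]`, through coded control and state
paths. -/
def extend (ph : Phase) (s t t' : ℝ) (o : Option (Fin n)) (u : Controlled d k₁ k₂ n Ω)
    (ψ : Law d → Code k₁ k₂) : Controlled d k₁ k₂ n Ω where
  α r ω := if r ∈ Set.Iio t ∪ M.beforeObs ph s t then u.α r ω
    else M.codeControl (ψ (u.X t ω)) r
  β r ω := if r ∈ M.beforeObs ph s t then u.β r ω else (ψ (u.X t ω)).2.2.2
  X r ω := if r ∈ Set.Iic t then u.X r ω else
    if r < t' then M.codeLaw t (u.X t ω, ψ (u.X t ω)) r else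
      M.post o ((ψ (u.X t ω)).2.2.2, M.codeLaw t (u.X t ω, ψ (u.X t ω)) t') ω
  Xm i ω := if M.τ i ≤ t then u.Xm i ω else M.codeLaw t (u.X t ω, ψ (u.X t ω)) t'

variable {M}
variable {ph : Phase} {s t t' : ℝ} {μ : Law d} {u : Controlled d k₁ k₂ n Ω} {o : Option (Fin n)}
  {ψ : Law d → Code k₁ k₂}

theorem Step.mem_window (h : M.Step t t' o) (hst : s ≤ t) {j : Fin n} :
    j ∈ M.window ph s t' ↔ j ∈ M.window ph s t ∨ o = some j := by
  rw [Model.mem_window, Model.mem_window, ← h.obs j]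
  constructor
  · rintro ⟨h1, h2⟩
    rcases le_or_gt (M.τ j) t with h3 | h3
    · exact Or.inl ⟨h1, h3⟩
    · exact Or.inr (le_antisymm h2 (h.gap j h3))
  · rintro (⟨h1, h2⟩ | h1)
    · exact ⟨h1, h2.trans h.lt.le⟩
    · exact ⟨Or.inl (by rw [h1]; exact hst.trans_lt h.lt), h1.le⟩

theorem measurableSet_beforeObs : MeasurableSet (M.beforeObs ph s t) := by
  have : M.beforeObs ph s t = ⋃ j ∈ M.window ph s t, Set.Iic (M.τ j) := by
    ext r; simp [beforeObs]
  rw [this]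
  exact Finset.measurableSet_biUnion _ fun j _ => measurableSet_Iic

theorem beforeObs_le {r : ℝ} (hr : r ∈ M.beforeObs ph s t) : r ≤ t := by
  obtain ⟨j, hj, h⟩ := hr
  exact h.trans (window_le hj).2

theorem mem_beforeObs {j : Fin n} (hj : j ∈ M.window ph s t) : M.τ j ∈ M.beforeObs ph s t :=
  ⟨j, hj, le_rfl⟩

theorem window_subset (htt' : t ≤ t') : M.window ph s t ⊆ M.window ph s t' := fun j hj => by
  rw [Model.mem_window] at hj ⊢
  exact ⟨hj.1, hj.2.trans htt'⟩

/-- The continuation alters precisions only after the last observation of the window, so the old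
observations, and the information they generate, are unchanged. -/
theorem Y_extend {j : Fin n} (hj : j ∈ M.window ph s t) :
    M.Y (M.extend ph s t t' o u ψ) j = M.Y u j := by
  funext ω
  simp only [Y, extend, if_pos (window_le hj).2, if_pos (mem_beforeObs hj)]

theorem sigmaAt_extend (htt' : t ≤ t') {r r' : ℝ} (hr : r ≤ r') :
    M.sigmaAt ph s t u r ≤ M.sigmaAt ph s t' (M.extend ph s t t' o u ψ) r' := by
  refine iSup₂_le fun j hj => iSup_le fun h => ?_
  rw [← Y_extend (t' := t') (o := o) (ψ := ψ) hj]
  exact measurable_iff_comap_le.1 (measurable_Y_sigmaAt (window_subset htt' hj) (h.trans hr))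

theorem measurable_Y_sigmaBefore {j : Fin n} (hj : j ∈ M.window ph s t) {r : ℝ} (hr : M.τ j < r) :
    Measurable[M.sigmaBefore ph s t u r] (M.Y u j) :=
  measurable_iff_comap_le.2 (le_iSup₂_of_le (f := fun j (_ : j ∈ M.window ph s t) =>
    ⨆ _ : M.τ j < r, MeasurableSpace.comap (M.Y u j) inferInstance) j hj (le_iSup_of_le hr le_rfl))

theorem sigmaBefore_extend (htt' : t ≤ t') (r : ℝ) :
    M.sigmaBefore ph s t u r ≤ M.sigmaBefore ph s t' (M.extend ph s t t' o u ψ) r := by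
  refine iSup₂_le fun j hj => iSup_le fun h => ?_
  rw [← Y_extend (t' := t') (o := o) (ψ := ψ) hj]
  exact measurable_iff_comap_le.1 (measurable_Y_sigmaBefore (window_subset htt' hj) h)

/-- After the last observation nothing is learned until t, so what is known at t is already known
just before r. A precision depending on the law at t may therefore be used from the last observation
onwards without anticipation. -/
theorem sigmaAt_le_sigmaBefore_extend (htt' : t ≤ t') {r : ℝ} (hr : r ∉ M.beforeObs ph s t) :
    M.sigmaAt ph s t u t ≤ M.sigmaBefore ph s t' (M.extend ph s t t' o u ψ) r := by
  refine iSup₂_le fun j hj => iSup_le fun h => ?_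
  rw [← Y_extend (t' := t') (o := o) (ψ := ψ) hj]
  refine measurable_iff_comap_le.1 (measurable_Y_sigmaBefore (window_subset htt' hj) ?_)
  by_contra hle
  exact hr ⟨j, hj, not_lt.1 hle⟩

theorem extend_X_le {r : ℝ} (hr : r ≤ t) (ω : Ω) :
    (M.extend ph s t t' o u ψ).X r ω = u.X r ω := if_pos (Set.mem_Iic.2 hr)

theorem extend_X_mid {r : ℝ} (hr : t < r) (hr' : r < t') (ω : Ω) :
    (M.extend ph s t t' o u ψ).X r ω = M.codeLaw t (u.X t ω, ψ (u.X t ω)) r := by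
  simp only [extend, Set.mem_Iic, if_neg (not_le.2 hr), if_pos hr']

theorem extend_X_end (h : t < t') (ω : Ω) : (M.extend ph s t t' o u ψ).X t' ω
    = M.post o ((ψ (u.X t ω)).2.2.2, M.codeLaw t (u.X t ω, ψ (u.X t ω)) t') ω := by
  simp only [extend, Set.mem_Iic, if_neg (not_le.2 h), if_neg (lt_irrefl t')]

theorem extend_α_lt {r : ℝ} (hr : r < t) (ω : Ω) :
    (M.extend ph s t t' o u ψ).α r ω = u.α r ω := if_pos (Or.inl hr)

theorem extend_α_gt {r : ℝ} (hr : t < r) (ω : Ω) :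
    (M.extend ph s t t' o u ψ).α r ω = M.codeControl (ψ (u.X t ω)) r :=
  if_neg fun h => h.elim (fun h => (hr.trans h).false) fun h => (hr.trans_le (beforeObs_le h)).false

theorem extend_β_old {r : ℝ} (hr : r ∈ M.beforeObs ph s t) (ω : Ω) :
    (M.extend ph s t t' o u ψ).β r ω = u.β r ω := if_pos hr

theorem extend_β_new {r : ℝ} (hr : r ∉ M.beforeObs ph s t) (ω : Ω) :
    (M.extend ph s t t' o u ψ).β r ω = (ψ (u.X t ω)).2.2.2 := if_neg hr

theorem extend_Xm_le {j : Fin n} (hj : M.τ j ≤ t) (ω : Ω) :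
    (M.extend ph s t t' o u ψ).Xm j ω = u.Xm j ω := if_pos hj

theorem extend_Xm_gt {j : Fin n} (hj : t < M.τ j) (ω : Ω) :
    (M.extend ph s t t' o u ψ).Xm j ω = M.codeLaw t (u.X t ω, ψ (u.X t ω)) t' :=
  if_neg (not_le.2 hj)

theorem Admissible.measurable_X (hM : M.Standing) (hu : M.Admissible ph s t μ u) {r : ℝ}
    (hr : r ∈ Set.Icc s t) : Measurable (u.X r) :=
  (hu.X_adapted.at_time hr).mono (hu.sigmaAt_le hM r) le_rfl

theorem Step.extend_progressive (hM : M.Standing) (h : M.Step t t' o) (hst : s ≤ t)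
    (hu : M.Admissible ph s t μ u) (hψ : Measurable ψ) :
    ProgMeas (M.sigmaAt ph s t' (M.extend ph s t t' o u ψ)) s t' (M.extend ph s t t' o u ψ).α ∧
    ProgMeas (M.sigmaAt ph s t' (M.extend ph s t t' o u ψ)) s t' (M.extend ph s t t' o u ψ).X := by
  set u' := M.extend ph s t t' o u ψ with hu'
  have hX : Measurable[M.sigmaAt ph s t u t] (u.X t) := hu.X_adapted.at_time ⟨hst, le_rfl⟩
  have hX' : ∀ r, t ≤ r → Measurable[M.sigmaAt ph s t' u' r] (u.X t) := fun r hr =>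
    hX.mono (sigmaAt_extend h.lt.le hr) le_rfl
  have hp : ∀ r, t ≤ r → Measurable[M.sigmaAt ph s t' u' r] fun ω => (u.X t ω, ψ (u.X t ω)) :=
    fun r hr => (hX' r hr).prodMk (hψ.comp (hX' r hr))
  have hp2 : ∀ r, t ≤ r →
      Measurable[(inferInstance : MeasurableSpace (Set.Icc s r)).prod (M.sigmaAt ph s t' u' r)]
        fun p : Set.Icc s r × Ω => ((u.X t p.2, ψ (u.X t p.2)), (p.1 : ℝ)) := fun r hr =>
    ((hp r hr).comp (@measurable_snd _ _ _ (M.sigmaAt ph s t' u' r))).prodMk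
      (measurable_subtype_coe.comp (@measurable_fst _ _ _ (M.sigmaAt ph s t' u' r)))
  have hmono : ∀ r r', r ≤ r' → M.sigmaAt ph s t u r ≤ M.sigmaAt ph s t' u' r' :=
    fun r r' hr => sigmaAt_extend h.lt.le hr
  have hlaw : ∀ r, t ≤ r →
      Measurable[(inferInstance : MeasurableSpace (Set.Icc s r)).prod (M.sigmaAt ph s t' u' r)]
        fun p : Set.Icc s r × Ω => M.codeLaw t (u.X t p.2, ψ (u.X t p.2)) p.1 := fun r hr =>
    (hM.measurable_codeLaw t).comp (hp2 r hr)
  classical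
  constructor
  · refine ProgMeas.glue hst (F := M.sigmaAt ph s t u) (S := Set.Iio t ∪ M.beforeObs ph s t)
      (g := fun r ω => M.codeControl (ψ (u.X t ω)) r) (measurableSet_Iio.union measurableSet_beforeObs)
      (fun r hr => Or.inl hr) (fun r hr => by
        rcases hr with h1 | h1
        · exact le_of_lt h1
        · exact beforeObs_le h1)
      hu.α_adapted hmono fun r hr => ?_
    exact hM.measurable_codeControl.comp
      ((measurable_snd.comp measurable_fst).comp (hp2 r hr.1) |>.prodMk (hp2 r hr.1).snd)
  · refine ProgMeas.glue hst (F := M.sigmaAt ph s t u) (S := Set.Iic t)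
      (g := fun r ω => if r < t' then M.codeLaw t (u.X t ω, ψ (u.X t ω)) r else
        M.post o ((ψ (u.X t ω)).2.2.2, M.codeLaw t (u.X t ω, ψ (u.X t ω)) t') ω) measurableSet_Iic
      (fun r hr => le_of_lt hr) (fun r hr => hr) hu.X_adapted hmono fun r hr => ?_
    rcases lt_or_eq_of_le hr.2 with hlt | rfl
    · have h1 : (fun p : Set.Icc s r × Ω => if (p.1 : ℝ) < t' then
            M.codeLaw t (u.X t p.2, ψ (u.X t p.2)) p.1 else
          M.post o ((ψ (u.X t p.2)).2.2.2, M.codeLaw t (u.X t p.2, ψ (u.X t p.2)) t') p.2)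
          = fun p => M.codeLaw t (u.X t p.2, ψ (u.X t p.2)) p.1 := by
        funext p
        rw [if_pos (p.1.2.2.trans_lt hlt)]
      rw [h1]
      exact hlaw r hr.1
    · have hm : MeasurableSet[(inferInstance : MeasurableSpace (Set.Icc s r)).prod
          (M.sigmaAt ph s r u' r)] {p : Set.Icc s r × Ω | (p.1 : ℝ) < r} :=
        (measurable_subtype_coe.comp (@measurable_fst _ _ _ (M.sigmaAt ph s r u' r)))
          measurableSet_Iio
      refine Measurable.ite hm (hlaw r hr.1) ?_
      have hpre : Measurable[M.sigmaAt ph s r u' r] fun ω =>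
          M.codeLaw t (u.X t ω, ψ (u.X t ω)) r :=
        (hM.measurable_codeLaw t).comp (f := fun ω => ((u.X t ω, ψ (u.X t ω)), r))
          ((hp r hr.1).prodMk (@measurable_const _ _ _ (M.sigmaAt ph s r u' r) _))
      suffices hs : Measurable[M.sigmaAt ph s r u' r] fun ω =>
          M.post o ((ψ (u.X t ω)).2.2.2, M.codeLaw t (u.X t ω, ψ (u.X t ω)) r) ω from
        hs.comp (@measurable_snd _ _ _ (M.sigmaAt ph s r u' r))
      cases ho : o with
      | none => exact hpre
      | some j =>
        have hτ : M.τ j = r := (h.obs j).2 ho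
        have hj : j ∈ M.window ph s r := (h.mem_window hst).2 (Or.inr ho)
        have hY := measurable_Y_sigmaAt (u := u') hj hτ.le
        have hold : M.τ j ∉ M.beforeObs ph s t := fun hc =>
          (h.lt.trans_le (hτ ▸ beforeObs_le hc)).false
        -- As written, the final law depends on the noise itself, which is not adapted; it depends
        -- on it only through the observation, which is.
        have hYe : ∀ ω, M.post (some j) ((ψ (u.X t ω)).2.2.2,
            M.codeLaw t (u.X t ω, ψ (u.X t ω)) r) ω
            = M.update (ψ (u.X t ω)).2.2.2 (M.codeLaw t (u.X t ω, ψ (u.X t ω)) r) (M.Y u' j ω) := by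
          intro ω
          simp only [post, Y, hu', extend_β_new hold, extend_Xm_gt (hτ ▸ h.lt)]
        simp only [hYe]
        exact hM.measurable_update.comp (f := fun ω => ((ψ (u.X t ω)).2.2.2,
          M.codeLaw t (u.X t ω, ψ (u.X t ω)) r, M.Y u' j ω))
          ((hp r hr.1).snd.snd.snd.snd.prodMk (hpre.prodMk hY))

end Model

end ObsControl

/-! ### Admissibility of pasted controls. -/

namespace ObsControl

theorem ae_ne_real (S : Set ℝ) (t : ℝ) : ∀ᵐ r ∂(volume.restrict S), r ≠ t :=
  ae_restrict_of_ae (compl_mem_ae_iff.2 (measure_singleton t))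

namespace Model

variable {d m k₁ k₂ n : ℕ} {𝒴 G Ω : Type*}
  [MeasurableSpace 𝒴] [MeasurableSpace G] [MeasurableSpace Ω]
  {M : Model d m k₁ k₂ n 𝒴 G Ω}
  {ph : Phase} {s t t' : ℝ} {μ : Law d} {u : Controlled d k₁ k₂ n Ω} {o : Option (Fin n)}
  {ψ : Law d → Code k₁ k₂}

/-- The pasted paths agree with the pieces except at endpoints, which integrals in time ignore, and
the equations on both sides of t add up. The auxiliary `a₀` and `x₀` are globally measurable
versions of paths controlled only on [s, t]. -/
theorem IsTrajectory.append (hM : M.Standing) (h : M.Step t t' o) (hst : s ≤ t)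
    {a a₀ b a' : ℝ → Vec k₁} {x x₀ z x' : ℝ → Law d} {xm xm' : Fin n → Law d}
    {β β' : Fin n → Vec k₂} {y y' : Fin n → 𝒴}
    (htraj : M.IsTrajectory ph s t μ a x xm β y)
    (ha₀ : Measurable a₀) (ha₀' : ∀ r ∈ Set.Icc s t, a₀ r = a r)
    (hx₀ : Measurable x₀) (hx₀' : ∀ r ∈ Set.Icc s t, x₀ r = x r)
    (hb : Measurable b) (hz : Measurable z) (hseg : M.Segment t t' (x t) b z)
    (hxl : ∀ r ∈ Set.Icc s t, x' r = x r) (hxr : ∀ r ∈ Set.Ioo t t', x' r = z r)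
    (hal : ∀ r ∈ Set.Ico s t, a' r = a r) (har : ∀ r ∈ Set.Ioc t t', a' r = b r)
    (hold : ∀ j ∈ M.window ph s t, xm' j = xm j ∧ β' j = β j ∧ y' j = y j)
    (hnone : o = none → x' t' = z t')
    (hsome : ∀ j, o = some j → xm' j = z t' ∧ x' t' = M.update (β' j) (xm' j) (y' j)) :
    M.IsTrajectory ph s t' μ a' x' xm' β' y' := by
  have hsub : M.window ph s t ⊆ M.window ph s t' := window_subset h.lt.le
  have hsI : s ∈ Set.Icc s t := ⟨le_rfl, hst⟩
  have htI : t ∈ Set.Icc s t := ⟨hst, le_rfl⟩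
  have hτ' : ∀ j, o = some j → M.τ j = t' := fun j => (h.obs j).2
  have hzl : ∀ r ∈ Set.Ico t t', x' r = z r := by
    intro r hr
    rcases eq_or_lt_of_le hr.1 with rfl | hlt
    · rw [hxl _ htI, hseg.start]
    · exact hxr r ⟨hlt, hr.2⟩
  have hInt₀ : ∀ φ : Vec d → ℝ, IsTest φ →
      ∫⁻ r in Set.Icc s t, ∫⁻ w, ‖M.gen (a₀ r) φ w‖ₑ ∂(x₀ r : Measure (Vec d)) < ∞ := by
    intro φ hφ
    rw [setLIntegral_congr_fun measurableSet_Icc (g := fun r =>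
      ∫⁻ w, ‖M.gen (a r) φ w‖ₑ ∂(x r : Measure (Vec d))) fun r hr => ?_]
    · exact htraj.integrable φ hφ.contDiff hφ.compact
    · simp only [ha₀' r hr, hx₀' r hr]
  have hae₁ : ∀ S ⊆ Set.Icc s t, MeasurableSet S → ∀ᵐ r ∂(volume.restrict S),
      a' r = a₀ r ∧ x' r = x₀ r ∧ a₀ r = a r ∧ x₀ r = x r := by
    intro S hS hSm
    filter_upwards [ae_ne_real S t, ae_restrict_mem hSm] with r hr hrS
    have hr' := hS hrS
    rw [hal r ⟨hr'.1, lt_of_le_of_ne hr'.2 hr⟩, hxl r hr', ha₀' r hr', hx₀' r hr']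
    exact ⟨rfl, rfl, rfl, rfl⟩
  have hae₂ : ∀ S ⊆ Set.Icc t t', MeasurableSet S → ∀ᵐ r ∂(volume.restrict S),
      a' r = b r ∧ x' r = z r := by
    intro S hS hSm
    filter_upwards [ae_ne_real S t', ae_ne_real S t, ae_restrict_mem hSm] with r hr hrt hrS
    have hr' := hS hrS
    have h1 : r < t' := lt_of_le_of_ne hr'.2 hr
    exact ⟨har r ⟨lt_of_le_of_ne hr'.1 (Ne.symm hrt), h1.le⟩, hzl r ⟨hr'.1, h1⟩⟩
  have hoc : ∀ {r₁ r₂ c e : ℝ}, c ≤ r₁ → r₁ ≤ r₂ → r₂ ≤ e → Set.uIoc r₁ r₂ ⊆ Set.Icc c e := by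
    intro r₁ r₂ c e h1 h2 h3 r hr
    rw [Set.uIoc_of_le h2] at hr
    exact ⟨h1.trans hr.1.le, hr.2.trans h3⟩
  -- the equation on the left piece
  have hleft : ∀ r₁ r₂, s ≤ r₁ → r₁ ≤ r₂ → r₂ ≤ t →
      (∀ j ∈ M.window ph s t', ¬ (r₁ < M.τ j ∧ M.τ j ≤ r₂)) → ∀ φ : Vec d → ℝ, IsTest φ →
      ∫ w, φ w ∂(x' r₂ : Measure (Vec d)) = ∫ w, φ w ∂(x' r₁ : Measure (Vec d))
        + ∫ r in r₁..r₂, ∫ w, M.gen (a' r) φ w ∂(x' r : Measure (Vec d)) := by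
    intro r₁ r₂ h1 h2 h3 h4 φ hφ
    rw [hxl r₂ ⟨h1.trans h2, h3⟩, hxl r₁ ⟨h1, h2.trans h3⟩,
      htraj.fokker_planck r₁ r₂ h1 h2 h3 (fun j hj => h4 j (hsub hj)) φ hφ.contDiff hφ.compact]
    congr 1
    refine intervalIntegral.integral_congr_ae_restrict ?_
    filter_upwards [hae₁ _ (hoc h1 h2 h3) measurableSet_uIoc] with r hr
    rw [hr.1, hr.2.1, hr.2.2.1, hr.2.2.2]
  -- the equation on the right piece
  have hright : ∀ r₁ r₂, t ≤ r₁ → r₁ ≤ r₂ → r₂ ≤ t' →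
      (∀ j ∈ M.window ph s t', ¬ (r₁ < M.τ j ∧ M.τ j ≤ r₂)) → ∀ φ : Vec d → ℝ, IsTest φ →
      ∫ w, φ w ∂(x' r₂ : Measure (Vec d)) = ∫ w, φ w ∂(x' r₁ : Measure (Vec d))
        + ∫ r in r₁..r₂, ∫ w, M.gen (a' r) φ w ∂(x' r : Measure (Vec d)) := by
    intro r₁ r₂ h1 h2 h3 h4 φ hφ
    rcases eq_or_lt_of_le h2 with rfl | h2'
    · simp
    have hx₂ : x' r₂ = z r₂ := by
      rcases eq_or_lt_of_le h3 with rfl | h3'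
      · cases ho : o with
        | none => exact hnone ho
        | some j =>
          have hj := hτ' j ho
          exact absurd ⟨by rw [hj]; exact h2', hj.le⟩ (h4 j ((h.mem_window hst).2 (Or.inr ho)))
      · exact hzl r₂ ⟨h1.trans h2, h3'⟩
    rw [hx₂, hzl r₁ ⟨h1, h2'.trans_le h3⟩,
      hseg.two_times hM hb hz ⟨h1, h2.trans h3⟩ ⟨h1.trans h2, h3⟩ hφ]
    congr 1
    refine intervalIntegral.integral_congr_ae_restrict ?_
    filter_upwards [hae₂ _ (hoc h1 h2 h3) measurableSet_uIoc] with r hr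
    rw [hr.1, hr.2]
  constructor
  · intro hs
    rw [hxl s hsI]
    exact htraj.start fun j hj => hs j (hsub hj)
  · intro j hj hjs
    rcases (h.mem_window hst).1 hj with hj' | ho
    · rw [(hold j hj').1]
      exact htraj.start_before j hj' hjs
    · exact absurd (hτ' j ho) (by rw [hjs]; exact (hst.trans_lt h.lt).ne)
  · intro φ hφ₁ hφ₂
    have hφ : IsTest φ := ⟨hφ₁, hφ₂⟩
    have hI : Set.Icc s t' ⊆ Set.Icc s t ∪ Set.Icc t t' := by
      intro r hr
      rcases le_total r t with h1 | h1
      · exact Or.inl ⟨hr.1, h1⟩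
      · exact Or.inr ⟨h1, hr.2⟩
    refine (lintegral_mono_set hI).trans_lt ((lintegral_union_le _ _ _).trans_lt
      (ENNReal.add_lt_top.2 ⟨?_, ?_⟩))
    · rw [lintegral_congr_ae (g := fun r =>
        ∫⁻ w, ‖M.gen (a₀ r) φ w‖ₑ ∂(x₀ r : Measure (Vec d)))]
      · exact hInt₀ φ hφ
      · filter_upwards [hae₁ _ subset_rfl measurableSet_Icc] with r hr
        rw [hr.1, hr.2.1]
    · rw [lintegral_congr_ae (g := fun r =>
        ∫⁻ w, ‖M.gen (b r) φ w‖ₑ ∂(z r : Measure (Vec d)))]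
      · exact hseg.integrable φ hφ
      · filter_upwards [hae₂ _ subset_rfl measurableSet_Icc] with r hr
        rw [hr.1, hr.2]
  · intro r₁ r₂ h1 h2 h3 h4 φ hφ₁ hφ₂
    have hφ : IsTest φ := ⟨hφ₁, hφ₂⟩
    rcases le_total r₂ t with h5 | h5
    · exact hleft r₁ r₂ h1 h2 h5 h4 φ hφ
    rcases le_total t r₁ with h6 | h6
    · exact hright r₁ r₂ h6 h2 h3 h4 φ hφ
    rw [hright t r₂ le_rfl h5 h3 (fun j hj hc => h4 j hj ⟨h6.trans_lt hc.1, hc.2⟩) φ hφ,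
      hleft r₁ t h1 h6 le_rfl (fun j hj hc => h4 j hj ⟨hc.1, hc.2.trans h5⟩) φ hφ, add_assoc,
      intervalIntegral.integral_add_adjacent_intervals]
    · refine (intervalIntegrable_gen_path hM ha₀ hx₀ hφ (hInt₀ φ hφ) ⟨h1, h6⟩ htI).congr_ae ?_
      filter_upwards [hae₁ _ (hoc h1 h6 le_rfl) measurableSet_uIoc] with r hr
      rw [hr.1, hr.2.1]
    · refine (intervalIntegrable_gen_path hM hb hz hφ (hseg.integrable φ hφ)
        ⟨le_rfl, h.lt.le⟩ ⟨h5, h3⟩).congr_ae ?_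
      filter_upwards [hae₂ _ (hoc le_rfl h5 h3) measurableSet_uIoc] with r hr
      rw [hr.1, hr.2]
  · intro j hj hsj
    rcases (h.mem_window hst).1 hj with hj' | ho
    · rw [(hold j hj').1]
      refine (htraj.left_limit j hj' hsj).congr' ?_
      filter_upwards [Ioo_mem_nhdsLT hsj] with r hr
      exact (hxl r ⟨hr.1.le, hr.2.le.trans (window_le hj').2⟩).symm
    · rw [(hsome j ho).1, hτ' j ho]
      have h1 := (hseg.continuousOn hM hb hz t' ⟨h.lt.le, le_rfl⟩).tendsto
      have h2 : 𝓝[<] t' ≤ 𝓝[Set.Icc t t'] t' := by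
        rw [← nhdsWithin_Ioo_eq_nhdsLT h.lt]
        exact nhdsWithin_mono _ Set.Ioo_subset_Icc_self
      refine (h1.mono_left h2).congr' ?_
      filter_upwards [Ioo_mem_nhdsLT h.lt] with r hr
      exact (hxr r hr).symm
  · intro j hj
    rcases (h.mem_window hst).1 hj with hj' | ho
    · obtain ⟨h1, h2, h3⟩ := hold j hj'
      rw [h1, h2, h3, hxl _ (window_le hj')]
      exact htraj.jump j hj'
    · rw [hτ' j ho]
      exact (hsome j ho).2

/-- The path of a control process, extended to a measurable path. -/
theorem _root_.ObsControl.ProgMeas.exists_path {E : Type*} [MeasurableSpace E] {F : ℝ → MeasurableSpace Ω}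
    {f : ℝ → Ω → E} (h : ProgMeas F s t f) (hst : s ≤ t)
    (hF : F t ≤ (inferInstance : MeasurableSpace Ω)) (ω : Ω) :
    ∃ p : ℝ → E, Measurable p ∧ ∀ r ∈ Set.Icc s t, p r = f r ω :=
  ⟨fun r => f (Set.projIcc s t hst r) ω,
    (h.measurable_projIcc hst hF).comp (measurable_id.prodMk measurable_const),
    fun r hr => by simp only [Set.projIcc_of_mem hst hr]⟩

theorem Step.extend_admissible (hM : M.Standing) (h : M.Step t t' o) (hst : s ≤ t)
    (hs : M.Splittable ph s t) (hu : M.Admissible ph s t μ u) (hψ : Measurable ψ)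
    (hψU : ∀ ν, codePair (ψ ν) ∈ M.U)
    (hvalid : ∀ᵐ ω ∂M.P, M.ValidCode t t' (u.X t ω, ψ (u.X t ω))) :
    M.Admissible ph s t' μ (M.extend ph s t t' o u ψ) := by
  have hX : Measurable[M.sigmaAt ph s t u t] (u.X t) := hu.X_adapted.at_time ⟨hst, le_rfl⟩
  have hold_of_mem : ∀ {r}, r ∈ M.beforeObs ph s t → r ≤ t := fun hr => beforeObs_le hr
  obtain ⟨hα', hX'⟩ := h.extend_progressive hM hst hu hψ
  have hXb : ∀ r, r ∉ M.beforeObs ph s t →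
      Measurable[M.sigmaBefore ph s t' (M.extend ph s t t' o u ψ) r] (u.X t) := fun r hr =>
    hX.mono (sigmaAt_le_sigmaBefore_extend h.lt.le hr) le_rfl
  refine ⟨hα', ?_, ?_, ?_, hX', ?_, ?_⟩
  · intro r₁ r₂ h1 h2 h3 h4
    funext ω
    by_cases hr₂ : r₂ ∈ M.beforeObs ph s t
    · have hr₁ : r₁ ∈ M.beforeObs ph s t := by
        obtain ⟨j, hj, hj'⟩ := hr₂
        exact ⟨j, hj, h2.trans hj'⟩
      rw [extend_β_old hr₁, extend_β_old hr₂, hu.β_piecewise r₁ r₂ h1 h2 (beforeObs_le hr₂)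
        fun j hj => h4 j (window_subset h.lt.le hj)]
    · by_cases hr₁ : r₁ ∈ M.beforeObs ph s t
      · obtain ⟨j, hj, hj'⟩ := hr₁
        refine absurd ⟨hj', ?_⟩ (h4 j (window_subset h.lt.le hj))
        by_contra hc
        exact hr₂ ⟨j, hj, not_lt.1 hc⟩
      · rw [extend_β_new hr₁, extend_β_new hr₂]
  · intro r hr
    by_cases hro : r ∈ M.beforeObs ph s t
    · have h1 : (M.extend ph s t t' o u ψ).β r = u.β r := funext fun ω => extend_β_old hro ω
      rw [h1]
      exact (hu.β_predictable r ⟨hr.1, beforeObs_le hro⟩).mono (sigmaBefore_extend h.lt.le r) le_rfl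
    · have h1 : (M.extend ph s t t' o u ψ).β r = fun ω => (ψ (u.X t ω)).2.2.2 :=
        funext fun ω => extend_β_new hro ω
      rw [h1]
      exact (hψ.comp (hXb r hro)).snd.snd.snd
  · intro r hr ω
    by_cases hro : r ∈ M.beforeObs ph s t
    · rw [extend_β_old hro]
      have h1 : (M.extend ph s t t' o u ψ).α r ω = u.α r ω := if_pos (Or.inr hro)
      rw [h1]
      exact hu.mem_U r ⟨hr.1, beforeObs_le hro⟩ ω
    · rw [extend_β_new hro]
      rcases lt_or_ge r t with hrt | hrt
      · rw [extend_α_lt hrt]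
        -- Here an old α meets a new precision at a time before t. A product set allows this; with
        -- an observation at t nothing before t is overwritten; and for s = t there is no earlier
        -- time.
        rcases hs with ⟨A, B, hAB⟩ | ⟨j, hj, hj'⟩ | rfl
        · have h1 := hu.mem_U r ⟨hr.1, hrt.le⟩ ω
          have h2 := hψU (u.X t ω)
          rw [hAB] at h1 h2 ⊢
          exact ⟨h1.1, h2.2⟩
        · exact absurd ⟨j, hj, by rw [hj']; exact hrt.le⟩ hro
        · exact absurd hrt (not_lt.2 hr.1)
      · have h1 : (M.extend ph s t t' o u ψ).α r ω = M.codeControl (ψ (u.X t ω)) r :=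
          if_neg fun hc => hc.elim (fun hc => absurd hc (not_lt.2 hrt)) hro
        rw [h1]
        exact codeControl_mem (hψU _) r
  · intro j hj
    rcases le_or_gt (M.τ j) t with hjt | hjt
    · have hj' : j ∈ M.window ph s t := by
        rw [Model.mem_window] at hj ⊢
        exact ⟨hj.1, hjt⟩
      have h1 : (M.extend ph s t t' o u ψ).Xm j = u.Xm j := funext fun ω => extend_Xm_le hjt ω
      rw [h1]
      exact (hu.Xm_adapted j hj').mono (sigmaBefore_extend h.lt.le _) le_rfl
    · have h1 : (M.extend ph s t t' o u ψ).Xm j = fun ω =>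
          M.codeLaw t (u.X t ω, ψ (u.X t ω)) t' := funext fun ω => extend_Xm_gt hjt ω
      rw [h1]
      have h2 := hXb (M.τ j) fun hc => (hjt.trans_le (beforeObs_le hc)).false
      have h3 : Measurable fun ν : Law d => M.codeLaw t (ν, ψ ν) t' :=
        (hM.measurable_codeLaw t).comp (f := fun ν : Law d => ((ν, ψ ν), t'))
          ((measurable_id.prodMk hψ).prodMk measurable_const)
      exact h3.comp h2
  · filter_upwards [hu.dynamics, hvalid] with ω hω hv
    obtain ⟨a₀, ha₀, ha₀'⟩ := hu.α_adapted.exists_path hst (hu.sigmaAt_le hM t) ω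
    obtain ⟨x₀, hx₀, hx₀'⟩ := hu.X_adapted.exists_path hst (hu.sigmaAt_le hM t) ω
    have hb : Measurable (M.codeControl (ψ (u.X t ω))) :=
      hM.measurable_codeControl.comp (measurable_const.prodMk measurable_id)
    have hz : Measurable (M.codeLaw t (u.X t ω, ψ (u.X t ω))) :=
      (hM.measurable_codeLaw t).comp (measurable_const.prodMk measurable_id)
    refine hω.append hM h hst ha₀ ha₀' hx₀ hx₀' hb hz hv.2.2 (fun r hr => extend_X_le hr.2 ω)
      (fun r hr => extend_X_mid hr.1 hr.2 ω) (fun r hr => extend_α_lt hr.2 ω)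
      (fun r hr => extend_α_gt hr.1 ω) (fun j hj => ⟨extend_Xm_le (window_le hj).2 ω,
        extend_β_old (mem_beforeObs hj) ω, congrFun (Y_extend hj) ω⟩) (fun ho => ?_)
      fun j ho => ?_
    · rw [extend_X_end h.lt, ho]
      rfl
    · have hj : M.τ j = t' := (h.obs j).2 ho
      have hgt : t < M.τ j := by rw [hj]; exact h.lt
      have hnew : M.τ j ∉ M.beforeObs ph s t := fun hc => (hgt.trans_le (beforeObs_le hc)).false
      refine ⟨extend_Xm_gt hgt ω, ?_⟩
      rw [extend_X_end h.lt, ho]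
      simp only [Y, extend_β_new hnew, extend_Xm_gt hgt, post]

end Model

end ObsControl

namespace ObsControl

/-! ### Extended integrals against kernels. -/

section ExtIntegralMore

variable {S R : Type*} [MeasurableSpace S] [MeasurableSpace R] {κ : Measure S} {f : S → EReal}

theorem measurable_extIntegral_kernel {η : Kernel S R} [IsSFiniteKernel η] {f : S × R → EReal}
    (hf : Measurable f) : Measurable fun x => extIntegral (η x) fun y => f (x, y) := by
  have h1 : Measurable fun x => ∫⁻ y, (f (x, y)).toENNReal ∂(η x) :=
    hf.ereal_toENNReal.lintegral_kernel_prod_right'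
  have h2 : Measurable fun x => ∫⁻ y, (-f (x, y)).toENNReal ∂(η x) :=
    hf.neg.ereal_toENNReal.lintegral_kernel_prod_right'
  unfold extIntegral
  refine Measurable.ite (h1 (measurableSet_singleton ∞)) measurable_const ?_
  exact h1.coe_ereal_ennreal.add h2.coe_ereal_ennreal.neg

theorem measurable_extIntegral_prod {η : Measure R} [SFinite η] {f : S × R → EReal}
    (hf : Measurable f) : Measurable fun x => extIntegral η fun y => f (x, y) :=
  measurable_extIntegral_kernel (η := Kernel.const S η) hf

theorem extIntegral_add_measure {κ₁ κ₂ : Measure S}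
    (h : ∫⁻ x, (-f x).toENNReal ∂(κ₁ + κ₂) ≠ ∞) :
    extIntegral (κ₁ + κ₂) f = extIntegral κ₁ f + extIntegral κ₂ f := by
  have h' := h
  rw [lintegral_add_measure] at h'
  obtain ⟨h₁, h₂⟩ := ENNReal.add_ne_top.1 h'
  rw [extIntegral_of_neg_ne_top h, extIntegral_of_neg_ne_top h₁, extIntegral_of_neg_ne_top h₂]
  refine coe_sub_eq_add_sub ?_ h h₁ h₂
  rw [lintegral_add_measure, lintegral_add_measure]
  ring

theorem neg_add_toENNReal_le (x y : EReal) :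
    (-(x + y)).toENNReal ≤ (-x).toENNReal + (-y).toENNReal := by
  by_cases hx : x = ⊥
  · simp [hx]
  by_cases hy : y = ⊥
  · simp [hy]
  exact neg_toENNReal_add_le hx hy

theorem neg_sum_toENNReal_le {ι : Type*} (A : Finset ι) (f : ι → EReal) :
    (-(∑ i ∈ A, f i)).toENNReal ≤ ∑ i ∈ A, (-f i).toENNReal := by
  classical
  induction A using Finset.induction_on with
  | empty => simp
  | insert i A hi ih =>
    rw [Finset.sum_insert hi, Finset.sum_insert hi]
    exact (neg_add_toENNReal_le _ _).trans (add_le_add le_rfl ih)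

/-- This bounds the negative part of the integrated running cost by the integral of the negative
parts, the quantity controlled by `negCost`. -/
theorem neg_extIntegral_toENNReal_le :
    (-(extIntegral κ f)).toENNReal ≤ ∫⁻ x, (-f x).toENNReal ∂κ := by
  by_cases h : ∫⁻ x, (f x).toENNReal ∂κ = ∞
  · rw [extIntegral_of_pos_eq_top h]; simp
  · unfold extIntegral
    rw [if_neg h]
    lift (∫⁻ x, (f x).toENNReal ∂κ) to NNReal using h with A
    rw [EReal.neg_sub (Or.inl (by simp)) (Or.inl (by simp))]
    have h1 : ∀ N : ℝ≥0∞, -((A : ℝ≥0∞) : EReal) + (N : EReal) ≤ N := fun N => by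
      have h2 : -((A : ℝ≥0∞) : EReal) ≤ 0 :=
        EReal.neg_le_zero.2 (EReal.coe_ennreal_nonneg _)
      calc -((A : ℝ≥0∞) : EReal) + (N : EReal) ≤ 0 + (N : EReal) := by gcongr
        _ = N := zero_add _
    exact (EReal.toENNReal_le_toENNReal (h1 _)).trans (by rw [EReal.toENNReal_coe])

theorem neg_coe_toENNReal (a : ℝ≥0∞) : (-(a : EReal)).toENNReal = 0 :=
  EReal.toENNReal_of_nonpos (EReal.neg_le_zero.2 (EReal.coe_ennreal_nonneg _))

theorem extIntegral_coe_ennreal (f : S → ℝ≥0∞) :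
    extIntegral κ (fun x => (f x : EReal)) = ((∫⁻ x, f x ∂κ : ℝ≥0∞) : EReal) := by
  rw [extIntegral_of_neg_ne_top] <;>
    simp only [neg_coe_toENNReal, EReal.toENNReal_coe, lintegral_zero]
  · simp
  · exact ENNReal.zero_ne_top

theorem extIntegral_neg_coe_ennreal {f : S → ℝ≥0∞} (hf : ∫⁻ x, f x ∂κ ≠ ∞) :
    extIntegral κ (fun x => -(f x : EReal)) = -((∫⁻ x, f x ∂κ : ℝ≥0∞) : EReal) := by
  rw [extIntegral_of_neg_ne_top] <;>
    simp only [neg_coe_toENNReal, EReal.toENNReal_coe, lintegral_zero, neg_neg]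
  · simp
  · exact hf

/-- Disintegration of the integral of an extended real function. -/
theorem LowerIntegrable.bind {η : Kernel S R} {f : R → EReal}
    (hf : LowerIntegrable (κ.bind η) f) :
    LowerIntegrable κ (fun x => extIntegral (η x) f) ∧
      extIntegral (κ.bind η) f = extIntegral κ (fun x => extIntegral (η x) f) := by
  have hη : AEMeasurable η κ := η.aemeasurable
  have hmP := hf.aemeasurable.ereal_toENNReal
  have hmN := hf.aemeasurable.neg.ereal_toENNReal
  simp only [Pi.neg_apply] at hmN
  have hP := Measure.lintegral_bind hη hmP
  have hN := Measure.lintegral_bind hη hmN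
  -- f is measurable only up to a null set of the mixture; for almost every x this set is null for
  -- `η x`, so a measurable version has the same inner integral.
  have haeP : AEMeasurable (fun x => ∫⁻ y, (f y).toENNReal ∂(η x)) κ := by
    refine ⟨fun x => ∫⁻ y, hmP.mk _ y ∂(η x), hmP.measurable_mk.lintegral_kernel, ?_⟩
    filter_upwards [Measure.ae_ae_of_ae_bind hη hmP.ae_eq_mk] with x hx
    exact lintegral_congr_ae hx
  have haeN : AEMeasurable (fun x => ∫⁻ y, (-f y).toENNReal ∂(η x)) κ := by
    refine ⟨fun x => ∫⁻ y, hmN.mk _ y ∂(η x), hmN.measurable_mk.lintegral_kernel, ?_⟩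
    filter_upwards [Measure.ae_ae_of_ae_bind hη hmN.ae_eq_mk] with x hx
    exact lintegral_congr_ae hx
  have hNfin : ∫⁻ x, ∫⁻ y, (-f y).toENNReal ∂(η x) ∂κ ≠ ∞ := hN ▸ hf.neg_ne_top
  have hae : ∀ᵐ x ∂κ, ((∫⁻ y, (f y).toENNReal ∂(η x) : ℝ≥0∞) : EReal)
      + -((∫⁻ y, (-f y).toENNReal ∂(η x) : ℝ≥0∞) : EReal) = extIntegral (η x) f := by
    filter_upwards [ae_lt_top' haeN hNfin] with x hx
    rw [extIntegral_of_neg_ne_top hx.ne, sub_eq_add_neg]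
  have h1 : LowerIntegrable κ (fun x => ((∫⁻ y, (f y).toENNReal ∂(η x) : ℝ≥0∞) : EReal)) := by
    refine ⟨haeP.coe_ereal_ennreal, ?_⟩
    simp only [neg_coe_toENNReal, lintegral_zero]
    exact ENNReal.zero_ne_top
  have h2 : LowerIntegrable κ (fun x => -((∫⁻ y, (-f y).toENNReal ∂(η x) : ℝ≥0∞) : EReal)) := by
    refine ⟨haeN.coe_ereal_ennreal.neg, ?_⟩
    simpa using hNfin
  refine ⟨(h1.add h2).congr hae, ?_⟩
  rw [← extIntegral_congr_ae hae, extIntegral_add h1 h2, extIntegral_coe_ennreal,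
    extIntegral_neg_coe_ennreal hNfin, extIntegral_of_neg_ne_top hf.neg_ne_top, hP, hN,
    sub_eq_add_neg]

end ExtIntegralMore

namespace Model

variable {d m k₁ k₂ n : ℕ} {𝒴 G Ω : Type*}
  [MeasurableSpace 𝒴] [MeasurableSpace G] [MeasurableSpace Ω]
  {M : Model d m k₁ k₂ n 𝒴 G Ω}
  {ph ph' : Phase} {s t t' r₁ r₂ : ℝ} {μ : Law d} {u u' : Controlled d k₁ k₂ n Ω}

/-! ### Restricting a control to a shorter interval. -/

section Restriction

theorem sigmaAt_restrict (htt' : t ≤ t') {r : ℝ} (hr : r ≤ t) :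
    M.sigmaAt ph s t' u r = M.sigmaAt ph s t u r := by
  refine le_antisymm (iSup₂_le fun j hj => iSup_le fun h => ?_) (iSup₂_le fun j hj =>
    iSup_le fun h => ?_)
  · refine measurable_iff_comap_le.1 (measurable_Y_sigmaAt ?_ h)
    rw [mem_window] at hj ⊢
    exact ⟨hj.1, h.trans hr⟩
  · exact measurable_iff_comap_le.1 (measurable_Y_sigmaAt (window_subset htt' hj) h)

theorem sigmaBefore_restrict (htt' : t ≤ t') {r : ℝ} (hr : r ≤ t) :
    M.sigmaBefore ph s t' u r = M.sigmaBefore ph s t u r := by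
  refine le_antisymm (iSup₂_le fun j hj => iSup_le fun h => ?_) (iSup₂_le fun j hj =>
    iSup_le fun h => ?_)
  · refine measurable_iff_comap_le.1 (measurable_Y_sigmaBefore ?_ h)
    rw [mem_window] at hj ⊢
    exact ⟨hj.1, h.le.trans hr⟩
  · exact measurable_iff_comap_le.1 (measurable_Y_sigmaBefore (window_subset htt' hj) h)

theorem not_mem_window {P : Fin n → Prop} (h : ∀ j ∈ M.window ph s t, ¬ P j)
    (hP : ∀ j, P j → M.τ j ≤ t) : ∀ j ∈ M.window ph s t', ¬ P j := fun j hj hc => by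
  refine h j ?_ hc
  rw [mem_window] at hj ⊢
  exact ⟨hj.1, hP j hc⟩

theorem Admissible.restrict (hu : M.Admissible ph s t' μ u) (hst : s ≤ t) (htt' : t ≤ t') :
    M.Admissible ph s t μ u := by
  have hsub : M.window ph s t ⊆ M.window ph s t' := window_subset htt'
  have hI : Set.Icc s t ⊆ Set.Icc s t' := Set.Icc_subset_Icc_right htt'
  refine ⟨fun r hr => ?_, fun r₁ r₂ h1 h2 h3 h4 => ?_, fun r hr => ?_, fun r hr => hu.mem_U r (hI hr),
    fun r hr => ?_, fun j hj => ?_, ?_⟩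
  · rw [← sigmaAt_restrict htt' hr.2]; exact hu.α_adapted r (hI hr)
  · exact hu.β_piecewise r₁ r₂ h1 h2 (h3.trans htt')
      (not_mem_window h4 fun j hc => hc.2.le.trans h3)
  · rw [← sigmaBefore_restrict htt' hr.2]; exact hu.β_predictable r (hI hr)
  · rw [← sigmaAt_restrict htt' hr.2]; exact hu.X_adapted r (hI hr)
  · rw [← sigmaBefore_restrict htt' (window_le hj).2]; exact hu.Xm_adapted j (hsub hj)
  · filter_upwards [hu.dynamics] with ω h
    refine ⟨fun hs => ?_, fun j hj => h.start_before j (hsub hj), fun φ h1 h2 => ?_,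
      fun r₁ r₂ h1 h2 h3 h4 => ?_, fun j hj => h.left_limit j (hsub hj),
      fun j hj => h.jump j (hsub hj)⟩
    · exact h.start (not_mem_window hs fun j hj => by rw [hj]; exact hst)
    · exact (lintegral_mono_set hI).trans_lt (h.integrable φ h1 h2)
    · exact h.fokker_planck r₁ r₂ h1 h2 (h3.trans htt') (not_mem_window h4 fun j hc => hc.2.trans h3)

end Restriction

/-! ### Splitting and lower integrability of costs. -/

section Costs

theorem window_split (hst : s ≤ t) (htt' : t ≤ t') :
    M.window ph s t' = M.window ph s t ∪ M.window .after t t' := by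
  ext j
  simp only [Finset.mem_union, mem_window]
  constructor
  · rintro ⟨h1, h2⟩
    rcases le_or_gt (M.τ j) t with h3 | h3
    · exact Or.inl ⟨h1, h3⟩
    · exact Or.inr ⟨Or.inl h3, h2⟩
  · rintro (⟨h1, h2⟩ | ⟨h1, h2⟩)
    · exact ⟨h1, h2.trans htt'⟩
    · rcases h1 with h1 | ⟨h1, -⟩
      · exact ⟨Or.inl (hst.trans_lt h1), h2⟩
      · exact absurd h1 (by simp)

theorem window_disjoint : Disjoint (M.window ph s t) (M.window .after t t') := by
  rw [Finset.disjoint_left]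
  intro j h1 h2
  rw [mem_window] at h1 h2
  rcases h2.1 with h3 | ⟨h3, -⟩
  · exact (h3.trans_le h1.2).false
  · exact absurd h3 (by simp)

theorem restrict_Icc_add (hst : s ≤ t) (htt' : t ≤ t') :
    (volume : Measure ℝ).restrict (Set.Icc s t')
      = volume.restrict (Set.Icc s t) + volume.restrict (Set.Icc t t') := by
  rw [← restrict_Ioc_eq_restrict_Icc (a := t) (b := t'), ← Set.Icc_union_Ioc_eq_Icc hst htt',
    Measure.restrict_union ?_ measurableSet_Ioc]
  rw [Set.disjoint_left]
  exact fun r h1 h2 => (h2.1.trans_le h1.2).false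

/-- Finiteness of the negative part prevents ∞ - ∞ between the two intervals; for admissible
controls it holds almost surely by well-posedness. -/
theorem runCost_split (hst : s ≤ t) (htt' : t ≤ t') {ω : Ω}
    (h : ∫⁻ r in Set.Icc s t', (-M.ℓ r (u.X r ω) (u.α r ω)).toENNReal ≠ ∞) :
    M.runCost ph s t' u ω = M.runCost ph s t u ω + M.runCost .after t t' u ω := by
  unfold runCost
  rw [restrict_Icc_add hst htt'] at h ⊢
  rw [extIntegral_add_measure h, window_split hst htt', Finset.sum_union window_disjoint,
    add_add_add_comm]

/-- Equality of two controlled processes up to the time `t`, as far as costs are concerned. -/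
structure AgreesUpTo (M : Model d m k₁ k₂ n 𝒴 G Ω) (ph : Phase) (s t : ℝ)
    (u u' : Controlled d k₁ k₂ n Ω) : Prop where
  X_eq : ∀ r ∈ Set.Icc s t, ∀ ω, u'.X r ω = u.X r ω
  α_eq : ∀ r ∈ Set.Ico s t, ∀ ω, u'.α r ω = u.α r ω
  Xm_eq : ∀ j ∈ M.window ph s t, ∀ ω, u'.Xm j ω = u.Xm j ω
  β_eq : ∀ j ∈ M.window ph s t, ∀ ω, u'.β (M.τ j) ω = u.β (M.τ j) ω

theorem AgreesUpTo.refl : M.AgreesUpTo ph s t u u :=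
  ⟨fun _ _ _ => rfl, fun _ _ _ => rfl, fun _ _ _ => rfl, fun _ _ _ => rfl⟩

theorem AgreesUpTo.trans {u'' : Controlled d k₁ k₂ n Ω} (h : M.AgreesUpTo ph s t u u')
    (h' : M.AgreesUpTo ph s t' u' u'') (htt' : t ≤ t') : M.AgreesUpTo ph s t u u'' :=
  ⟨fun r hr ω => (h'.X_eq r ⟨hr.1, hr.2.trans htt'⟩ ω).trans (h.X_eq r hr ω),
    fun r hr ω => (h'.α_eq r ⟨hr.1, hr.2.trans_le htt'⟩ ω).trans (h.α_eq r hr ω),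
    fun j hj ω => (h'.Xm_eq j (window_subset htt' hj) ω).trans (h.Xm_eq j hj ω),
    fun j hj ω => (h'.β_eq j (window_subset htt' hj) ω).trans (h.β_eq j hj ω)⟩

theorem AgreesUpTo.runCost_eq (h : M.AgreesUpTo ph s t u u') (hI : Set.Icc r₁ r₂ ⊆ Set.Icc s t)
    (hw : M.window ph' r₁ r₂ ⊆ M.window ph s t) (ω : Ω) :
    M.runCost ph' r₁ r₂ u' ω = M.runCost ph' r₁ r₂ u ω := by
  unfold runCost
  congr 1
  · refine extIntegral_congr_ae ?_
    filter_upwards [ae_ne_real _ t, ae_restrict_mem measurableSet_Icc] with r hr hrI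
    have hr' := hI hrI
    rw [h.X_eq r hr' ω, h.α_eq r ⟨hr'.1, lt_of_le_of_ne hr'.2 hr⟩ ω]
  · exact Finset.sum_congr rfl fun j hj => by rw [h.Xm_eq j (hw hj) ω, h.β_eq j (hw hj) ω]

theorem window_mono (h₁ : s ≤ r₁) (h₂ : r₂ ≤ t) : M.window .after r₁ r₂ ⊆ M.window ph s t := by
  intro j hj
  rw [mem_window] at hj ⊢
  rcases hj.1 with h3 | ⟨h3, -⟩
  · exact ⟨Or.inl (h₁.trans_lt h3), hj.2.trans h₂⟩
  · exact absurd h3 (by simp)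

theorem Admissible.measurable_Xm (hM : M.Standing) (hu : M.Admissible ph s t μ u) {j : Fin n}
    (hj : j ∈ M.window ph s t) : Measurable (u.Xm j) :=
  (hu.Xm_adapted j hj).mono ((sigmaBefore_le_sigmaAt _).trans (hu.sigmaAt_le hM _)) le_rfl

theorem Admissible.measurable_β (hM : M.Standing) (hu : M.Admissible ph s t μ u) {r : ℝ}
    (hr : r ∈ Set.Icc s t) : Measurable (u.β r) :=
  (hu.β_predictable r hr).mono ((sigmaBefore_le_sigmaAt _).trans (hu.sigmaAt_le hM _)) le_rfl

theorem Admissible.measurable_ℓ (hM : M.Standing) (hu : M.Admissible ph s t μ u) (hst : s ≤ t) :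
    ∃ f : Ω × ℝ → EReal, Measurable f ∧
      ∀ r ∈ Set.Icc s t, ∀ ω, f (ω, r) = M.ℓ r (u.X r ω) (u.α r ω) := by
  have h1 := hu.X_adapted.measurable_projIcc hst (hu.sigmaAt_le hM t)
  have h2 := hu.α_adapted.measurable_projIcc hst (hu.sigmaAt_le hM t)
  refine ⟨fun p => M.ℓ p.2 (u.X (Set.projIcc s t hst p.2) p.1) (u.α (Set.projIcc s t hst p.2) p.1),
    hM.meas_ℓ.comp (measurable_snd.prodMk ((h1.comp measurable_swap).prodMk
      (h2.comp measurable_swap))), fun r hr ω => ?_⟩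
  simp only [Set.projIcc_of_mem hst hr]

theorem Admissible.measurable_runCost (hM : M.Standing) (hu : M.Admissible ph s t μ u)
    (hst : s ≤ t) (hI : Set.Icc r₁ r₂ ⊆ Set.Icc s t)
    (hw : M.window ph' r₁ r₂ ⊆ M.window ph s t) : Measurable (M.runCost ph' r₁ r₂ u) := by
  obtain ⟨f, hf, hf'⟩ := hu.measurable_ℓ hM hst
  unfold runCost
  refine Measurable.add ?_ (Finset.measurable_sum _ fun j hj => ?_)
  · have h1 : (fun ω => extIntegral (volume.restrict (Set.Icc r₁ r₂))
        fun r => M.ℓ r (u.X r ω) (u.α r ω))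
        = fun ω => extIntegral (volume.restrict (Set.Icc r₁ r₂)) fun r => f (ω, r) := by
      funext ω
      refine extIntegral_congr_ae ?_
      filter_upwards [ae_restrict_mem measurableSet_Icc] with r hr
      exact (hf' r (hI hr) ω).symm
    rw [h1]
    exact measurable_extIntegral_prod hf
  · exact (hM.meas_h j).comp ((hu.measurable_Xm hM (hw hj)).prodMk
      (hu.measurable_β hM (window_le (hw hj))))

theorem neg_runCost_le (hI : Set.Icc r₁ r₂ ⊆ Set.Icc s t)
    (hw : M.window ph' r₁ r₂ ⊆ M.window ph s t) (ω : Ω) :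
    (-M.runCost ph' r₁ r₂ u ω).toENNReal
      ≤ (∫⁻ r in Set.Icc s t, (-M.ℓ r (u.X r ω) (u.α r ω)).toENNReal)
    + ∑ j ∈ M.window ph s t, (-M.h (M.τ j) (u.Xm j ω) (u.β (M.τ j) ω)).toENNReal := by
  unfold runCost
  refine (neg_add_toENNReal_le _ _).trans (add_le_add ?_ ?_)
  · exact neg_extIntegral_toENNReal_le.trans (lintegral_mono_set hI)
  · exact (neg_sum_toENNReal_le _ _).trans (Finset.sum_le_sum_of_subset hw)

theorem Admissible.lowerIntegrable_runCost (hM : M.Standing) (hu : M.Admissible ph s t μ u)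
    (hneg : M.negCost ph s t u < ∞) (hst : s ≤ t) (hI : Set.Icc r₁ r₂ ⊆ Set.Icc s t)
    (hw : M.window ph' r₁ r₂ ⊆ M.window ph s t) :
    LowerIntegrable M.P (M.runCost ph' r₁ r₂ u) := by
  refine ⟨(hu.measurable_runCost hM hst hI hw).aemeasurable, ne_top_of_le_ne_top hneg.ne ?_⟩
  exact lintegral_mono fun ω => (neg_runCost_le hI hw ω).trans le_self_add

theorem Admissible.lowerIntegrable_terminal (hM : M.Standing) (hu : M.Admissible ph s M.T μ u)
    (hneg : M.negCost ph s M.T u < ∞) (hst : s ≤ M.T) :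
    LowerIntegrable M.P (fun ω => M.g (u.X M.T ω)) := by
  refine ⟨(hM.meas_g.comp (hu.measurable_X hM ⟨hst, le_rfl⟩)).aemeasurable,
    ne_top_of_le_ne_top hneg.ne ?_⟩
  refine lintegral_mono fun ω => ?_
  rw [if_pos rfl]
  exact le_add_self

theorem Admissible.ae_neg_ℓ (hM : M.Standing) (hu : M.Admissible ph s t μ u)
    (hneg : M.negCost ph s t u < ∞) (hst : s ≤ t) :
    ∀ᵐ ω ∂M.P, ∫⁻ r in Set.Icc s t, (-M.ℓ r (u.X r ω) (u.α r ω)).toENNReal < ∞ := by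
  obtain ⟨f, hf, hf'⟩ := hu.measurable_ℓ hM hst
  have h1 : (fun ω => ∫⁻ r in Set.Icc s t, (-M.ℓ r (u.X r ω) (u.α r ω)).toENNReal)
      = fun ω => ∫⁻ r in Set.Icc s t, (-f (ω, r)).toENNReal := by
    funext ω
    exact setLIntegral_congr_fun measurableSet_Icc fun r hr => by rw [hf' r hr ω]
  have h2 : Measurable fun ω => ∫⁻ r in Set.Icc s t, (-M.ℓ r (u.X r ω) (u.α r ω)).toENNReal := by
    rw [h1]
    exact hf.neg.ereal_toENNReal.lintegral_prod_right'
  refine ae_lt_top h2 (ne_top_of_le_ne_top hneg.ne (lintegral_mono fun ω => ?_))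
  rw [add_assoc]
  exact le_self_add

theorem Admissible.runCost_split (hM : M.Standing) (hu : M.Admissible ph s t μ u)
    (hneg : M.negCost ph s t u < ∞) (h₁ : s ≤ r₁) (h₂ : r₁ ≤ r₂) (h₃ : r₂ ≤ t) :
    ∀ᵐ ω ∂M.P, M.runCost .after r₁ t u ω
      = M.runCost .after r₁ r₂ u ω + M.runCost .after r₂ t u ω := by
  filter_upwards [hu.ae_neg_ℓ hM hneg (h₁.trans (h₂.trans h₃))] with ω hω
  exact Model.runCost_split h₂ h₃ (ne_top_of_le_ne_top hω.ne
    (lintegral_mono_set (Set.Icc_subset_Icc_left h₁)))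

theorem Admissible.runCost_split_start (hM : M.Standing) (hu : M.Admissible ph s t μ u)
    (hneg : M.negCost ph s t u < ∞) (h₁ : s ≤ r₁) (h₂ : r₁ ≤ t) :
    ∀ᵐ ω ∂M.P, M.runCost ph s t u ω = M.runCost ph s r₁ u ω + M.runCost .after r₁ t u ω := by
  filter_upwards [hu.ae_neg_ℓ hM hneg (h₁.trans h₂)] with ω hω
  exact Model.runCost_split h₁ h₂ hω.ne

end Costs

end Model

end ObsControl

/-! ### The one-step operator and measurable ε-optimal codes. -/

namespace ObsControl

theorem le_of_forall_pos_le_add_real {x y : EReal} (h : ∀ ε : ℝ, 0 < ε → x ≤ y + ε) : x ≤ y := by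
  induction y with
  | bot => simpa using h 1 one_pos
  | top => exact le_top
  | coe b =>
    refine EReal.le_of_forall_lt_iff_le.1 fun z hz => ?_
    have hz' : b < z := by exact_mod_cast hz
    have := h (z - b) (by linarith)
    rw [← EReal.coe_add] at this
    simpa using this

/-- The integral of an infimal projection is approximated by integrals of measurable sections. -/
theorem exists_extIntegral_section_le {S : Type*} [MeasurableSpace S] [StandardBorelSpace S]
    {W : S → EReal} {F : S × (ℕ → ℕ) → EReal} (hF : Measurable F)
    (hWF : ∀ ν, W ν = ⨅ z, F (ν, z)) (hW : ∀ ν, W ν ≠ ⊥) {ev : (ℕ → ℕ) × S → (ℕ → ℕ)}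
    (hev : ∀ (κ : Measure S) [IsFiniteMeasure κ] (f : S → (ℕ → ℕ)),
      Measurable f → ∃ z, ∀ᵐ s ∂κ, ev (z, s) = f s)
    (κ : Measure S) [IsProbabilityMeasure κ] {ε : ℝ} (hε : 0 < ε) :
    ∃ ζ, extIntegral κ (fun ν => F (ν, ev (ζ, ν))) ≤ extIntegral κ W + ε := by
  have hm : AEMeasurable W κ := InfProj.aemeasurable ⟨F, hF, hWF⟩ κ
  obtain ⟨f, hf, hfW⟩ := exists_measurable_lt hF hWF hW κ hε
  obtain ⟨ζ, hζ⟩ := hev κ f hf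
  refine ⟨ζ, ?_⟩
  by_cases htop : ∀ᵐ ν ∂κ, W ν < ⊤
  · refine (extIntegral_mono_ae ?_).trans (extIntegral_add_real_le hm ε)
    filter_upwards [htop, hfW, hζ] with ν h1 h2 h3
    rw [h3]
    exact (h2 h1).le
  · rw [extIntegral_eq_top_of_not_ae hm htop]
    simp

namespace Model

variable {d m k₁ k₂ n : ℕ} {𝒴 G Ω : Type*}
  [MeasurableSpace 𝒴] [MeasurableSpace G] [MeasurableSpace Ω]
  {M : Model d m k₁ k₂ n 𝒴 G Ω}
  {t t' : ℝ} {o : Option (Fin n)} {W : Law d → EReal}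

/-- The precision and the law just before time `t'`, for a coded path started at time `t`. -/
def codeEnd (M : Model d m k₁ k₂ n 𝒴 G Ω) (t t' : ℝ) (p : Law d × Code k₁ k₂) : Vec k₂ × Law d :=
  (p.2.2.2.2, M.codeLaw t p t')

/-- The cost on `[t, t']` of a coded path. -/
def pathCost (M : Model d m k₁ k₂ n 𝒴 G Ω) (t t' : ℝ) (o : Option (Fin n))
    (p : Law d × Code k₁ k₂) : EReal :=
  extIntegral (volume.restrict (Set.Icc t t'))
    (fun r => M.ℓ r (M.codeLaw t p r) (M.codeControl p.2 r)) + M.obsCost o (M.codeEnd t t' p)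

/-- The cost of a coded path on `[t, t']`, with the cost to go `W` at time `t'`. -/
def stepCost (hM : M.Standing) (t t' : ℝ) (o : Option (Fin n)) (W : Law d → EReal)
    (p : Law d × Code k₁ k₂) : EReal :=
  M.pathCost t t' o p + extIntegral (postKernel hM o (M.codeEnd t t' p)) W

/-- The one-step dynamic programming operator. -/
def bellman (hM : M.Standing) (t t' : ℝ) (o : Option (Fin n)) (W : Law d → EReal) (ν : Law d) :
    EReal :=
  ⨅ (z : Code k₁ k₂) (_ : M.ValidCode t t' (ν, z)), stepCost hM t t' o W (ν, z)

theorem Standing.measurable_codeEnd (hM : M.Standing) (t t' : ℝ) : Measurable (M.codeEnd t t') := by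
  have h1 : Measurable fun p : Law d × Code k₁ k₂ => M.codeLaw t p t' :=
    (hM.measurable_codeLaw t).comp (measurable_id.prodMk measurable_const)
  have h2 : Measurable fun p : Law d × Code k₁ k₂ => p.2.2.2.2 := by fun_prop
  exact h2.prodMk h1

theorem Standing.measurable_pathCost (hM : M.Standing) (t t' : ℝ) (o : Option (Fin n)) :
    Measurable (M.pathCost t t' o) := by
  refine Measurable.add ?_ ((hM.measurable_obsCost o).comp (hM.measurable_codeEnd t t'))
  have hC : Measurable fun q : (Law d × Code k₁ k₂) × ℝ => M.codeControl q.1.2 q.2 :=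
    hM.measurable_codeControl.comp (f := fun q : (Law d × Code k₁ k₂) × ℝ => (q.1.2, q.2))
      (by fun_prop)
  exact measurable_extIntegral_prod (f := fun q : (Law d × Code k₁ k₂) × ℝ =>
    M.ℓ q.2 (M.codeLaw t q.1 q.2) (M.codeControl q.1.2 q.2))
    (hM.meas_ℓ.comp (measurable_snd.prodMk ((hM.measurable_codeLaw t).prodMk hC)))

theorem polishSpace_prod (X Y : Type*) [TopologicalSpace X] [TopologicalSpace Y] [PolishSpace X]
    [PolishSpace Y] : PolishSpace (X × Y) := inferInstance

instance : PolishSpace (Code k₁ k₂) :=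
  have : PolishSpace ((ℕ → ℕ) × Vec k₁ × Vec k₂) := polishSpace_prod _ _
  polishSpace_prod _ _

theorem borelSpace_prod (X Y : Type*) [TopologicalSpace X] [TopologicalSpace Y]
    [SecondCountableTopology X] [MeasurableSpace X] [MeasurableSpace Y] [BorelSpace X]
    [BorelSpace Y] : BorelSpace (X × Y) := inferInstance

instance : BorelSpace (Code k₁ k₂) :=
  have : BorelSpace ((ℕ → ℕ) × Vec k₁ × Vec k₂) := borelSpace_prod _ _
  borelSpace_prod _ _

/-- The one-step operator preserves infimal projections, and its infimum is attained up to `ε` along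
measurable selections. -/
theorem exists_bellman_projection (hM : M.Standing) (htt' : t < t') (hW : InfProj W)
    (hWbot : ∀ ν, W ν ≠ ⊥) :
    ∃ (F : Law d × (ℕ → ℕ) → EReal) (e : (ℕ → ℕ) → Code k₁ k₂), Measurable F ∧ Measurable e ∧
      (∀ ν, bellman hM t t' o W ν = ⨅ z, F (ν, z)) ∧
      ∀ ν z, F (ν, z) < ⊤ → M.ValidCode t t' (ν, e z) ∧
        stepCost hM t t' o W (ν, e z) ≤ F (ν, z) := by
  classical
  obtain ⟨F', hF', hWF⟩ := hW
  obtain ⟨ev, hev, hev'⟩ := exists_universal_evaluation (Law d) (ℕ → ℕ)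
  have : PolishSpace (Code k₁ k₂ × (ℕ → ℕ)) := polishSpace_prod _ _
  have : BorelSpace (Code k₁ k₂ × (ℕ → ℕ)) := borelSpace_prod _ _
  -- A parameter is a pair: a code for the path up to t', and a code ζ for a measurable choice of
  -- the argument of `F'` as a function of the law after the update. Minimizing also over ζ turns
  -- the integral of an infimum into an infimum of integrals of Borel functions. The Baire space
  -- covers all such pairs.
  obtain ⟨e, he, hes⟩ := PolishSpace.exists_nat_nat_continuous_surjective (Code k₁ k₂ × (ℕ → ℕ))
  let V' : Set (Law d × Code k₁ k₂) := {p | M.ValidCode t t' p}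
  have hV' : MeasurableSet V' := measurableSet_validCode hM htt'
  let Φ : Law d × (Code k₁ k₂ × (ℕ → ℕ)) → EReal := fun q =>
    if (q.1, q.2.1) ∈ V' then M.pathCost t t' o (q.1, q.2.1)
      + extIntegral (postKernel hM o (M.codeEnd t t' (q.1, q.2.1)))
        (fun ν' => F' (ν', ev (q.2.2, ν'))) else ⊤
  have hp : Measurable fun q : Law d × (Code k₁ k₂ × (ℕ → ℕ)) => (q.1, q.2.1) := by fun_prop
  have hΦ : Measurable Φ := by
    refine Measurable.ite (hp hV') (((hM.measurable_pathCost t t' o).comp hp).add ?_)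
      measurable_const
    let η : Kernel (Law d × (Code k₁ k₂ × (ℕ → ℕ))) (Law d) :=
      (postKernel hM o).comap _ ((hM.measurable_codeEnd t t').comp hp)
    have : IsMarkovKernel η := by unfold η; infer_instance
    refine measurable_extIntegral_kernel (η := η)
      (f := fun w : (Law d × (Code k₁ k₂ × (ℕ → ℕ))) × Law d => F' (w.2, ev (w.1.2.2, w.2))) ?_
    refine hF'.comp (measurable_snd.prodMk (hev.comp ?_))
    fun_prop
  have hle : ∀ ν z ζ, (ν, z) ∈ V' → stepCost hM t t' o W (ν, z) ≤ Φ (ν, z, ζ) := by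
    intro ν z ζ h
    simp only [Φ, if_pos h, stepCost]
    gcongr
    refine extIntegral_mono_ae (ae_of_all _ fun ν' => ?_)
    rw [hWF]
    exact iInf_le _ _
  refine ⟨fun q => Φ (q.1, e q.2), fun z => (e z).1,
    hΦ.comp (measurable_fst.prodMk (he.measurable.comp measurable_snd)),
    measurable_fst.comp he.measurable, fun ν => ?_, fun ν z hlt => ?_⟩
  · rw [hes.iInf_comp (g := fun w => Φ (ν, w))]
    refine le_antisymm (le_iInf fun w => ?_) (le_iInf₂ fun z hz => ?_)
    · by_cases hv : (ν, w.1) ∈ V'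
      · exact (iInf₂_le w.1 hv).trans (hle ν w.1 w.2 hv)
      · simp only [Φ, if_neg hv]
        exact le_top
    · refine le_of_forall_pos_le_add_real fun ε hε => ?_
      obtain ⟨ζ, hζ⟩ := exists_extIntegral_section_le hF' hWF hWbot hev'
        (postKernel hM o (M.codeEnd t t' (ν, z))) hε
      refine (iInf_le _ (z, ζ)).trans ?_
      have hv : (ν, z) ∈ V' := hz
      simp only [Φ, if_pos hv, stepCost]
      rw [add_assoc]
      gcongr
  · have hv : (ν, (e z).1) ∈ V' := by
      by_contra hv
      simp only [Φ, if_neg hv] at hlt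
      exact lt_irrefl _ hlt
    exact ⟨hv, hle ν _ _ hv⟩

theorem infProj_bellman (hM : M.Standing) (htt' : t < t') (hW : InfProj W)
    (hWbot : ∀ ν, W ν ≠ ⊥) : InfProj (bellman hM t t' o W) := by
  obtain ⟨F, -, hF, -, hF', -⟩ := exists_bellman_projection (o := o) hM htt' hW hWbot
  exact ⟨F, hF, hF'⟩

theorem exists_bellman_selection (hM : M.Standing) (htt' : t < t') (hW : InfProj W)
    (hWbot : ∀ ν, W ν ≠ ⊥) (hbot : ∀ ν, bellman hM t t' o W ν ≠ ⊥) {z₀ : Code k₁ k₂}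
    (hz₀ : codePair z₀ ∈ M.U) (ρ : Measure (Law d)) [IsFiniteMeasure ρ] {ε : ℝ} (hε : 0 < ε) :
    ∃ ψ : Law d → Code k₁ k₂, Measurable ψ ∧ (∀ ν, codePair (ψ ν) ∈ M.U) ∧
      ∀ᵐ ν ∂ρ, bellman hM t t' o W ν < ⊤ → M.ValidCode t t' (ν, ψ ν) ∧
        stepCost hM t t' o W (ν, ψ ν) ≤ bellman hM t t' o W ν + ε := by
  classical
  obtain ⟨F, e, hF, he, hBF, hFe⟩ := exists_bellman_projection (o := o) hM htt' hW hWbot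
  obtain ⟨f, hf, hfB⟩ := exists_measurable_lt hF hBF hbot ρ hε
  have hpair : Measurable (codePair (k₁ := k₁) (k₂ := k₂)) := by unfold codePair; fun_prop
  have hef : Measurable fun ν => e (f ν) := he.comp hf
  -- Selected codes are valid only almost everywhere and where the value is finite; `z₀` keeps the
  -- default pair inside U for every law.
  refine ⟨fun ν => if codePair (e (f ν)) ∈ M.U then e (f ν) else z₀,
    Measurable.ite (hpair.comp hef hM.meas_U) hef measurable_const, fun ν => ?_, ?_⟩
  · dsimp only
    split_ifs with h
    · exact h
    · exact hz₀
  · filter_upwards [hfB] with ν h1 h2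
    obtain ⟨h3, h4⟩ := hFe ν (f ν) ((h1 h2).trans_le le_top)
    have h5 : codePair (e (f ν)) ∈ M.U := h3.1
    simp only [if_pos h5]
    exact ⟨h3, h4.trans (h1 h2).le⟩

end Model

end ObsControl

/-! ### One step along a controlled process. -/

namespace ObsControl

theorem lowerIntegrable_map_iff {S R : Type*} [MeasurableSpace S] [MeasurableSpace R]
    {κ : Measure S} {X : S → R} (hX : Measurable X) {f : R → EReal}
    (hf : AEMeasurable f (κ.map X)) :
    LowerIntegrable (κ.map X) f ↔ LowerIntegrable κ (fun x => f (X x)) := by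
  have h1 := hf.neg.ereal_toENNReal
  simp only [Pi.neg_apply] at h1
  have h2 := lintegral_map' h1 hX.aemeasurable
  constructor
  · intro h
    exact ⟨hf.comp_measurable hX, h2 ▸ h.neg_ne_top⟩
  · intro h
    exact ⟨hf, h2.symm ▸ h.neg_ne_top⟩

theorem extIntegral_map {S R : Type*} [MeasurableSpace S] [MeasurableSpace R]
    {κ : Measure S} {X : S → R} (hX : Measurable X) {f : R → EReal}
    (hf : AEMeasurable f (κ.map X)) :
    extIntegral (κ.map X) f = extIntegral κ (fun x => f (X x)) := by
  have h1 := hf.neg.ereal_toENNReal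
  simp only [Pi.neg_apply] at h1
  have h2 := lintegral_map' h1 hX.aemeasurable
  have h3 := lintegral_map' hf.ereal_toENNReal hX.aemeasurable
  unfold extIntegral
  rw [h2, h3]

namespace Model

variable {d m k₁ k₂ n : ℕ} {𝒴 G Ω : Type*}
  [MeasurableSpace 𝒴] [MeasurableSpace G] [MeasurableSpace Ω]
  {M : Model d m k₁ k₂ n 𝒴 G Ω}
  {ph : Phase} {s t t' t'' : ℝ} {μ : Law d} {u : Controlled d k₁ k₂ n Ω} {o : Option (Fin n)}
  {ψ : Law d → Code k₁ k₂} {W : Law d → EReal}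

/-- The precision and the state just before time `t'`, at which the observation `o` is made. -/
def endState (u : Controlled d k₁ k₂ n Ω) (o : Option (Fin n)) (t' : ℝ) (ω : Ω) : Vec k₂ × Law d :=
  (u.β t' ω, match o with
    | none => u.X t' ω
    | some j => u.Xm j ω)

theorem Step.mem_window_after (h : M.Step t t' o) {j : Fin n} :
    j ∈ M.window .after t t' ↔ o = some j := by
  rw [Model.mem_window, ← h.obs j]
  constructor
  · rintro ⟨h1 | ⟨h1, -⟩, h2⟩
    · exact le_antisymm h2 (h.gap j h1)
    · exact absurd h1 (by simp)
  · intro h1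
    exact ⟨Or.inl (h1 ▸ h.lt), h1.le⟩

theorem Step.sum_window (h : M.Step t t' o) (u : Controlled d k₁ k₂ n Ω) (ω : Ω) :
    ∑ j ∈ M.window .after t t', M.h (M.τ j) (u.Xm j ω) (u.β (M.τ j) ω)
      = M.obsCost o (endState u o t' ω) := by
  cases ho : o with
  | none =>
    have : M.window .after t t' = ∅ := by
      ext j
      rw [h.mem_window_after, ho]
      simp
    rw [this]
    rfl
  | some j =>
    have : M.window .after t t' = {j} := by
      ext i
      rw [h.mem_window_after, ho]
      simp [eq_comm]
    rw [this, Finset.sum_singleton]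
    simp only [obsCost, endState, (h.obs j).2 ho]

theorem Step.endState_extend (h : M.Step t t' o) (ω : Ω) :
    endState (M.extend ph s t t' o u ψ) o t' ω = M.codeEnd t t' (u.X t ω, ψ (u.X t ω)) := by
  have hnew : t' ∉ M.beforeObs ph s t := fun hc => (h.lt.trans_le (beforeObs_le hc)).false
  unfold endState codeEnd
  rw [extend_β_new hnew]
  cases ho : o with
  | none =>
    simp only
    rw [extend_X_end h.lt]
    rfl
  | some j =>
    have hj : t < M.τ j := by rw [(h.obs j).2 ho]; exact h.lt
    simp only
    rw [extend_Xm_gt hj]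

theorem Step.runCost_extend (h : M.Step t t' o) (ω : Ω) :
    M.runCost .after t t' (M.extend ph s t t' o u ψ) ω
      = M.pathCost t t' o (u.X t ω, ψ (u.X t ω)) := by
  unfold runCost pathCost
  rw [h.sum_window, h.endState_extend]
  congr 1
  refine extIntegral_congr_ae ?_
  filter_upwards [ae_ne_real _ t, ae_ne_real _ t', ae_restrict_mem measurableSet_Icc] with r h1 h2 h3
  have h4 := lt_of_le_of_ne h3.1 (Ne.symm h1)
  rw [extend_X_mid h4 (lt_of_le_of_ne h3.2 h2), extend_α_gt h4]

theorem Step.agreesUpTo_extend :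
    M.AgreesUpTo ph s t u (M.extend ph s t t' o u ψ) :=
  ⟨fun _ hr ω => extend_X_le hr.2 ω, fun _ hr ω => extend_α_lt hr.2 ω,
    fun _ hj ω => extend_Xm_le (window_le hj).2 ω,
    fun _ hj ω => extend_β_old (mem_beforeObs hj) ω⟩

theorem Step.measurable_endState (hM : M.Standing) (h : M.Step t t' o) (hst : s ≤ t)
    (ht'' : t' ≤ t'') (hu : M.Admissible ph s t'' μ u) :
    Measurable (endState u o t') ∧
      ∀ j, o = some j → Measurable[M.noiseBefore j] (endState u o t') := by
  have hsI : t' ∈ Set.Icc s t'' := ⟨hst.trans h.lt.le, ht''⟩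
  have key : ∀ j, o = some j → Measurable[M.noiseBefore j] (endState u o t') := by
    intro j ho
    have hj : M.τ j = t' := (h.obs j).2 ho
    have hw : j ∈ M.window ph s t'' := by
      rw [Model.mem_window, hj]
      exact ⟨Or.inl (hst.trans_lt h.lt), ht''⟩
    have h1 : Measurable[M.noiseBefore j] (u.β t') := by
      rw [← hj] at hsI ⊢
      exact (hu.β_predictable _ hsI).mono (hu.sigmaBefore_le_noise hM j) le_rfl
    have h2 : Measurable[M.noiseBefore j] (u.Xm j) :=
      (hu.Xm_adapted j hw).mono (hu.sigmaBefore_le_noise hM j) le_rfl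
    have h3 : endState u o t' = fun ω => (u.β t' ω, u.Xm j ω) := by rw [ho]; rfl
    rw [h3]
    exact h1.prodMk h2
  refine ⟨?_, key⟩
  cases ho : o with
  | none => exact (hu.measurable_β hM hsI).prodMk (hu.measurable_X hM hsI)
  | some j => rw [← ho]; exact (key j ho).mono (hM.noiseBefore_le j) le_rfl

theorem Step.ae_X_eq (h : M.Step t t' o) (hst : s ≤ t) (ht'' : t' ≤ t'')
    (hu : M.Admissible ph s t'' μ u) :
    ∀ᵐ ω ∂M.P, u.X t' ω = M.post o (endState u o t' ω) ω := by
  filter_upwards [hu.dynamics] with ω hω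
  cases ho : o with
  | none => rfl
  | some j =>
    have hj : M.τ j = t' := (h.obs j).2 ho
    have hw : j ∈ M.window ph s t'' := by
      rw [Model.mem_window, hj]
      exact ⟨Or.inl (hst.trans_lt h.lt), ht''⟩
    have h1 := hω.jump j hw
    simp only [hj] at h1
    rw [h1]
    simp only [post, endState, Y, hj]

theorem Step.map_X (hM : M.Standing) (h : M.Step t t' o) (hst : s ≤ t) (ht'' : t' ≤ t'')
    (hu : M.Admissible ph s t'' μ u) :
    M.P.map (u.X t') = (M.P.map (endState u o t')).bind (postKernel hM o) := by
  obtain ⟨h1, h2⟩ := h.measurable_endState hM hst ht'' hu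
  rw [← hM.map_post o h1 h2]
  exact Measure.map_congr (h.ae_X_eq hst ht'' hu)

/-- Conditioning on the past before an observation. -/
theorem Step.extIntegral_X (hM : M.Standing) (h : M.Step t t' o) (hst : s ≤ t) (ht'' : t' ≤ t'')
    (hu : M.Admissible ph s t'' μ u) (hW : InfProj W)
    (hL : LowerIntegrable M.P (fun ω => W (u.X t' ω))) :
    LowerIntegrable M.P (fun ω => extIntegral (postKernel hM o (endState u o t' ω)) W) ∧
      extIntegral M.P (fun ω => W (u.X t' ω))
        = extIntegral M.P (fun ω => extIntegral (postKernel hM o (endState u o t' ω)) W) := by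
  have := hM.prob
  have hX : Measurable (u.X t') := hu.measurable_X hM ⟨hst.trans h.lt.le, ht''⟩
  obtain ⟨hE, -⟩ := h.measurable_endState hM hst ht'' hu
  have hWX : AEMeasurable W (M.P.map (u.X t')) := hW.aemeasurable _
  have h1 := (lowerIntegrable_map_iff hX hWX).2 hL
  rw [h.map_X hM hst ht'' hu] at h1
  obtain ⟨h2, h3⟩ := h1.bind
  refine ⟨(lowerIntegrable_map_iff hE h2.aemeasurable).1 h2, ?_⟩
  rw [← extIntegral_map hX hWX, h.map_X hM hst ht'' hu, h3, extIntegral_map hE h2.aemeasurable]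

/-- If the conditional means are finite from above, W is finite from above almost surely under each
conditional law, hence under their mixture. A Borel version of W is used to disintegrate the
exceptional set. -/
theorem Step.ae_lt_top_of_postKernel (hM : M.Standing) (h : M.Step t t' o) (hst : s ≤ t)
    (ht'' : t' ≤ t'') (hu : M.Admissible ph s t'' μ u) (hW : InfProj W)
    (hlt : ∀ᵐ ω ∂M.P, extIntegral (postKernel hM o (endState u o t' ω)) W < ⊤) :
    ∀ᵐ ω ∂M.P, W (u.X t' ω) < ⊤ := by
  have := hM.prob
  have hX : Measurable (u.X t') := hu.measurable_X hM ⟨hst.trans h.lt.le, ht''⟩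
  obtain ⟨hE, -⟩ := h.measurable_endState hM hst ht'' hu
  have hWX : AEMeasurable W (M.P.map (u.X t')) := hW.aemeasurable _
  suffices hs : ∀ᵐ ν ∂(M.P.map (u.X t')), W ν < ⊤ from ae_of_ae_map hX.aemeasurable hs
  have hb := h.map_X hM hst ht'' hu
  set V' := hWX.mk W
  have hV' : Measurable V' := hWX.measurable_mk
  have hVW : ∀ᵐ ν ∂(M.P.map (u.X t')), W ν = V' ν := hWX.ae_eq_mk
  have hVW' := hVW
  rw [hb] at hVW'
  have h1 : ∀ᵐ ω ∂M.P, ∀ᵐ ν ∂(postKernel hM o (endState u o t' ω)), W ν = V' ν :=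
    ae_of_ae_map hE.aemeasurable (Measure.ae_ae_of_ae_bind (postKernel hM o).aemeasurable hVW')
  have h2 : ∀ᵐ ω ∂M.P, postKernel hM o (endState u o t' ω) (V' ⁻¹' {⊤}) = 0 := by
    filter_upwards [h1, hlt] with ω h3 h4
    have h5 := ae_lt_top_of_pos_ne_top (hW.aemeasurable (postKernel hM o (endState u o t' ω)))
      fun hc => h4.ne (extIntegral_of_pos_eq_top hc)
    refine measure_eq_zero_iff_ae_notMem.2 ?_
    filter_upwards [h3, h5] with ν h6 h7 h8
    rw [h6, h8] at h7
    exact h7.false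
  have h3 : M.P.map (u.X t') (V' ⁻¹' {⊤}) = 0 := by
    rw [hb, Measure.bind_apply (hV' (measurableSet_singleton ⊤)) (postKernel hM o).aemeasurable,
      lintegral_map (f := fun q => postKernel hM o q (V' ⁻¹' {⊤})) ((Measure.measurable_coe
        (hV' (measurableSet_singleton ⊤))).comp (postKernel hM o).measurable) hE,
      lintegral_congr_ae h2]
    simp
  filter_upwards [hVW, measure_eq_zero_iff_ae_notMem.1 h3] with ν h4 h5
  rw [h4, lt_top_iff_ne_top]
  exact h5

section Lower

/-- The trajectory may jump at t', so the segment takes the left limit there; its equation at t' is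
the limit of the equations at earlier times. -/
theorem IsTrajectory.segment (hM : M.Standing) (h : M.Step t t' o) (hst : s ≤ t) (ht'' : t' ≤ t'')
    {a a' : ℝ → Vec k₁} {x x' : ℝ → Law d} {xm : Fin n → Law d}
    {β : Fin n → Vec k₂} {y : Fin n → 𝒴} (htraj : M.IsTrajectory ph s t'' μ a x xm β y)
    (ha' : Measurable a') (haa' : ∀ r ∈ Set.Ioc t t', a' r = a r)
    (hx' : Measurable x') (hxx' : ∀ r ∈ Set.Ico t t', x' r = x r)
    (hnone : o = none → x' t' = x t') (hsome : ∀ j, o = some j → x' t' = xm j) :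
    M.Segment t t' (x t) a' x' := by
  have hae : ∀ S ⊆ Set.Icc t t', MeasurableSet S → ∀ᵐ r ∂(volume.restrict S),
      a' r = a r ∧ x' r = x r := by
    intro S hS hSm
    filter_upwards [ae_ne_real S t', ae_ne_real S t, ae_restrict_mem hSm] with r hr hrt hrS
    have hr' := hS hrS
    exact ⟨haa' r ⟨lt_of_le_of_ne hr'.1 (Ne.symm hrt), hr'.2⟩,
      hxx' r ⟨hr'.1, lt_of_le_of_ne hr'.2 hr⟩⟩
  have hint : ∀ φ : Vec d → ℝ, IsTest φ →
      ∫⁻ r in Set.Icc t t', ∫⁻ z, ‖M.gen (a' r) φ z‖ₑ ∂(x' r : Measure (Vec d)) < ∞ := by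
    intro φ hφ
    rw [lintegral_congr_ae (g := fun r => ∫⁻ z, ‖M.gen (a r) φ z‖ₑ ∂(x r : Measure (Vec d)))]
    · exact (lintegral_mono_set (Set.Icc_subset_Icc hst ht'')).trans_lt
        (htraj.integrable φ hφ.contDiff hφ.compact)
    · filter_upwards [hae _ subset_rfl measurableSet_Icc] with r hr
      rw [hr.1, hr.2]
  have hFP : ∀ r ∈ Set.Icc t t', (r = t' → o = none) → ∀ φ : Vec d → ℝ, IsTest φ →
      ∫ z, φ z ∂(x r : Measure (Vec d)) = ∫ z, φ z ∂(x t : Measure (Vec d))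
        + ∫ ρ in t..r, ∫ z, M.gen (a' ρ) φ z ∂(x' ρ : Measure (Vec d)) := by
    intro r hr hrt φ hφ
    rw [htraj.fokker_planck t r hst hr.1 (hr.2.trans ht'') ?_ φ hφ.contDiff hφ.compact]
    · congr 1
      refine intervalIntegral.integral_congr_ae_restrict ?_
      have hsub : Set.uIoc t r ⊆ Set.Icc t t' := by
        rw [Set.uIoc_of_le hr.1]
        exact fun ρ hρ => ⟨hρ.1.le, hρ.2.trans hr.2⟩
      filter_upwards [hae _ hsub measurableSet_uIoc] with ρ hρ
      rw [hρ.1, hρ.2]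
    · rintro j - ⟨h1, h2⟩
      have h3 := h.gap j h1
      have h4 : r = t' := le_antisymm hr.2 (h3.trans h2)
      have h5 : M.τ j = t' := le_antisymm (h2.trans hr.2) h3
      have h6 := (h.obs j).1 h5
      rw [hrt h4] at h6
      simp at h6
  refine ⟨hxx' t ⟨le_rfl, h.lt⟩, hint, fun r hr φ hφ => ?_⟩
  rcases eq_or_lt_of_le hr.2 with rfl | hlt
  · cases ho : o with
    | none =>
      rw [hnone ho]
      exact hFP r hr (fun _ => ho) φ hφ
    | some j =>
      rw [hsome j ho]
      have hj : M.τ j = r := (h.obs j).2 ho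
      have hw : j ∈ M.window ph s t'' := by
        rw [Model.mem_window, hj]
        exact ⟨Or.inl (hst.trans_lt h.lt), ht''⟩
      have h1 := htraj.left_limit j hw (by rw [hj]; exact hst.trans_lt h.lt)
      rw [hj] at h1
      have h2 := ((continuous_integral_test hφ).tendsto (xm j)).comp h1
      have h3 := intervalIntegral.continuousOn_primitive_interval (a := t) (b := r) (μ := volume)
        (f := fun ρ => ∫ z, M.gen (a' ρ) φ z ∂(x' ρ : Measure (Vec d)))
        (by rw [Set.uIcc_of_le h.lt.le]; exact integrableOn_gen_path hM ha' hx' hφ (hint φ hφ))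
      rw [Set.uIcc_of_le h.lt.le] at h3
      have h4 : 𝓝[<] r ≤ 𝓝[Set.Icc t r] r := by
        rw [← nhdsWithin_Ioo_eq_nhdsLT h.lt]
        exact nhdsWithin_mono _ Set.Ioo_subset_Icc_self
      have h5 := (((h3 r hr).tendsto.mono_left h4).const_add
        (∫ z, φ z ∂(x t : Measure (Vec d))))
      refine tendsto_nhds_unique h2 (h5.congr' ?_)
      filter_upwards [Ioo_mem_nhdsLT h.lt] with ρ hρ
      exact (hFP ρ ⟨hρ.1.le, hρ.2.le⟩ (fun hc => absurd hc hρ.2.ne) φ hφ).symm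
  · rw [hxx' r ⟨hr.1, hlt⟩]
    exact hFP r hr (fun hc => absurd hc hlt.ne) φ hφ

/-- Along every controlled process, the one-step operator bounds the cost of the step from below. -/
theorem Step.bellman_le (hM : M.Standing) (h : M.Step t t' o) (hst : s ≤ t) (ht'' : t' ≤ t'')
    (hu : M.Admissible ph s t'' μ u) (W : Law d → EReal) :
    ∀ᵐ ω ∂M.P, bellman hM t t' o W (u.X t ω) ≤ M.runCost .after t t' u ω
      + extIntegral (postKernel hM o (endState u o t' ω)) W := by
  classical
  have hst'' : s ≤ t'' := hst.trans (h.lt.le.trans ht'')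
  filter_upwards [hu.dynamics] with ω hω
  obtain ⟨a₀, ha₀, ha₀'⟩ := hu.α_adapted.exists_path hst'' (hu.sigmaAt_le hM t'') ω
  obtain ⟨x₀, hx₀, hx₀'⟩ := hu.X_adapted.exists_path hst'' (hu.sigmaAt_le hM t'') ω
  have hI : Set.Icc t t' ⊆ Set.Icc s t'' := Set.Icc_subset_Icc hst ht''
  -- On (t, t'] the precision is constant and equal to its value at t'. At t itself it may be the
  -- one used for an observation at t, so t is excluded; the value of α at t' is a compatible
  -- default.
  let a : ℝ → Vec k₁ := fun r => if r ∈ Set.Ioc t t' then a₀ r else u.α t' ω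
  let x : ℝ → Law d := fun r => if r ∈ Set.Iio t' then x₀ r else (endState u o t' ω).2
  have ha : Measurable a := Measurable.ite measurableSet_Ioc ha₀ measurable_const
  have hx : Measurable x := Measurable.ite measurableSet_Iio hx₀ measurable_const
  have haα : ∀ r ∈ Set.Ioc t t', a r = u.α r ω := fun r hr => by
    simp only [a, if_pos hr]
    exact ha₀' r (hI ⟨hr.1.le, hr.2⟩)
  have hxX : ∀ r ∈ Set.Ico t t', x r = u.X r ω := fun r hr => by
    simp only [x, if_pos (Set.mem_Iio.2 hr.2)]
    exact hx₀' r (hI ⟨hr.1, hr.2.le⟩)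
  have hxe : x t' = (endState u o t' ω).2 := if_neg (lt_irrefl t')
  have ht'I : t' ∈ Set.Icc s t'' := hI ⟨h.lt.le, le_rfl⟩
  have hU : ∀ r, (a r, u.β t' ω) ∈ M.U := by
    intro r
    by_cases hr : r ∈ Set.Ioc t t'
    · have h1 : u.β r = u.β t' := hu.β_piecewise r t' (hst.trans hr.1.le) hr.2 ht''
        fun j _ hc => (hc.2.trans_le (h.gap j (hr.1.trans_le hc.1))).false
      rw [haα r hr, ← h1]
      exact hu.mem_U r (hI ⟨hr.1.le, hr.2⟩) ω
    · simp only [a, if_neg hr]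
      exact hu.mem_U t' ht'I ω
  have hseg : M.Segment t t' (u.X t ω) a x :=
    hω.segment hM h hst ht'' ha haα hx hxX (fun ho => by rw [hxe, ho]; rfl)
      (fun j ho => by rw [hxe, ho]; rfl)
  obtain ⟨z, hz, hzβ, hzα, hzX⟩ := exists_validCode h.lt.le ha hx hU hseg
  refine (iInf₂_le z hz).trans (le_of_eq ?_)
  have hend : M.codeEnd t t' (u.X t ω, z) = endState u o t' ω := by
    unfold codeEnd
    rw [hzX t' ⟨h.lt.le, le_rfl⟩, hxe]
    exact Prod.ext hzβ rfl
  unfold stepCost pathCost runCost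
  rw [hend, h.sum_window]
  congr 2
  refine extIntegral_congr_ae ?_
  filter_upwards [ae_ne_real _ t, ae_ne_real _ t', ae_restrict_mem measurableSet_Icc, hzα]
    with r h1 h2 h3 h4
  rw [h4, hzX r h3, haα r ⟨lt_of_le_of_ne h3.1 (Ne.symm h1), h3.2⟩,
    hxX r ⟨h3.1, lt_of_le_of_ne h3.2 h2⟩]

end Lower

end Model

end ObsControl

namespace ObsControl

namespace Model

variable {d m k₁ k₂ n : ℕ} {𝒴 G Ω : Type*}
  [MeasurableSpace 𝒴] [MeasurableSpace G] [MeasurableSpace Ω]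
  {M : Model d m k₁ k₂ n 𝒴 G Ω}
  {ph : Phase} {s t t' : ℝ} {μ : Law d} {u : Controlled d k₁ k₂ n Ω} {o : Option (Fin n)}
  {ψ : Law d → Code k₁ k₂}

/-! ### Controls on degenerate time intervals. -/

section PointControl

variable (M) in
/-- A control on a degenerate time interval, at which the observation `o` is made. -/
def pointControl (o : Option (Fin n)) (c : Vec k₁ × Vec k₂) (ν : Law d) :
    Controlled d k₁ k₂ n Ω where
  α _ _ := c.1
  β _ _ := c.2
  X _ ω := M.post o (c.2, ν) ω
  Xm _ _ := ν

/-- Serves twice: with no observation, it is the empty past to which a continuation from a given law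
is attached; with one, it realizes a deterministic precision in the problem started just before that
observation. -/
theorem admissible_pointControl (hM : M.Standing) {c : Vec k₁ × Vec k₂} (hc : c ∈ M.U) (ν : Law d)
    (ho : ∀ j, j ∈ M.window ph t t ↔ o = some j) :
    M.Admissible ph t t ν (M.pointControl o c ν) := by
  have hτ : ∀ j ∈ M.window ph t t, M.τ j = t := fun j hj =>
    le_antisymm (window_le hj).2 (window_le hj).1
  refine ⟨fun r _ => measurable_const, fun _ _ _ _ _ _ => rfl, fun _ _ => measurable_const,
    fun _ _ _ => hc, fun r hr => ?_, fun _ _ => measurable_const, ?_⟩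
  · suffices hs : Measurable[M.sigmaAt ph t t (M.pointControl o c ν) r] (M.post o (c.2, ν)) from
      hs.comp (@measurable_snd _ _ _ (M.sigmaAt ph t t (M.pointControl o c ν) r))
    cases ho' : o with
    | none => exact measurable_const
    | some j =>
      have hj := (ho j).2 ho'
      have hY := measurable_Y_sigmaAt (u := M.pointControl o c ν) hj
        (show M.τ j ≤ r by rw [hτ j hj]; exact hr.1)
      rw [ho'] at hY
      exact hM.measurable_update.comp
        (f := fun ω => (c.2, ν, M.Y (M.pointControl (some j) c ν) j ω))
        (measurable_const.prodMk (measurable_const.prodMk hY))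
  · refine ae_of_all _ fun ω => ⟨fun h => ?_, fun j hj _ => rfl, fun φ _ _ => ?_,
      fun r₁ r₂ h1 h2 h3 _ φ _ _ => ?_, fun j hj hlt => ?_, fun j hj => ?_⟩
    · cases ho' : o with
      | none => rfl
      | some j => exact absurd (hτ j ((ho j).2 ho')) (h j ((ho j).2 ho'))
    · rw [Set.Icc_self, Measure.restrict_singleton, Real.volume_singleton, zero_smul,
        lintegral_zero_measure]
      exact ENNReal.zero_lt_top
    · obtain rfl : r₁ = r₂ := le_antisymm h2 (h3.trans h1)
      simp
    · exact absurd (hτ j hj) hlt.ne'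
    · rw [(ho j).1 hj]
      rfl

theorem window_after_self (j : Fin n) : j ∈ M.window .after t t ↔ none = some j := by
  rw [mem_window]
  constructor
  · rintro ⟨h1 | ⟨h1, -⟩, h2⟩
    · exact absurd h2 (not_le.2 h1)
    · exact absurd h1 (by simp)
  · simp

theorem runCost_after_self (u : Controlled d k₁ k₂ n Ω) (ω : Ω) :
    M.runCost .after t t u ω = 0 := by
  have h1 : M.window .after t t = ∅ := by
    ext j
    rw [window_after_self]
    simp
  unfold runCost
  rw [h1, Set.Icc_self, Measure.restrict_singleton, Real.volume_singleton, zero_smul]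
  simp [extIntegral]

end PointControl

/-! ### Backward induction over the observation times. -/

section Induction

/-- The regularity and the approximation properties of the value function at time `t` which make
the dynamic programming principle work. -/
structure Programmable (M : Model d m k₁ k₂ n 𝒴 G Ω) (t : ℝ) : Prop where
  infProj : InfProj (M.V t)
  continuation : ∀ ph s μ u, 0 ≤ s → s ≤ t → (M.Splittable ph s t ∨ t = M.T) →
    u ∈ M.controls ph s t μ → (∀ᵐ ω ∂M.P, M.V t (u.X t ω) < ⊤) →
    LowerIntegrable M.P (fun ω => M.V t (u.X t ω)) ∧ ∀ ε : ℝ, 0 < ε →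
      ∃ u' ∈ M.controls ph s M.T μ, M.AgreesUpTo ph s t u u' ∧
        extIntegral M.P (M.runCost .after t M.T u') + extIntegral M.P (fun ω => M.g (u'.X M.T ω))
          ≤ extIntegral M.P (fun ω => M.V t (u.X t ω)) + ε
  lower : ∀ ph s μ u, 0 ≤ s → s ≤ t → u ∈ M.controls ph s M.T μ →
    extIntegral M.P (fun ω => M.V t (u.X t ω))
      ≤ extIntegral M.P (M.runCost .after t M.T u) + extIntegral M.P (fun ω => M.g (u.X M.T ω))

theorem V_terminal : M.V M.T = M.g := by
  funext ν
  exact if_neg (lt_irrefl _)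

theorem programmable_terminal (hM : M.Standing) (hW : M.WellDefined) : Programmable M M.T := by
  have hT : 0 ≤ M.T := hM.T_pos.le
  have := hM.prob
  have h0 : ∀ u : Controlled d k₁ k₂ n Ω, extIntegral M.P (M.runCost .after M.T M.T u) = 0 :=
    fun u => by
      have : M.runCost .after M.T M.T u = fun _ => 0 := funext fun ω => runCost_after_self u ω
      rw [this, extIntegral_zero]
  refine ⟨?_, fun ph s μ u hs hsT _ hu _ => ⟨?_, fun ε hε => ⟨u, hu, AgreesUpTo.refl, ?_⟩⟩,
    fun ph s μ u hs hsT hu => ?_⟩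
  · rw [V_terminal]
    exact ObsControl.Measurable.infProj hM.meas_g
  · rw [V_terminal]
    exact Admissible.lowerIntegrable_terminal hM hu
      (hW.negCost_lt ph s M.T μ hs hsT le_rfl u hu) hsT
  · rw [V_terminal, h0, zero_add]
    exact le_add_of_nonneg_right (by exact_mod_cast hε.le)
  · rw [V_terminal, h0, zero_add]

/-- Steps end at an observation or at T, so the product form of U is never needed at the later
pasting times, only possibly at the first. -/
theorem Step.splittable (h : M.Step t t' o) (hst : s ≤ t)
    (ht' : (∃ j, o = some j) ∨ t' = M.T) : M.Splittable ph s t' ∨ t' = M.T := by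
  rcases ht' with ⟨j, hj⟩ | ht'
  · exact Or.inl (Or.inr (Or.inl ⟨j, (h.mem_window hst).2 (Or.inr hj), (h.obs j).2 hj⟩))
  · exact Or.inr ht'

/-- The codes ψ continue the process to t', and the induction hypothesis continues it from there
with the whole history kept. A finite step cost makes the value at t' finite almost surely, as that
hypothesis requires; lower integrability of the step comes from well-posedness for the pasted
control. -/
theorem Step.exists_continuation (hM : M.Standing) (hW : M.WellDefined) (h : M.Step t t' o)
    (ht' : (∃ j, o = some j) ∨ t' = M.T) (hP : Programmable M t') (hs : 0 ≤ s) (hst : s ≤ t)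
    (hsp : M.Splittable ph s t) (hu : u ∈ M.controls ph s t μ) (hψ : Measurable ψ)
    (hψU : ∀ ν, codePair (ψ ν) ∈ M.U)
    (hvalid : ∀ᵐ ω ∂M.P, M.ValidCode t t' (u.X t ω, ψ (u.X t ω)))
    (hlt : ∀ᵐ ω ∂M.P, stepCost hM t t' o (M.V t') (u.X t ω, ψ (u.X t ω)) < ⊤) :
    LowerIntegrable M.P (fun ω => stepCost hM t t' o (M.V t') (u.X t ω, ψ (u.X t ω))) ∧
    ∀ ε : ℝ, 0 < ε → ∃ u' ∈ M.controls ph s M.T μ, M.AgreesUpTo ph s t u u' ∧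
      extIntegral M.P (M.runCost .after t M.T u') + extIntegral M.P (fun ω => M.g (u'.X M.T ω))
        ≤ extIntegral M.P (fun ω => stepCost hM t t' o (M.V t') (u.X t ω, ψ (u.X t ω))) + ε := by
  have := hM.prob
  have hst' : s ≤ t' := hst.trans h.lt.le
  set u₁ := M.extend ph s t t' o u ψ with hu₁def
  have hu₁ : M.Admissible ph s t' μ u₁ := h.extend_admissible hM hst hsp hu hψ hψU hvalid
  have hneg₁ := hW.negCost_lt ph s t' μ hs hst' h.le_T u₁ hu₁
  have hL₁ : LowerIntegrable M.P (M.runCost .after t t' u₁) :=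
    hu₁.lowerIntegrable_runCost hM hneg₁ hst' (Set.Icc_subset_Icc_left hst) (window_mono hst le_rfl)
  have hstep : ∀ ω, stepCost hM t t' o (M.V t') (u.X t ω, ψ (u.X t ω))
      = M.runCost .after t t' u₁ ω + extIntegral (postKernel hM o (endState u₁ o t' ω)) (M.V t') := by
    intro ω
    rw [h.runCost_extend, h.endState_extend]
    rfl
  simp only [hstep] at hlt ⊢
  have hlt' : ∀ᵐ ω ∂M.P, M.V t' (u₁.X t' ω) < ⊤ := by
    refine h.ae_lt_top_of_postKernel hM hst le_rfl hu₁ hP.infProj ?_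
    filter_upwards [hlt, hL₁.ae_ne_bot] with ω h1 h2
    rw [lt_top_iff_ne_top] at h1 ⊢
    intro hc
    rw [hc, EReal.add_top_of_ne_bot h2] at h1
    exact h1 rfl
  obtain ⟨hLV, hcont⟩ := hP.continuation ph s μ u₁ hs hst' (h.splittable hst ht') hu₁ hlt'
  obtain ⟨hLK, hEK⟩ := h.extIntegral_X hM hst le_rfl hu₁ hP.infProj hLV
  refine ⟨hL₁.add hLK, fun ε hε => ?_⟩
  obtain ⟨u', hu', hag, hle⟩ := hcont ε hε
  refine ⟨u', hu', Step.agreesUpTo_extend.trans hag h.lt.le, ?_⟩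
  have hsT : s ≤ M.T := hst'.trans h.le_T
  have hu'' : M.Admissible ph s M.T μ u' := hu'
  have hneg' := hW.negCost_lt ph s M.T μ hs hsT le_rfl u' hu'
  have hsplit := hu''.runCost_split hM hneg' hst h.lt.le h.le_T
  have heq : ∀ ω, M.runCost .after t t' u' ω = M.runCost .after t t' u₁ ω :=
    hag.runCost_eq (Set.Icc_subset_Icc_left hst) (window_mono hst le_rfl)
  simp only [heq] at hsplit
  have hL₂ : LowerIntegrable M.P (M.runCost .after t' M.T u') :=
    hu''.lowerIntegrable_runCost hM hneg' hsT (Set.Icc_subset_Icc_left hst')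
      (window_mono hst' le_rfl)
  rw [extIntegral_congr_ae hsplit, extIntegral_add hL₁ hL₂, extIntegral_add hL₁ hLK, ← hEK,
    add_assoc, add_assoc]
  gcongr

theorem J_eq (hM : M.Standing) (hW : M.WellDefined) (hs : 0 ≤ s) (hsT : s ≤ M.T)
    (hu : u ∈ M.controls ph s M.T μ) : M.J ph s u
      = extIntegral M.P (M.runCost ph s M.T u) + extIntegral M.P (fun ω => M.g (u.X M.T ω)) := by
  have hneg := hW.negCost_lt ph s M.T μ hs hsT le_rfl u hu
  exact extIntegral_add (Admissible.lowerIntegrable_runCost hM hu hneg hsT subset_rfl subset_rfl)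
    (Admissible.lowerIntegrable_terminal hM hu hneg hsT)

/-- A single deterministic code continues the degenerate control at t, so no selection is needed for
this inequality. -/
theorem Step.V_le_stepCost (hM : M.Standing) (hW : M.WellDefined) (h : M.Step t t' o)
    (ht' : (∃ j, o = some j) ∨ t' = M.T) (hP : Programmable M t') (ν : Law d) {z : Code k₁ k₂}
    (hz : M.ValidCode t t' (ν, z)) : M.V t ν ≤ stepCost hM t t' o (M.V t') (ν, z) := by
  have := hM.prob
  have htT : t < M.T := h.lt.trans_le h.le_T
  rcases eq_or_ne (stepCost hM t t' o (M.V t') (ν, z)) ⊤ with htop | htop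
  · rw [htop]; exact le_top
  have hu : M.Admissible .after t t ν (M.pointControl none (codePair z) ν) :=
    admissible_pointControl hM hz.1 ν window_after_self
  obtain ⟨-, hex⟩ := h.exists_continuation hM hW ht' hP h.nonneg le_rfl (Or.inr (Or.inr rfl)) hu
    (ψ := fun _ => z) measurable_const (fun _ => hz.1) (ae_of_all _ fun _ => hz)
    (ae_of_all _ fun _ => lt_top_iff_ne_top.2 htop)
  refine le_of_forall_pos_le_add_real fun ε hε => ?_
  obtain ⟨u', hu', -, hle⟩ := hex ε hε
  have h1 : M.V t ν ≤ M.J .after t u' := by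
    unfold V value
    rw [if_pos htT]
    exact iInf₂_le u' hu'
  refine h1.trans ?_
  rw [J_eq hM hW h.nonneg htT.le hu']
  refine hle.trans (le_of_eq ?_)
  have h2 : ∀ ω, (M.pointControl none (codePair z) ν).X t ω = ν := fun _ => rfl
  simp only [h2, extIntegral_const]

/-- The pathwise one-step bound is integrated, independence replaces the kernel mean by the value at
t', and the induction hypothesis bounds that value by the remaining cost. If the value at t' is
infinite with positive probability, so is the remaining cost. -/
theorem Step.bellman_lower (hM : M.Standing) (hW : M.WellDefined) (h : M.Step t t' o)
    (ht' : (∃ j, o = some j) ∨ t' = M.T) (hP : Programmable M t') (hs : 0 ≤ s) (hst : s ≤ t)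
    (hu : u ∈ M.controls ph s M.T μ) :
    extIntegral M.P (fun ω => bellman hM t t' o (M.V t') (u.X t ω))
      ≤ extIntegral M.P (M.runCost .after t M.T u)
        + extIntegral M.P (fun ω => M.g (u.X M.T ω)) := by
  have := hM.prob
  have hst' : s ≤ t' := hst.trans h.lt.le
  have hsT : s ≤ M.T := hst'.trans h.le_T
  have hu' : M.Admissible ph s M.T μ u := hu
  have hneg := hW.negCost_lt ph s M.T μ hs hsT le_rfl u hu
  have hL₁ : LowerIntegrable M.P (M.runCost .after t t' u) :=
    hu'.lowerIntegrable_runCost hM hneg hsT (Set.Icc_subset_Icc hst h.le_T) (window_mono hst h.le_T)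
  have hL₂ : LowerIntegrable M.P (M.runCost .after t' M.T u) :=
    hu'.lowerIntegrable_runCost hM hneg hsT (Set.Icc_subset_Icc_left hst')
      (window_mono hst' le_rfl)
  have hlow := hP.lower ph s μ u hs hst' hu
  rw [extIntegral_congr_ae (hu'.runCost_split hM hneg hst h.lt.le h.le_T),
    extIntegral_add hL₁ hL₂, add_assoc]
  by_cases hlt : ∀ᵐ ω ∂M.P, M.V t' (u.X t' ω) < ⊤
  · obtain ⟨hLV, -⟩ := hP.continuation ph s μ u hs hst' (h.splittable hst ht')
      (hu'.restrict hst' h.le_T) hlt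
    obtain ⟨hLK, hEK⟩ := h.extIntegral_X hM hst h.le_T hu' hP.infProj hLV
    refine (extIntegral_mono_ae (h.bellman_le hM hst h.le_T hu' _)).trans ?_
    rw [extIntegral_add hL₁ hLK, ← hEK]
    gcongr
  · have hm : AEMeasurable (fun ω => M.V t' (u.X t' ω)) M.P :=
      (hP.infProj.aemeasurable (M.P.map (u.X t'))).comp_measurable
        (hu'.measurable_X hM ⟨hst', h.le_T⟩)
    rw [extIntegral_eq_top_of_not_ae hm hlt, top_le_iff] at hlow
    rw [hlow, EReal.add_top_of_ne_bot hL₁.extIntegral_ne_bot]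
    exact le_top

theorem Admissible.ae_start (hu : M.Admissible .after s t μ u) : ∀ᵐ ω ∂M.P, u.X s ω = μ := by
  filter_upwards [hu.dynamics] with ω hω
  refine hω.start fun j hj => ?_
  rw [mem_window] at hj
  rcases hj.1 with h | ⟨h, -⟩
  · exact h.ne'
  · exact absurd h (by simp)

/-- The Bellman equation over one step. -/
theorem Step.V_eq_bellman (hM : M.Standing) (hW : M.WellDefined) (h : M.Step t t' o)
    (ht' : (∃ j, o = some j) ∨ t' = M.T) (hP : Programmable M t') :
    M.V t = bellman hM t t' o (M.V t') := by
  have := hM.prob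
  have htT : t < M.T := h.lt.trans_le h.le_T
  funext ν
  refine le_antisymm (le_iInf₂ fun z hz => h.V_le_stepCost hM hW ht' hP ν hz) ?_
  unfold V value
  rw [if_pos htT]
  refine le_iInf₂ fun u hu => ?_
  rw [J_eq hM hW h.nonneg htT.le hu]
  refine le_trans (le_of_eq ?_) (h.bellman_lower hM hW ht' hP h.nonneg le_rfl hu)
  have h1 : ∀ᵐ ω ∂M.P, bellman hM t t' o (M.V t') (u.X t ω) = bellman hM t t' o (M.V t') ν := by
    filter_upwards [Admissible.ae_start hu] with ω hω
    rw [hω]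
  rw [extIntegral_congr_ae h1, extIntegral_const]
  rfl

/-- Once the value at t is identified with `bellman`, it inherits the form of an infimal projection.
Selecting codes under the law of the current state loses ε/2, and continuing from t' loses another
ε/2. -/
theorem Step.programmable (hM : M.Standing) (hW : M.WellDefined) (h : M.Step t t' o)
    (ht' : (∃ j, o = some j) ∨ t' = M.T) (hP : Programmable M t') : Programmable M t := by
  have := hM.prob
  have htT : t < M.T := h.lt.trans_le h.le_T
  have hV := h.V_eq_bellman hM hW ht' hP
  have hV'bot : ∀ ν, M.V t' ν ≠ ⊥ := fun ν => hW.V_ne_bot t' ν (h.nonneg.trans h.lt.le) h.le_T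
  have hVbot : ∀ ν, M.V t ν ≠ ⊥ := fun ν => hW.V_ne_bot t ν h.nonneg htT.le
  have hinf : InfProj (M.V t) := by
    rw [hV]
    exact infProj_bellman hM h.lt hP.infProj hV'bot
  refine ⟨hinf, fun ph s μ u hs hst hsp hu hlt => ?_, fun ph s μ u hs hst hu => ?_⟩
  · have hsp' : M.Splittable ph s t := hsp.resolve_right htT.ne
    have hu' : M.Admissible ph s t μ u := hu
    have hX : Measurable (u.X t) := hu'.measurable_X hM ⟨hst, le_rfl⟩
    have hVX : AEMeasurable (fun ω => M.V t (u.X t ω)) M.P :=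
      (hinf.aemeasurable (M.P.map (u.X t))).comp_measurable hX
    obtain ⟨ω₀⟩ : Nonempty Ω := Measure.nonempty_of_neZero M.P
    -- Any value taken by u provides an element of U, which is not assumed nonempty.
    let z₀ : Code k₁ k₂ := (fun _ => 0, fun _ => 0, u.α t ω₀, u.β t ω₀)
    have hz₀ : codePair z₀ ∈ M.U := hu'.mem_U t ⟨hst, le_rfl⟩ ω₀
    have hsel : ∀ ε : ℝ, 0 < ε → ∃ ψ : Law d → Code k₁ k₂, Measurable ψ ∧
        (∀ ν, codePair (ψ ν) ∈ M.U) ∧ (∀ᵐ ω ∂M.P, M.ValidCode t t' (u.X t ω, ψ (u.X t ω))) ∧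
        (∀ᵐ ω ∂M.P, stepCost hM t t' o (M.V t') (u.X t ω, ψ (u.X t ω))
          ≤ M.V t (u.X t ω) + ε) ∧
        ∀ᵐ ω ∂M.P, stepCost hM t t' o (M.V t') (u.X t ω, ψ (u.X t ω)) < ⊤ := by
      intro ε hε
      obtain ⟨ψ, hψ, hψU, hψ'⟩ := exists_bellman_selection (o := o) hM h.lt hP.infProj hV'bot
        (by rw [← hV]; exact hVbot) hz₀ (M.P.map (u.X t)) hε
      have hae := ae_of_ae_map hX.aemeasurable hψ'
      rw [← hV] at hae
      refine ⟨ψ, hψ, hψU, ?_, ?_, ?_⟩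
      · filter_upwards [hae, hlt] with ω h1 h2 using (h1 h2).1
      · filter_upwards [hae, hlt] with ω h1 h2 using (h1 h2).2
      · filter_upwards [hae, hlt] with ω h1 h2
        refine (h1 h2).2.trans_lt ?_
        exact EReal.add_lt_top h2.ne (EReal.coe_ne_top ε)
    -- The value exceeds the step cost of a 1-optimal pasted control minus 1, and the negative part
    -- of that step cost is already known to be integrable.
    have hLV : LowerIntegrable M.P (fun ω => M.V t (u.X t ω)) := by
      obtain ⟨ψ, hψ, hψU, hv, hle, hst⟩ := hsel 1 one_pos
      obtain ⟨hL, -⟩ := h.exists_continuation hM hW ht' hP hs ‹s ≤ t› hsp' hu hψ hψU hv hst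
      refine ⟨hVX, ?_⟩
      have h1 : ∫⁻ ω, (-M.V t (u.X t ω)).toENNReal ∂M.P ≤ ∫⁻ ω,
          (-stepCost hM t t' o (M.V t') (u.X t ω, ψ (u.X t ω))).toENNReal + 1 ∂M.P := by
        refine lintegral_mono_ae ?_
        filter_upwards [hle] with ω h2
        have h3 : -M.V t (u.X t ω)
            ≤ -stepCost hM t t' o (M.V t') (u.X t ω, ψ (u.X t ω)) + (1 : ℝ) := by
          rw [EReal.neg_le, EReal.neg_add (Or.inr (EReal.coe_ne_top 1)) (Or.inr (EReal.coe_ne_bot 1)), neg_neg]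
          exact EReal.sub_le_of_le_add h2
        refine (EReal.toENNReal_le_toENNReal h3).trans (EReal.toENNReal_add_le.trans ?_)
        rw [EReal.toENNReal_of_ne_top (EReal.coe_ne_top 1), EReal.toReal_coe, ENNReal.ofReal_one]
      rw [lintegral_add_right _ measurable_const] at h1
      exact ne_top_of_le_ne_top (ENNReal.add_ne_top.2 ⟨hL.neg_ne_top, by simp⟩) h1
    refine ⟨hLV, fun ε hε => ?_⟩
    obtain ⟨ψ, hψ, hψU, hv, hle, hlt'⟩ := hsel (ε / 2) (half_pos hε)
    obtain ⟨-, hex⟩ := h.exists_continuation hM hW ht' hP hs hst hsp' hu hψ hψU hv hlt'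
    obtain ⟨u', hu'T, hag, hcost⟩ := hex (ε / 2) (half_pos hε)
    refine ⟨u', hu'T, hag, hcost.trans ?_⟩
    have h1 := (extIntegral_mono_ae hle).trans (extIntegral_add_real_le hVX (ε / 2))
    calc _ ≤ extIntegral M.P (fun ω => M.V t (u.X t ω)) + ((ε / 2 : ℝ) : EReal)
          + ((ε / 2 : ℝ) : EReal) := by gcongr
      _ = _ := by rw [add_assoc, ← EReal.coe_add, add_halves]
  · rw [hV]
    exact h.bellman_lower hM hW ht' hP hs hst hu

theorem exists_step (hM : M.Standing) (ht : 0 ≤ t) (htT : t < M.T) :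
    ∃ t' o, M.Step t t' o ∧ ((∃ j, o = some j) ∨ t' = M.T) := by
  classical
  by_cases h : ∃ j, t < M.τ j
  · obtain ⟨j, hj, hmin⟩ := (Finset.univ.filter fun j => t < M.τ j).exists_min_image M.τ
      (by obtain ⟨j, hj⟩ := h; exact ⟨j, by simpa using hj⟩)
    simp only [Finset.mem_filter, Finset.mem_univ, true_and] at hj hmin
    refine ⟨M.τ j, some j, ⟨ht, hj, (hM.τ_mem j).2.le, hmin, fun i => ?_⟩, Or.inl ⟨j, rfl⟩⟩
    rw [hM.τ_mono.injective.eq_iff, Option.some_inj, eq_comm]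
  · push Not at h
    refine ⟨M.T, none, ⟨ht, htT, le_rfl, fun j hj => absurd hj (not_lt.2 (h j)), fun j => ?_⟩,
      Or.inr rfl⟩
    simp [(hM.τ_mem j).2.ne]

theorem programmable (hM : M.Standing) (hW : M.WellDefined) (ht : 0 ≤ t) (htT : t ≤ M.T) :
    Programmable M t := by
  classical
  -- The induction is on the number of observation times strictly after t.
  obtain ⟨N, hN⟩ : ∃ N, (Finset.univ.filter fun j => t < M.τ j).card = N := ⟨_, rfl⟩
  induction N using Nat.strong_induction_on generalizing t with
  | _ N ih =>
    rcases eq_or_lt_of_le htT with rfl | hlt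
    · exact programmable_terminal hM hW
    obtain ⟨t', o, h, ht'⟩ := exists_step hM ht hlt
    refine h.programmable hM hW ht' ?_
    rcases ht' with ⟨j, hj⟩ | rfl
    · refine ih _ ?_ (ht.trans h.lt.le) h.le_T rfl
      rw [← hN]
      refine Finset.card_lt_card ⟨fun i hi => ?_, fun hc => ?_⟩
      · simp only [Finset.mem_filter, Finset.mem_univ, true_and] at hi ⊢
        exact h.lt.trans hi
      · have h1 : M.τ j = t' := (h.obs j).2 hj
        have h2 : j ∈ Finset.univ.filter fun j => t < M.τ j := by simp [h1, h.lt]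
        have h3 := hc h2
        simp [h1] at h3
    · exact programmable_terminal hM hW

end Induction

/-! ### The dynamic programming principle after and before an observation. -/

section Principle

/-- The dynamic programming principle, for problems started before or after an observation. -/
theorem value_eq (hM : M.Standing) (hW : M.WellDefined) (hs : 0 ≤ s) (hsT : s < M.T)
    (hst : s ≤ t) (htT : t ≤ M.T) (hsp : M.Splittable ph s t ∨ t = M.T) (μ : Law d) :
    M.value ph s μ = ⨅ u ∈ M.controls ph s t μ,
      extIntegral M.P fun ω => M.runCost ph s t u ω + M.V t (u.X t ω) := by
  have := hM.prob
  have hP := programmable hM hW (hs.trans hst) htT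
  have hval : M.value ph s μ = ⨅ u ∈ M.controls ph s M.T μ, M.J ph s u := if_pos hsT
  have hL : ∀ u, M.Admissible ph s t μ u → LowerIntegrable M.P (M.runCost ph s t u) := fun u hu =>
    hu.lowerIntegrable_runCost hM (hW.negCost_lt ph s t μ hs hst htT u hu) hst subset_rfl subset_rfl
  have hm : ∀ u, M.Admissible ph s t μ u → AEMeasurable (fun ω => M.V t (u.X t ω)) M.P :=
    fun u hu => (hP.infProj.aemeasurable (M.P.map (u.X t))).comp_measurable
      (hu.measurable_X hM ⟨hst, le_rfl⟩)
  have hnt : ∀ u, M.Admissible ph s t μ u → (¬ ∀ᵐ ω ∂M.P, M.V t (u.X t ω) < ⊤) →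
      extIntegral M.P (fun ω => M.runCost ph s t u ω + M.V t (u.X t ω)) = ⊤ := by
    intro u hu hlt
    refine extIntegral_eq_top_of_not_ae ((hL u hu).aemeasurable.add (hm u hu)) fun hc => hlt ?_
    filter_upwards [hc, (hL u hu).ae_ne_bot] with ω h1 h2
    rw [lt_top_iff_ne_top] at h1 ⊢
    intro h3
    rw [h3, EReal.add_top_of_ne_bot h2] at h1
    exact h1 rfl
  rw [hval]
  refine le_antisymm (le_iInf₂ fun u hu => ?_) (le_iInf₂ fun u hu => ?_)
  · by_cases hlt : ∀ᵐ ω ∂M.P, M.V t (u.X t ω) < ⊤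
    · obtain ⟨hLV, hex⟩ := hP.continuation ph s μ u hs hst hsp hu hlt
      refine le_of_forall_pos_le_add_real fun ε hε => ?_
      obtain ⟨u', hu', hag, hle⟩ := hex ε hε
      refine (iInf₂_le u' hu').trans ?_
      have hu'' : M.Admissible ph s M.T μ u' := hu'
      have hneg' := hW.negCost_lt ph s M.T μ hs hsT.le le_rfl u' hu'
      have hsplit := hu''.runCost_split_start hM hneg' hst htT
      simp only [hag.runCost_eq subset_rfl subset_rfl] at hsplit
      have hL' : LowerIntegrable M.P (M.runCost .after t M.T u') :=
        hu''.lowerIntegrable_runCost hM hneg' hsT.le (Set.Icc_subset_Icc_left hst)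
          (window_mono hst le_rfl)
      rw [J_eq hM hW hs hsT.le hu', extIntegral_congr_ae hsplit, extIntegral_add (hL u hu) hL',
        extIntegral_add (hL u hu) hLV, add_assoc, add_assoc]
      gcongr
    · rw [hnt u hu hlt]
      exact le_top
  · have hu'' : M.Admissible ph s M.T μ u := hu
    have hur : M.Admissible ph s t μ u := hu''.restrict hst htT
    have hneg := hW.negCost_lt ph s M.T μ hs hsT.le le_rfl u hu
    have hL' : LowerIntegrable M.P (M.runCost .after t M.T u) :=
      hu''.lowerIntegrable_runCost hM hneg hsT.le (Set.Icc_subset_Icc_left hst)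
        (window_mono hst le_rfl)
    have hlow := hP.lower ph s μ u hs hst hu
    refine (iInf₂_le u hur).trans ?_
    rw [J_eq hM hW hs hsT.le hu,
      extIntegral_congr_ae (hu''.runCost_split_start hM hneg hst htT),
      extIntegral_add (hL u hur) hL', add_assoc]
    -- If the value at t is `⊤` with positive probability, the lower bound forces the remaining cost
    -- to be `⊤`; otherwise `continuation` supplies the lower integrability needed to split the
    -- integral.
    by_cases hlt : ∀ᵐ ω ∂M.P, M.V t (u.X t ω) < ⊤
    · obtain ⟨hLV, -⟩ := hP.continuation ph s μ u hs hst hsp hur hlt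
      rw [extIntegral_add (hL u hur) hLV]
      gcongr
    · rw [extIntegral_eq_top_of_not_ae (hm u hur) hlt, top_le_iff] at hlow
      rw [hlow, EReal.add_top_of_ne_bot (hL u hur).extIntegral_ne_bot]
      exact le_top

theorem V_eq (hM : M.Standing) (hW : M.WellDefined) (hs : 0 ≤ s) (hsT : s < M.T)
    (hst : s ≤ t) (htT : t ≤ M.T)
    (h : (∃ A B, M.U = A ×ˢ B) ∨ t ∈ Set.range M.τ ∨ t = M.T) (μ : Law d) :
    M.V s μ = ⨅ u ∈ M.controls .after s t μ,
      extIntegral M.P fun ω => M.runCost .after s t u ω + M.V t (u.X t ω) := by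
  refine value_eq hM hW hs hsT hst htT ?_ μ
  rcases h with h | ⟨j, hj⟩ | h
  · exact Or.inl (Or.inl h)
  · rcases eq_or_lt_of_le hst with rfl | hlt
    · exact Or.inl (Or.inr (Or.inr rfl))
    · refine Or.inl (Or.inr (Or.inl ⟨j, ?_, hj⟩))
      rw [mem_window, hj]
      exact ⟨Or.inl hlt, le_rfl⟩
  · exact Or.inr h

theorem window_before_self (hM : M.Standing) (i j : Fin n) :
    j ∈ M.window .before (M.τ i) (M.τ i) ↔ some i = some j := by
  rw [mem_window, Option.some_inj]
  constructor
  · rintro ⟨h1 | ⟨-, h1⟩, h2⟩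
    · exact absurd h2 (not_le.2 h1)
    · exact (hM.τ_mono.injective h1).symm
  · rintro rfl
    exact ⟨Or.inr ⟨rfl, rfl⟩, le_rfl⟩

theorem runCost_before_self (hM : M.Standing) (i : Fin n) (u : Controlled d k₁ k₂ n Ω) (ω : Ω) :
    M.runCost .before (M.τ i) (M.τ i) u ω = M.h (M.τ i) (u.Xm i ω) (u.β (M.τ i) ω) := by
  have h1 : M.window .before (M.τ i) (M.τ i) = {i} := by
    ext j
    rw [window_before_self hM]
    simp [eq_comm]
  unfold runCost
  rw [h1, Set.Icc_self, Measure.restrict_singleton, Real.volume_singleton, zero_smul,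
    Finset.sum_singleton]
  simp [extIntegral]

/-- This is the principle on the degenerate interval at the observation time, where the only cost is
that of the measurement and the only relevant choice is a deterministic precision. -/
theorem Vleft_eq (hM : M.Standing) (hW : M.WellDefined) (i : Fin n) (μ : Law d) :
    M.Vleft (M.τ i) μ = ⨅ c ∈ M.U, (M.h (M.τ i) μ c.2 + extIntegral M.P fun ω =>
      M.V (M.τ i) (M.update c.2 μ (M.obs (M.τ i) μ c.2 (M.Γ i ω)))) := by
  have := hM.prob
  have h0 : 0 ≤ M.τ i := (hM.τ_mem i).1.le
  have hT := (hM.τ_mem i).2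
  have hP := programmable hM hW h0 hT.le
  have hi : i ∈ M.window .before (M.τ i) (M.τ i) := (window_before_self hM i i).2 rfl
  have hsp : M.Splittable .before (M.τ i) (M.τ i) := Or.inr (Or.inr rfl)
  -- the cost of a deterministic precision
  have key : ∀ c ∈ M.U, extIntegral M.P (fun ω => M.h (M.τ i) μ c.2
        + M.V (M.τ i) (M.post (some i) (c.2, μ) ω))
      = M.h (M.τ i) μ c.2 + extIntegral M.P fun ω => M.V (M.τ i) (M.post (some i) (c.2, μ) ω) := by
    intro c hc
    have hu : M.Admissible .before (M.τ i) (M.τ i) μ (M.pointControl (some i) c μ) :=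
      admissible_pointControl hM hc μ (window_before_self hM i)
    have hneg := hW.negCost_lt _ _ _ μ h0 le_rfl hT.le _ hu
    have hL := hu.lowerIntegrable_runCost hM hneg le_rfl subset_rfl subset_rfl
    have hLh : LowerIntegrable M.P fun _ : Ω => M.h (M.τ i) μ c.2 :=
      hL.congr (ae_of_all _ fun ω => runCost_before_self hM i _ ω)
    have hm : AEMeasurable (fun ω => M.V (M.τ i) (M.post (some i) (c.2, μ) ω)) M.P :=
      (hP.infProj.aemeasurable (M.P.map _)).comp_measurable
        (hu.measurable_X hM ⟨le_rfl, le_rfl⟩)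
    by_cases hlt : ∀ᵐ ω ∂M.P, M.V (M.τ i) (M.post (some i) (c.2, μ) ω) < ⊤
    · obtain ⟨hLV, -⟩ := hP.continuation _ _ μ _ h0 le_rfl (Or.inl hsp) hu hlt
      have hLV' : LowerIntegrable M.P fun ω => M.V (M.τ i) (M.post (some i) (c.2, μ) ω) := hLV
      rw [extIntegral_add hLh hLV', extIntegral_const]
    -- Lower integrability of the constant measurement cost excludes the value `⊥`, so both sides
    -- equal `⊤`.
    · obtain ⟨ω₀, hω₀⟩ := hLh.ae_ne_bot.exists
      rw [extIntegral_eq_top_of_not_ae hm hlt, EReal.add_top_of_ne_bot hω₀]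
      refine extIntegral_eq_top_of_not_ae (hLh.aemeasurable.add hm) fun hc => hlt ?_
      filter_upwards [hc] with ω h1
      rw [lt_top_iff_ne_top] at h1 ⊢
      intro h3
      rw [h3, EReal.add_top_of_ne_bot hω₀] at h1
      exact h1 rfl
  have hval := value_eq hM hW h0 hT le_rfl hT.le (Or.inl hsp) μ
  unfold Vleft
  rw [hval]
  refine le_antisymm (le_iInf₂ fun c hc => ?_) (le_iInf₂ fun u hu => ?_)
  · have hu : M.Admissible .before (M.τ i) (M.τ i) μ (M.pointControl (some i) c μ) :=
      admissible_pointControl hM hc μ (window_before_self hM i)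
    refine (iInf₂_le _ hu).trans (le_of_eq ((extIntegral_congr_ae (ae_of_all _ fun ω => ?_)).trans
      (key c hc)))
    rw [runCost_before_self hM]
    rfl
  · have hu' : M.Admissible .before (M.τ i) (M.τ i) μ u := hu
    -- Nothing has been observed yet: the precision is measurable for the trivial σ-algebra, hence
    -- constant, so an admissible control reduces to one pair in U.
    have hbot : M.sigmaBefore .before (M.τ i) (M.τ i) u (M.τ i) = ⊥ := by
      refine le_antisymm (iSup₂_le fun j hj => iSup_le fun h => ?_) bot_le
      exact absurd h (not_lt.2 (window_le hj).1)
    have hβ := hu'.β_predictable (M.τ i) ⟨le_rfl, le_rfl⟩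
    rw [hbot] at hβ
    obtain ⟨ω₀⟩ : Nonempty Ω := M.P.nonempty_of_neZero
    have hconst : ∀ ω, u.β (M.τ i) ω = u.β (M.τ i) ω₀ := by
      intro ω
      have h1 := hβ (measurableSet_singleton (u.β (M.τ i) ω₀))
      rw [MeasurableSpace.measurableSet_bot_iff] at h1
      rcases h1 with h1 | h1
      · exact absurd (show ω₀ ∈ u.β (M.τ i) ⁻¹' {u.β (M.τ i) ω₀} from rfl) (h1 ▸ id)
      · exact h1.symm.subset (Set.mem_univ ω)
    have hc := hu'.mem_U (M.τ i) ⟨le_rfl, le_rfl⟩ ω₀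
    refine (iInf₂_le _ hc).trans (le_of_eq ((key _ hc).symm.trans (extIntegral_congr_ae ?_)))
    filter_upwards [hu'.dynamics] with ω hω
    have h1 : u.Xm i ω = μ := hω.start_before i hi rfl
    have h2 : u.X (M.τ i) ω = M.update (u.β (M.τ i) ω) (u.Xm i ω) (M.Y u i ω) := hω.jump i hi
    rw [runCost_before_self hM, h2, Y, h1, hconst ω]
    rfl

end Principle

end Model

end ObsControl

end

theorem theorem3p3 {d m k₁ k₂ n : ℕ} {𝒴 G Ω : Type*}
    [MeasurableSpace 𝒴] [MeasurableSpace G] [MeasurableSpace Ω]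
    (M : ObsControl.Model d m k₁ k₂ n 𝒴 G Ω) (hM : M.Standing) (hW : M.WellDefined) :
    (∀ (s t : ℝ) (μ : ObsControl.Law d), 0 ≤ s → s < M.T → s ≤ t → t ≤ M.T →
      ((∃ A B, M.U = A ×ˢ B) ∨ t ∈ Set.range M.τ ∨ t = M.T) →
      M.V s μ = ⨅ u ∈ M.controls .after s t μ,
        ObsControl.extIntegral M.P fun ω => M.runCost .after s t u ω + M.V t (u.X t ω)) ∧
    (∀ (i : Fin n) (μ : ObsControl.Law d),
      M.Vleft (M.τ i) μ = ⨅ c ∈ M.U,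
        (M.h (M.τ i) μ c.2 + ObsControl.extIntegral M.P fun ω =>
          M.V (M.τ i) (M.update c.2 μ (M.obs (M.τ i) μ c.2 (M.Γ i ω))))) :=
  ⟨fun _ _ μ hs hsT hst htT h => ObsControl.Model.V_eq hM hW hs hsT hst htT h μ,
    fun i μ => ObsControl.Model.Vleft_eq hM hW i μ⟩
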